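/- For $\rho>0$ let $B_\rho\subset\mathbb R^3$ be the open ball of radius $\rho$ centred at the origin, placed in the uniform applied field $H_{0,\mathrm{ex}}=\mathbf e_z$, where $\mathbf e_z=(0,0,1)$. *The field $B_0$.* Let $(e^{i\phi_0},A_0)$ be the Meissner state: $\phi_0\in H^1(B_\rho)$ has zero mean, $A_0\in H^1_{\mathrm{loc}}(\mathbb R^3,\mathbb R^3)$ satisfies $\operatorname{div}A_0=0$ and $\operatorname{curl}A_0-\mathbf e_z\in L^2(\mathbb R^3)$, and $(\phi_0,A_0)$ minimizes $$\frac12\int_{B_\rho}|\nabla\phi-A|^2+\frac12\int_{\mathbb R^3}|\operatorname{curl}A-\mathbf e_z|^2$$ among all $\phi\in H^1(B_\rho)$ and $A\in H^1_{\mathrm{loc}}(\mathbb R^3,\mathbb R^3)$ with $\operatorname{curl}A-\mathbf e_z\in L^2(\mathbb R^3)$. Let $B_0$ be the Lipschitz vector field on $\overline{B_\rho}$ with $\operatorname{div}B_0=0$ and $\operatorname{curl}B_0=A_0-\nabla\phi_0$ in $B_\rho$, and $B_0\times\nu=0$ on $\partial B_\rho$, where $\nu$ is the outer unit normal. *The ratio.*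 For a normal $1$-current $\Gamma\neq0$ supported in $\overline{B_\rho}$ with boundary supported on $\partial B_\rho$, put $\mathrm R(\Gamma)=\langle B_0,\Gamma\rangle/|\Gamma|$, where $|\Gamma|$ is the mass; for a curve this is the circulation of $B_0$ along $\Gamma$ divided by the length of $\Gamma$. Let $\Gamma_0(z)=(0,0,z-\rho)$, $z\in[0,L_0]$, $L_0=2\rho$, be the vertical diameter. *Tube coordinates.* Tube coordinates around $\Gamma_0$ are given by a diffeomorphism $\Phi$, smooth up to the boundary, from a cylinder $\{w\in\mathbb R^2:|w|<\delta\}\times[0,L_0]$ onto a neighbourhood of $\Gamma_0$ in $\overline{B_\rho}$, such that $\Phi(0,z)=\Gamma_0(z)$, such that $\partial_z\Phi$ is orthogonal to $\partial_{w_1}\Phi$ and $\partial_{w_2}\Phi$, and such that $\Phi$ maps the two end discs $\{z=0\}$ and $\{z=L_0\}$ into $\partial B_\rho$. **Proposition.** There is $\rho_0>0$ such that for every $0<\rho<\rho_0$ the diameter $\Gamma_0$ satisfies the strong nondegeneracy condition: 1. $\Gamma_0$ maximizes $\mathrm R$ among all nonzero normal $1$-currents supported in $\overline{B_\rho}$ with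 boundary supported on $\partial B_\rho$; 2. for every choice of tube coordinates $\Phi$ around $\Gamma_0$ and every $u\in H^1((0,L_0),\mathbb R^2)$, with $\Gamma_t(z)=\Phi(tu(z),z)$, the second derivative $\frac{d^2}{dt^2}\big|_{t=0}\mathrm R(\Gamma_t)$ exists, and $$Q(u)=-\frac{d^2}{dt^2}\Big|_{t=0}\mathrm R(\Gamma_t)$$ is a positive definite quadratic form on $H^1((0,L_0),\mathbb R^2)$: there is $c>0$ (depending on $\rho$ and $\Phi$) with $Q(u)\ge c\,\|u\|_{H^1}^2$ for all $u$. -/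

import Mathlib

open MeasureTheory Set Filter Topology
open scoped ContDiff

namespace Isoflux

/-- Euclidean space of dimension three. -/
abbrev E3 := EuclideanSpace ℝ (Fin 3)

/-- Euclidean plane. -/
abbrev E2 := EuclideanSpace ℝ (Fin 2)

/-- The standard basis vectors of `E3`. -/
noncomputable def basisVec (j : Fin 3) : E3 := EuclideanSpace.single j (1 : ℝ)

/-- The vertical unit vector. -/
noncomputable def eZ : E3 := basisVec 2

/-! ### Weak derivatives, the Meissner state and its field -/

/-- Smooth functions with compact support contained in `U`. -/
def IsTest {F : Type*} [NormedAddCommGroup F] [NormedSpace ℝ F] (U : Set E3) (η : E3 → F) : Prop :=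
  ContDiff ℝ ∞ η ∧ HasCompactSupport η ∧ tsupport η ⊆ U

/-- `g` is the weak partial derivative of `f` in the direction `j` on the open set `U`. -/
def IsWeakPartial (U : Set E3) (j : Fin 3) (f g : E3 → ℝ) : Prop :=
  LocallyIntegrableOn f U ∧ LocallyIntegrableOn g U ∧
    ∀ η : E3 → ℝ, IsTest U η →
      ∫ x in U, f x * fderiv ℝ η x (basisVec j) = -∫ x in U, g x * η x

/-- `φ` belongs to the Sobolev space `H¹(U)` and `G` is its weak gradient. -/
structure MemH1 (U : Set E3) (φ : E3 → ℝ) (G : E3 → E3) : Prop where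
  memLp : MemLp φ 2 (volume.restrict U)
  memLp_grad : MemLp G 2 (volume.restrict U)
  weak : ∀ j, IsWeakPartial U j φ (fun x => G x j)

/-- `A` belongs to `H¹_loc(ℝ³, ℝ³)` and `D` is its weak Jacobian, `D x i j = ∂_j A_i (x)`. -/
structure MemH1Loc (A : E3 → E3) (D : E3 → Matrix (Fin 3) (Fin 3) ℝ) : Prop where
  memLp : ∀ K : Set E3, IsCompact K → MemLp A 2 (volume.restrict K)
  memLp_deriv : ∀ K : Set E3, IsCompact K → ∀ i j,
    MemLp (fun x => D x i j) 2 (volume.restrict K)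
  weak : ∀ i j, IsWeakPartial univ j (fun x => A x i) (fun x => D x i j)

/-- The curl read off from a Jacobian matrix `M i j = ∂_j A_i`. -/
noncomputable def curlOf (M : Matrix (Fin 3) (Fin 3) ℝ) : E3 :=
  !₂[M 2 1 - M 1 2, M 0 2 - M 2 0, M 1 0 - M 0 1]

/-- The classical curl of a vector field. -/
noncomputable def curl (X : E3 → E3) (x : E3) : E3 :=
  curlOf (Matrix.of fun i j => fderiv ℝ X x (basisVec j) i)

/-- The class `A_ex + H_curl` of vector potentials for the applied field `Hex`, where
`H_curl = {A ∈ H¹_loc(ℝ³, ℝ³) | curl A ∈ L²(ℝ³)}`, `A_ex ∈ H¹_loc` and `curl A_ex = Hex`. -/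
structure Admissible (Hex : E3 → E3) (A : E3 → E3) (D : E3 → Matrix (Fin 3) (Fin 3) ℝ) : Prop where
  memH1Loc : MemH1Loc A D
  memLp_curl : MemLp (fun x => curlOf (D x) - Hex x) 2 volume

/-- The Ginzburg-Landau energy of `(u, A)` with `u = exp (i φ)` (so that `|u| = 1` and
`|∇_A u| = |∇φ - A|`), where `G = ∇φ` and `D` is the Jacobian of `A`. -/
noncomputable def meissnerEnergy (Ω : Set E3) (Hex : E3 → E3) (A : E3 → E3)
    (D : E3 → Matrix (Fin 3) (Fin 3) ℝ) (G : E3 → E3) : ℝ :=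
  (1 / 2) * (∫ x in Ω, ‖G x - A x‖ ^ 2) + (1 / 2) * (∫ x, ‖curlOf (D x) - Hex x‖ ^ 2)

/-- `(exp (i φ), A)` is the Meissner state of `Ω` in the applied field `Hex`, in the gauge
`div A = 0` and with the phase normalized to have zero mean; `D` and `G` are the weak Jacobian
of `A` and the weak gradient of `φ`. -/
structure IsMeissnerState (Ω : Set E3) (Hex : E3 → E3) (A : E3 → E3)
    (D : E3 → Matrix (Fin 3) (Fin 3) ℝ) (φ : E3 → ℝ) (G : E3 → E3) : Prop where
  admissible : Admissible Hex A D
  phase : MemH1 Ω φ G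
  gauge : ∀ᵐ x, (D x).trace = 0
  mean_zero : ∫ x in Ω, φ x = 0
  minimal : ∀ (A' : E3 → E3) (D' : E3 → Matrix (Fin 3) (Fin 3) ℝ) (φ' : E3 → ℝ) (G' : E3 → E3),
    Admissible Hex A' D' → MemH1 Ω φ' G' →
      meissnerEnergy Ω Hex A D G ≤ meissnerEnergy Ω Hex A' D' G'

/-- `B` is the Meissner magnetic field of the ball of radius `ρ` in the uniform vertical unit
field: a Lipschitz field on the closed ball with `B × ν = 0` on the sphere (i.e. `B` has no
tangential component there), `div B = 0`, and `curl B = A₀ - ∇φ₀` in the ball, where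
`(exp (i φ₀), A₀)` is the Meissner state. -/
def IsMeissnerField (ρ : ℝ) (B : E3 → E3) : Prop :=
  ∃ (A : E3 → E3) (D : E3 → Matrix (Fin 3) (Fin 3) ℝ) (φ : E3 → ℝ) (G : E3 → E3),
    IsMeissnerState (Metric.ball 0 ρ) (fun _ => eZ) A D φ G ∧
    (∃ K, LipschitzOnWith K B (Metric.closedBall 0 ρ)) ∧
    (∀ x ∈ Metric.sphere (0 : E3) ρ, ∀ w : E3, inner ℝ x w = 0 → inner ℝ (B x) w = 0) ∧
    (∀ η : E3 → ℝ, IsTest (Metric.ball 0 ρ) η →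
      ∫ x in Metric.ball 0 ρ, fderiv ℝ η x (B x) = 0) ∧
    (∀ X : E3 → E3, IsTest (Metric.ball 0 ρ) X →
      ∫ x in Metric.ball 0 ρ, inner ℝ (B x) (curl X x) =
        ∫ x in Metric.ball 0 ρ, inner ℝ (A x - G x) (X x))

/-! ### One-dimensional currents and the ratio -/

/-- A `1`-current of finite mass in `ℝ³`, given by its polar decomposition `τ μ` with `μ` a finite
measure and `|τ| = 1` almost everywhere; it acts on a field `X` by `∫ X · τ dμ`. -/
structure FiniteMassCurrent where
  μ : Measure E3
  finite : IsFiniteMeasure μ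
  τ : E3 → E3
  measurable_τ : Measurable τ
  unit : ∀ᵐ x ∂μ, ‖τ x‖ = 1

/-- The mass of a current. -/
noncomputable def FiniteMassCurrent.mass (T : FiniteMassCurrent) : ℝ := T.μ.real univ

/-- The value of a current on a vector field. -/
noncomputable def FiniteMassCurrent.pairing (T : FiniteMassCurrent) (B : E3 → E3) : ℝ :=
  ∫ x, inner ℝ (B x) (T.τ x) ∂T.μ

/-- The normal `1`-currents supported in the closed ball of radius `ρ` whose boundary
(a difference of two finite measures) is supported on the sphere. -/
def normalCurrents (ρ : ℝ) : Set FiniteMassCurrent :=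
  {T | T.μ (Metric.closedBall 0 ρ)ᶜ = 0 ∧
    ∃ ν₁ ν₂ : Measure E3, IsFiniteMeasure ν₁ ∧ IsFiniteMeasure ν₂ ∧
      ν₁ (Metric.sphere 0 ρ)ᶜ = 0 ∧ ν₂ (Metric.sphere 0 ρ)ᶜ = 0 ∧
      ∀ η : E3 → ℝ, IsTest univ η →
        ∫ x, fderiv ℝ η x (T.τ x) ∂T.μ = ∫ x, η x ∂ν₁ - ∫ x, η x ∂ν₂}

/-- The isoflux ratio of a current. -/
noncomputable def ratio (B : E3 → E3) (T : FiniteMassCurrent) : ℝ := T.pairing B / T.mass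

/-- The vertical diameter of the ball of radius `ρ`, oriented upwards, as a current. -/
noncomputable def diameterCurrent (ρ : ℝ) : FiniteMassCurrent where
  μ := Measure.map (fun s : ℝ => s • eZ) (volume.restrict (Icc (-ρ) ρ))
  finite := inferInstance
  τ := fun _ => eZ
  measurable_τ := measurable_const
  unit := by simp [eZ, basisVec]

/-- The ratio (circulation divided by length) of an absolutely continuous curve
`γ : [0, L] → ℝ³`. -/
noncomputable def curveRatio (B : E3 → E3) (L : ℝ) (γ : ℝ → E3) : ℝ :=
  (∫ z in (0 : ℝ)..L, inner ℝ (B (γ z)) (deriv γ z)) / ∫ z in (0 : ℝ)..L, ‖deriv γ z‖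

/-! ### Tube coordinates around the diameter -/

/-- The arclength parametrization of the vertical diameter by `[0, 2ρ]`. -/
noncomputable def diameterCurve (ρ z : ℝ) : E3 := (z - ρ) • eZ

/-- The cylinder `{|u| < δ} × [0, L]`. -/
def cylinder (δ L : ℝ) : Set (E2 × ℝ) := Metric.ball 0 δ ×ˢ Icc 0 L

/-- `Φ` is (the inverse of) a system of tube coordinates around the vertical diameter in the
closed ball of radius `ρ`, defined on the cylinder of radius `δ` over `[0, 2ρ]`: a diffeomorphism,
smooth up to the boundary, onto a neighbourhood of the diameter in the closed ball, such that the
axis is mapped to the diameter by arclength, `g₁₃ = g₂₃ = 0` for the pulled back Euclidean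
metric, and the two end discs are mapped into the sphere. -/
structure IsTubeChart (ρ δ : ℝ) (Φ : E2 × ℝ → E3) : Prop where
  pos : 0 < δ
  smooth : ContDiffOn ℝ ∞ Φ (cylinder δ (2 * ρ))
  injOn : InjOn Φ (cylinder δ (2 * ρ))
  invertible : ∀ p ∈ cylinder δ (2 * ρ),
    Function.Bijective (fderivWithin ℝ Φ (cylinder δ (2 * ρ)) p)
  mapsTo : MapsTo Φ (cylinder δ (2 * ρ)) (Metric.closedBall 0 ρ)
  image_nhds : ∀ z ∈ Icc 0 (2 * ρ),
    Φ '' cylinder δ (2 * ρ) ∈ 𝓝[Metric.closedBall 0 ρ] diameterCurve ρ z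
  axis : ∀ z ∈ Icc 0 (2 * ρ), Φ (0, z) = diameterCurve ρ z
  orthogonal : ∀ p ∈ cylinder δ (2 * ρ), ∀ h : E2,
    inner ℝ (fderivWithin ℝ Φ (cylinder δ (2 * ρ)) p (h, 0))
      (fderivWithin ℝ Φ (cylinder δ (2 * ρ)) p (0, 1)) = 0
  bottom : ∀ w ∈ Metric.ball (0 : E2) δ, Φ (w, 0) ∈ Metric.sphere 0 ρ
  top : ∀ w ∈ Metric.ball (0 : E2) δ, Φ (w, 2 * ρ) ∈ Metric.sphere 0 ρ

/-! ### The Sobolev space `H¹((0, L), ℝ²)` and the second variation -/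

/-- `H¹((0, L), ℝ²)`: a function `u` in this space is the same as its initial value `u(0)` together
with its weak derivative `u' ∈ L²((0, L), ℝ²)`. -/
abbrev H1 (L : ℝ) := E2 × Lp E2 2 (volume.restrict (Ioo 0 L))

/-- The continuous representative on `[0, L]` of an element of `H¹((0, L), ℝ²)`. -/
noncomputable def H1.eval {L : ℝ} (u : H1 L) (z : ℝ) : E2 := u.1 + ∫ s in (0 : ℝ)..z, u.2 s

/-- The square of the `H¹` norm, `∫ |u|² + |u'|²`. -/
noncomputable def H1.normSq {L : ℝ} (u : H1 L) : ℝ :=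
  (∫ z in Ioo 0 L, ‖H1.eval u z‖ ^ 2) + ∫ z in Ioo 0 L, ‖u.2 z‖ ^ 2

/-- The curve `z ↦ Γ₀(z) + t u(z)`, `z ∈ [0, L]`, written in the tube coordinates `Φ`. -/
noncomputable def graphCurve {L : ℝ} (Φ : E2 × ℝ → E3) (u : H1 L) (t z : ℝ) : E3 :=
  Φ (t • H1.eval u z, z)

/-- `f` is differentiable near `t`, and its derivative has derivative `q` at `t`. -/
def HasSecondDerivAt (f : ℝ → ℝ) (q t : ℝ) : Prop :=
  ∃ f' : ℝ → ℝ, (∀ᶠ s in 𝓝 t, HasDerivAt f (f' s) s) ∧ HasDerivAt f' q t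

/-- The vertical diameter of the ball of radius `ρ` maximizes the ratio for the field `B` among
normal currents. -/
def DiameterMaximizes (ρ : ℝ) (B : E3 → E3) : Prop :=
  diameterCurrent ρ ∈ normalCurrents ρ ∧
    ∀ T ∈ normalCurrents ρ, T.mass ≠ 0 → ratio B T ≤ ratio B (diameterCurrent ρ)

/-- The strong nondegeneracy condition for the vertical diameter of the ball of radius `ρ`: it
maximizes the ratio and, in any tube coordinates, minus the second variation of the ratio at the
diameter is a quadratic form on `H¹((0, 2ρ), ℝ²)` which is positive definite. -/
def StronglyNondegenerate (ρ : ℝ) (B : E3 → E3) : Prop :=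
  DiameterMaximizes ρ B ∧
    ∀ (δ : ℝ) (Φ : E2 × ℝ → E3), IsTubeChart ρ δ Φ →
      ∃ Q : QuadraticForm ℝ (H1 (2 * ρ)),
        (∀ u : H1 (2 * ρ),
          HasSecondDerivAt (fun t => curveRatio B (2 * ρ) (graphCurve Φ u t)) (-Q u) 0) ∧
        ∃ c : ℝ, 0 < c ∧ ∀ u : H1 (2 * ρ), c * H1.normSq u ≤ Q u

end Isoflux

/-!
# The vertical diameter of a ball is strongly nondegenerate

The Meissner state of a ball in a uniform field is explicit, and a calibration built from it gives
both the maximality of the diameter and the second variation. The argument works for every radius.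

*The field.* Let `F` be the regular solution of `4 s F'' + 10 F' = F` (`london`). For a suitable
amplitude `C`, the potential `A x = C F(‖x‖²) (e_z × x)` inside the ball, continued outside by a
uniform field plus a dipole, satisfies with zero phase the Euler-Lagrange equations of the Meissner
energy (`eulerLagrange_potential`, `eulerLagrange_phase`). Competitors have no prescribed decay, so
these equations are tested with compactly supported fields approximating the induced field, which
are dominated by the decay of a dipole. The energy is strictly convex in `A - ∇φ`, so every Meissner
state has this supercurrent in the ball (`IsMeissnerState.current_eq`). An explicit field
`meissnerB` has it as its curl, is divergence free and is normal to the sphere. A Lipschitz field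
with these properties is unique (`eq_zero_of_div_curl`): the mollification of a difference of two is
the gradient of a harmonic function which is almost constant on a sphere close to the boundary, so
the weak maximum principle applies.

*The calibration.* Let `G` be the average of `F` along rays, `G + 2 s G' = F` (`londonMean`). The
function `ψ x = 2 C x₂ (G(ρ²) - G(‖x‖²))` vanishes on the sphere, and `V = meissnerB - ∇ψ`
(`calibration`) equals `R₀ e_z + q(‖x‖²) (x₂ x_h - ‖x_h‖² e_z)`, where `x_h` is the horizontal part
of `x`, `q = 2 C (F' + 2 G')` is positive and increasing, and `R₀ = ρ² q(ρ²)`. Since `s q(s) ≤ R₀` in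
the ball, `‖V‖ ≤ R₀`, with equality on the diameter, where `V = R₀ e_z`. A normal current with
boundary on the sphere does not see `∇ψ`, so its ratio is at most `R₀`, the ratio of the diameter
(`diameterMaximizes`).

*The second variation.* The end points of a curve in tube coordinates are on the sphere, so `∇ψ`
drops out of its circulation too. Hence its ratio is `R₀` minus the integral of the defect
`R₀ ‖γ'‖ - V(γ) · γ'` divided by its length. The defect is nonnegative and vanishes at the diameter,
so that its second order expansion only involves the first order changes `y` of the horizontal
position and `y'` of the horizontal velocity (`tendsto_defect_div_sq`), and minus the second
derivative of the ratio is
`(2ρ)⁻¹ ∫ R₀ ‖y'‖² - 2 q ζ y · y' + 2 q ‖y‖²` with `ζ = z - ρ`, `q = q(ζ²)`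
(`IsTubeChart.hasSecondDerivAt_curveRatio`). The density is positive definite because
`ζ² q(ζ²) ≤ R₀`, hence uniformly so in `(u, u')` by compactness of `[0, 2ρ]`, as the differential of
the chart is invertible (`exists_quadraticForm`).
-/

open scoped Convolution

namespace Isoflux

/-! ### Entire power series with factorially decaying coefficients -/

/-- The sum of the power series with coefficients `a`. -/
noncomputable def powerSum (a : ℕ → ℝ) (s : ℝ) : ℝ := ∑' n, a n * s ^ n

/-- The coefficients of the derivative of the power series with coefficients `a`. -/
def shiftCoeff (a : ℕ → ℝ) (n : ℕ) : ℝ := (n + 1) * a (n + 1)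

/-- A bound on the coefficients that makes the power series entire and that is inherited by its
derivative. -/
def FactorialBound (a : ℕ → ℝ) : Prop := ∀ n, |a n| ≤ (n.factorial : ℝ)⁻¹

theorem FactorialBound.shift {a : ℕ → ℝ} (ha : FactorialBound a) :
    FactorialBound (shiftCoeff a) := by
  intro n
  have h := ha (n + 1)
  have hn : (0 : ℝ) < n + 1 := by positivity
  rw [shiftCoeff, abs_mul, abs_of_pos hn]
  calc ((n : ℝ) + 1) * |a (n + 1)| ≤ (n + 1) * ((n + 1).factorial : ℝ)⁻¹ := by gcongr
    _ = (n.factorial : ℝ)⁻¹ := by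
      rw [Nat.factorial_succ]; push_cast; field_simp

theorem FactorialBound.summable {a : ℕ → ℝ} (ha : FactorialBound a) (s : ℝ) :
    Summable fun n => a n * s ^ n := by
  refine Summable.of_norm_bounded (Real.summable_pow_div_factorial |s|) fun n => ?_
  rw [norm_mul, norm_pow, Real.norm_eq_abs, Real.norm_eq_abs, div_eq_inv_mul]
  exact mul_le_mul_of_nonneg_right (ha n) (by positivity)

theorem powerSum_hasDerivAt {a : ℕ → ℝ} (ha : FactorialBound a) (s : ℝ) :
    HasDerivAt (powerSum a) (powerSum (shiftCoeff a) s) s := by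
  set R : ℝ := |s| + 1
  have hu : Summable fun n : ℕ => |a n * n| * R ^ (n - 1) := by
    rw [← summable_nat_add_iff 1]
    have := (ha.shift.summable R).norm
    refine this.congr fun n => ?_
    have hR : |R| = R := abs_of_pos (by positivity)
    simp only [shiftCoeff, norm_mul, Real.norm_eq_abs, norm_pow, hR, abs_mul]
    push_cast
    ring_nf
  have key := hasDerivAt_tsum_of_isPreconnected (𝕜 := ℝ) (g := fun n y => a n * y ^ n)
    (g' := fun n y => a n * (n * y ^ (n - 1))) hu (t := Metric.ball 0 R) Metric.isOpen_ball
    (convex_ball _ _).isPreconnected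
    (fun n y _ => (hasDerivAt_pow n y).const_mul (a n))
    (fun n y hy => by
      have hy' : |y| ≤ R := by simpa using (Metric.mem_ball.1 hy).le
      rw [← mul_assoc, norm_mul, norm_pow, Real.norm_eq_abs, Real.norm_eq_abs]
      gcongr)
    (y₀ := 0) (by simp [R]; positivity) (ha.summable 0) (y := s) (by simp [R])
  have e : powerSum (shiftCoeff a) s = ∑' n, a n * (n * s ^ (n - 1)) := by
    have hs : Summable fun n : ℕ => a n * (n * s ^ (n - 1)) := by
      rw [← summable_nat_add_iff 1]
      refine (ha.shift.summable s).congr fun n => ?_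
      simp only [shiftCoeff, Nat.add_sub_cancel]; push_cast; ring
    rw [hs.tsum_eq_zero_add, powerSum]
    simp only [shiftCoeff, Nat.add_sub_cancel]; push_cast
    simp only [zero_mul, mul_zero, zero_add]
    exact tsum_congr fun n => by ring
  rw [e]; exact key

theorem powerSum_deriv {a : ℕ → ℝ} (ha : FactorialBound a) :
    deriv (powerSum a) = powerSum (shiftCoeff a) :=
  funext fun s => (powerSum_hasDerivAt ha s).deriv

theorem powerSum_contDiff {a : ℕ → ℝ} (ha : FactorialBound a) : ContDiff ℝ ∞ (powerSum a) := by
  rw [contDiff_infty]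
  intro n
  induction n generalizing a with
  | zero =>
    exact contDiff_zero.2
      (Differentiable.continuous fun s => (powerSum_hasDerivAt ha s).differentiableAt)
  | succ n ih =>
    push_cast
    rw [contDiff_succ_iff_deriv]
    refine ⟨fun s => (powerSum_hasDerivAt ha s).differentiableAt, by simp, ?_⟩
    rw [powerSum_deriv ha]
    exact ih ha.shift

theorem powerSum_lower {a : ℕ → ℝ} (ha : FactorialBound a) (h0 : ∀ n, 0 ≤ a n) {s : ℝ}
    (hs : 0 ≤ s) : a 0 ≤ powerSum a s := by
  have := (ha.summable s).le_tsum 0 (fun n _ => mul_nonneg (h0 n) (pow_nonneg hs n))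
  simpa [powerSum] using this

theorem powerSum_mono {a : ℕ → ℝ} (ha : FactorialBound a) (h0 : ∀ n, 0 ≤ a n) {s t : ℝ}
    (hs : 0 ≤ s) (hst : s ≤ t) : powerSum a s ≤ powerSum a t :=
  (ha.summable s).tsum_le_tsum
    (fun n => mul_le_mul_of_nonneg_left (pow_le_pow_left₀ hs hst n) (h0 n)) (ha.summable t)

/-- The operator `s d/ds` multiplies the coefficients of a power series by their index. -/
theorem mul_powerSum {a : ℕ → ℝ} (ha : FactorialBound a) (s : ℝ) :
    HasSum (fun n : ℕ => n * a n * s ^ n) (s * powerSum (shiftCoeff a) s) := by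
  have h := (ha.shift.summable s).hasSum.mul_left s
  refine (hasSum_nat_add_iff' 1).1 ?_
  simp only [Finset.range_one, Finset.sum_singleton, Nat.cast_zero, zero_mul, sub_zero]
  have e : (fun n : ℕ => ((n + 1 : ℕ) : ℝ) * a (n + 1) * s ^ (n + 1)) =
      fun n => s * (shiftCoeff a n * s ^ n) := by
    funext n
    simp only [shiftCoeff]; push_cast; ring
  rw [e]; exact h

/-! ### The radial profile of the London equation on a ball -/

/-- The coefficients `3 (2 n + 2) / (2 n + 3)!` of `3 (r cosh r - sinh r) / r ^ 3` as a power
series in `s = r ^ 2`. -/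
noncomputable def londonCoeff : ℕ → ℝ
  | 0 => 1
  | n + 1 => londonCoeff n / ((2 * n + 2) * (2 * n + 5))

/-- The coefficients of the average of the London profile along a ray. -/
noncomputable def meanCoeff (n : ℕ) : ℝ := londonCoeff n / (2 * n + 1)

theorem londonCoeff_pos (n : ℕ) : 0 < londonCoeff n := by
  induction n with
  | zero => simp [londonCoeff]
  | succ n ih => rw [londonCoeff]; positivity

theorem londonCoeff_bound : FactorialBound londonCoeff := by
  intro n
  rw [abs_of_pos (londonCoeff_pos n)]
  induction n with
  | zero => simp [londonCoeff]
  | succ n ih =>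
    rw [londonCoeff, Nat.factorial_succ, div_eq_inv_mul]
    push_cast
    rw [mul_inv ((n : ℝ) + 1)]
    refine mul_le_mul ?_ ih (londonCoeff_pos n).le (by positivity)
    apply inv_anti₀ (by positivity)
    have : (0 : ℝ) ≤ n := Nat.cast_nonneg n
    nlinarith [(Nat.cast_nonneg n : (0 : ℝ) ≤ n)]

theorem meanCoeff_pos (n : ℕ) : 0 < meanCoeff n := by
  have := londonCoeff_pos n
  rw [meanCoeff]; positivity

theorem meanCoeff_bound : FactorialBound meanCoeff := by
  intro n
  refine le_trans ?_ (londonCoeff_bound n)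
  rw [meanCoeff, abs_div]
  apply div_le_self (abs_nonneg _)
  rw [abs_of_pos (by positivity)]
  linarith [(Nat.cast_nonneg n : (0 : ℝ) ≤ n)]

/-- The regular solution `F` of `4 s F'' + 10 F' = F` with `F 0 = 1`; the field
`F (‖x‖²) (e_z × x)` is, up to a factor, the supercurrent of the Meissner state of a ball. -/
noncomputable def london : ℝ → ℝ := powerSum londonCoeff

/-- The solution `G` of `G + 2 s G' = F`, that is, the average of `F` along a ray. -/
noncomputable def londonMean : ℝ → ℝ := powerSum meanCoeff

theorem london_contDiff : ContDiff ℝ ∞ london := powerSum_contDiff londonCoeff_bound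

theorem londonMean_contDiff : ContDiff ℝ ∞ londonMean := powerSum_contDiff meanCoeff_bound

theorem london_ode (s : ℝ) :
    4 * s * deriv (deriv london) s + 10 * deriv london s = london s := by
  have h1 := (mul_powerSum londonCoeff_bound.shift s).mul_left 4
  have h2 := (londonCoeff_bound.shift.summable s).hasSum.mul_left 10
  have h3 := h1.add h2
  rw [london, powerSum_deriv londonCoeff_bound, powerSum_deriv londonCoeff_bound.shift, mul_assoc]
  refine h3.unique ?_
  change HasSum _ (∑' n, londonCoeff n * s ^ n)
  convert (londonCoeff_bound.summable s).hasSum using 2 with n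
  simp only [shiftCoeff, londonCoeff]
  field_simp; ring

theorem londonMean_ode (s : ℝ) : londonMean s + 2 * s * deriv londonMean s = london s := by
  have h1 := (mul_powerSum meanCoeff_bound s).mul_left 2
  have h2 := (meanCoeff_bound.summable s).hasSum
  have h3 := h2.add h1
  rw [londonMean, powerSum_deriv meanCoeff_bound, mul_assoc]
  refine h3.unique ?_
  change HasSum _ (∑' n, londonCoeff n * s ^ n)
  convert (londonCoeff_bound.summable s).hasSum using 2 with n
  rw [meanCoeff]
  field_simp; ring

theorem one_le_london {s : ℝ} (hs : 0 ≤ s) : 1 ≤ london s := by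
  simpa [londonCoeff, london] using
    powerSum_lower londonCoeff_bound (fun n => (londonCoeff_pos n).le) hs

theorem shiftCoeff_pos {a : ℕ → ℝ} (h : ∀ n, 0 < a n) (n : ℕ) : 0 < shiftCoeff a n := by
  have := h (n + 1)
  rw [shiftCoeff]; positivity

theorem deriv_london_pos {s : ℝ} (hs : 0 ≤ s) : 0 < deriv london s := by
  rw [london, powerSum_deriv londonCoeff_bound]
  exact (shiftCoeff_pos londonCoeff_pos 0).trans_le
    (powerSum_lower londonCoeff_bound.shift (fun n => (shiftCoeff_pos londonCoeff_pos n).le) hs)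

theorem deriv_london_mono {s t : ℝ} (hs : 0 ≤ s) (hst : s ≤ t) :
    deriv london s ≤ deriv london t := by
  rw [london, powerSum_deriv londonCoeff_bound]
  exact powerSum_mono londonCoeff_bound.shift
    (fun n => (shiftCoeff_pos londonCoeff_pos n).le) hs hst

theorem deriv_londonMean_pos {s : ℝ} (hs : 0 ≤ s) : 0 < deriv londonMean s := by
  rw [londonMean, powerSum_deriv meanCoeff_bound]
  exact (shiftCoeff_pos meanCoeff_pos 0).trans_le
    (powerSum_lower meanCoeff_bound.shift (fun n => (shiftCoeff_pos meanCoeff_pos n).le) hs)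

theorem deriv_londonMean_mono {s t : ℝ} (hs : 0 ≤ s) (hst : s ≤ t) :
    deriv londonMean s ≤ deriv londonMean t := by
  rw [londonMean, powerSum_deriv meanCoeff_bound]
  exact powerSum_mono meanCoeff_bound.shift
    (fun n => (shiftCoeff_pos meanCoeff_pos n).le) hs hst

/-! ### Axially symmetric fields -/

@[simp] theorem basisVec_apply (i j : Fin 3) : basisVec j i = if i = j then 1 else 0 := by
  simp [basisVec]

@[simp] theorem eZ_apply (i : Fin 3) : eZ i = if i = 2 then 1 else 0 := basisVec_apply i 2

theorem norm_sq_coord (x : E3) : ‖x‖ ^ 2 = x 0 ^ 2 + x 1 ^ 2 + x 2 ^ 2 := by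
  rw [EuclideanSpace.real_norm_sq_eq, Fin.sum_univ_three]

theorem inner_coord (x y : E3) : inner ℝ x y = x 0 * y 0 + x 1 * y 1 + x 2 * y 2 := by
  rw [PiLp.inner_apply, Fin.sum_univ_three]
  simp [mul_comm]

theorem ext_coord {x y : E3} (h0 : x 0 = y 0) (h1 : x 1 = y 1) (h2 : x 2 = y 2) : x = y := by
  ext i; fin_cases i <;> assumption

/-- The infinitesimal rotation `x ↦ e_z × x` about the vertical axis. -/
noncomputable def rot : E3 →L[ℝ] E3 :=
  (EuclideanSpace.proj (𝕜 := ℝ) (0 : Fin 3)).smulRight (basisVec 1) -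
    (EuclideanSpace.proj (𝕜 := ℝ) (1 : Fin 3)).smulRight (basisVec 0)

theorem rot_apply (x : E3) : rot x = x 0 • basisVec 1 - x 1 • basisVec 0 := by simp [rot]

@[simp] theorem rot_zero (x : E3) : rot x 0 = -x 1 := by simp [rot_apply]
@[simp] theorem rot_one (x : E3) : rot x 1 = x 0 := by simp [rot_apply]
@[simp] theorem rot_two (x : E3) : rot x 2 = 0 := by simp [rot_apply]

/-- The azimuthal field `f (‖x‖²) (e_z × x)`. -/
noncomputable def azim (f : ℝ → ℝ) (x : E3) : E3 := f (‖x‖ ^ 2) • rot x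

/-- The meridional field `a (‖x‖²) e_z + b (‖x‖²) x₂ x`, where `x₂` is the height. -/
noncomputable def polar (a b : ℝ → ℝ) (x : E3) : E3 :=
  a (‖x‖ ^ 2) • eZ + (b (‖x‖ ^ 2) * x 2) • x

/-- The derivative at `x` of the azimuthal field, where `c`, `c'` are the value and the derivative
of the profile. -/
noncomputable def azimD (c c' : ℝ) (x : E3) : E3 →L[ℝ] E3 :=
  c • rot + ((2 * c') • innerSL ℝ x).smulRight (rot x)

/-- The derivative at `x` of the meridional field, in terms of the values and the derivatives of
the profiles. -/
noncomputable def polarD (a' b b' : ℝ) (x : E3) : E3 →L[ℝ] E3 :=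
  ((2 * a') • innerSL ℝ x).smulRight eZ + (b * x 2) • ContinuousLinearMap.id ℝ E3 +
    ((2 * b' * x 2) • innerSL ℝ x + b • EuclideanSpace.proj (𝕜 := ℝ) (2 : Fin 3)).smulRight x

theorem hasFDerivAt_comp_normSq {f : ℝ → ℝ} {f' : ℝ} {x : E3} (hf : HasDerivAt f f' (‖x‖ ^ 2)) :
    HasFDerivAt (fun y : E3 => f (‖y‖ ^ 2)) ((2 * f') • innerSL ℝ x) x := by
  have h := hf.comp_hasFDerivAt x (hasStrictFDerivAt_norm_sq x).hasFDerivAt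
  refine h.congr_fderiv ?_
  ext v; simp; ring

theorem hasFDerivAt_azim {f : ℝ → ℝ} {f' : ℝ} {x : E3} (hf : HasDerivAt f f' (‖x‖ ^ 2)) :
    HasFDerivAt (azim f) (azimD (f (‖x‖ ^ 2)) f' x) x :=
  (hasFDerivAt_comp_normSq hf).smul rot.hasFDerivAt

theorem hasFDerivAt_polar {a b : ℝ → ℝ} {a' b' : ℝ} {x : E3} (ha : HasDerivAt a a' (‖x‖ ^ 2))
    (hb : HasDerivAt b b' (‖x‖ ^ 2)) :
    HasFDerivAt (polar a b) (polarD a' (b (‖x‖ ^ 2)) b' x) x := by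
  have h1 := (hasFDerivAt_comp_normSq ha).smul_const eZ
  have h2 := ((hasFDerivAt_comp_normSq hb).mul
    (EuclideanSpace.proj (𝕜 := ℝ) (2 : Fin 3)).hasFDerivAt).smul (hasFDerivAt_id (𝕜 := ℝ) x)
  refine (h1.add h2).congr_fderiv ?_
  ext v i
  simp [polarD]
  ring

/-- The Jacobian matrix of a linear map. -/
noncomputable def jacobian (L : E3 →L[ℝ] E3) : Matrix (Fin 3) (Fin 3) ℝ :=
  Matrix.of fun i j => L (basisVec j) i

theorem curl_eq_curlOf_jacobian (X : E3 → E3) (x : E3) :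
    curl X x = curlOf (jacobian (fderiv ℝ X x)) := rfl

@[simp] theorem curlOf_zero (M : Matrix (Fin 3) (Fin 3) ℝ) : curlOf M 0 = M 2 1 - M 1 2 := rfl
@[simp] theorem curlOf_one (M : Matrix (Fin 3) (Fin 3) ℝ) : curlOf M 1 = M 0 2 - M 2 0 := rfl
@[simp] theorem curlOf_two (M : Matrix (Fin 3) (Fin 3) ℝ) : curlOf M 2 = M 1 0 - M 0 1 := rfl

theorem curlOf_azimD (c c' : ℝ) (x : E3) :
    curlOf (jacobian (azimD c c' x)) =
      (2 * c + 2 * ‖x‖ ^ 2 * c') • eZ + (-2 * c' * x 2) • x := by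
  apply ext_coord <;> simp [jacobian, azimD, inner_coord, norm_sq_coord]
  ring

theorem trace_azimD (c c' : ℝ) (x : E3) : (jacobian (azimD c c' x)).trace = 0 := by
  simp [Matrix.trace, Fin.sum_univ_three, jacobian, azimD, inner_coord]; ring

theorem curlOf_polarD (a' b b' : ℝ) (x : E3) :
    curlOf (jacobian (polarD a' b b' x)) = (b - 2 * a') • rot x := by
  apply ext_coord <;> (simp [jacobian, polarD, inner_coord]; ring)

theorem trace_polarD (a' b b' : ℝ) (x : E3) :
    (jacobian (polarD a' b b' x)).trace = x 2 * (2 * a' + 2 * ‖x‖ ^ 2 * b' + 4 * b) := by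
  simp [Matrix.trace, Fin.sum_univ_three, jacobian, polarD, inner_coord, norm_sq_coord]; ring

theorem contDiff_azim {f : ℝ → ℝ} {n : WithTop ℕ∞} (hf : ContDiff ℝ n f) :
    ContDiff ℝ n (azim f) :=
  (hf.comp (contDiff_norm_sq ℝ)).smul rot.contDiff

theorem contDiff_polar {a b : ℝ → ℝ} {n : WithTop ℕ∞} (ha : ContDiff ℝ n a) (hb : ContDiff ℝ n b) :
    ContDiff ℝ n (polar a b) :=
  ((ha.comp (contDiff_norm_sq ℝ)).smul contDiff_const).add
    (((hb.comp (contDiff_norm_sq ℝ)).mul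
      (EuclideanSpace.proj (𝕜 := ℝ) (2 : Fin 3)).contDiff).smul contDiff_id)

theorem abs_coord_le (x : E3) (i : Fin 3) : |x i| ≤ ‖x‖ := by
  simpa using PiLp.norm_apply_le x i

@[simp] theorem norm_eZ : ‖eZ‖ = 1 := by simp [eZ, basisVec]

theorem norm_polar_le (a b : ℝ → ℝ) (x : E3) :
    ‖polar a b x‖ ≤ |a (‖x‖ ^ 2)| + |b (‖x‖ ^ 2)| * ‖x‖ ^ 2 := by
  refine (norm_add_le _ _).trans ?_
  rw [norm_smul, norm_smul, norm_eZ, mul_one, Real.norm_eq_abs, Real.norm_eq_abs, abs_mul]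
  have := abs_coord_le x 2
  have h : |b (‖x‖ ^ 2)| * |x 2| * ‖x‖ ≤ |b (‖x‖ ^ 2)| * ‖x‖ * ‖x‖ := by gcongr
  nlinarith

/-! ### Integration by parts -/

theorem IsTest.coord {U : Set E3} {X : E3 → E3} (hX : IsTest U X) (k : Fin 3) :
    IsTest U (fun x => X x k) := by
  have e : (fun x => X x k) = (EuclideanSpace.proj (𝕜 := ℝ) k) ∘ X := rfl
  have hs : tsupport (fun x => X x k) ⊆ tsupport X := by
    rw [e]; exact closure_mono (Function.support_comp_subset (map_zero _) X)
  refine ⟨?_, hX.2.1.mono' (subset_trans subset_closure hs), hs.trans hX.2.2⟩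
  rw [e]; exact (EuclideanSpace.proj (𝕜 := ℝ) k).contDiff.comp hX.1

theorem IsTest.mono {F : Type*} [NormedAddCommGroup F] [NormedSpace ℝ F] {U V : Set E3}
    {X : E3 → F} (hX : IsTest U X) (h : U ⊆ V) : IsTest V X := ⟨hX.1, hX.2.1, hX.2.2.trans h⟩

theorem fderiv_coord {X : E3 → E3} {x : E3} (hX : DifferentiableAt ℝ X x) (k : Fin 3) (v : E3) :
    fderiv ℝ (fun y => X y k) x v = fderiv ℝ X x v k := by
  have := ((EuclideanSpace.proj (𝕜 := ℝ) k).hasFDerivAt.comp x hX.hasFDerivAt).fderiv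
  have e : (fun y => X y k) = (EuclideanSpace.proj (𝕜 := ℝ) k) ∘ X := rfl
  rw [e, this]; rfl

theorem IsTest.differentiable {F : Type*} [NormedAddCommGroup F] [NormedSpace ℝ F] {U : Set E3}
    {X : E3 → F} (hX : IsTest U X) : Differentiable ℝ X := hX.1.differentiable (by simp)

theorem IsTest.continuous_fderiv {F : Type*} [NormedAddCommGroup F] [NormedSpace ℝ F] {U : Set E3}
    {X : E3 → F} (hX : IsTest U X) (v : E3) : Continuous fun x => fderiv ℝ X x v :=
  (hX.1.continuous_fderiv (by simp)).clm_apply continuous_const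

theorem IsTest.hasCompactSupport_fderiv {F : Type*} [NormedAddCommGroup F] [NormedSpace ℝ F]
    {U : Set E3} {X : E3 → F} (hX : IsTest U X) (v : E3) :
    HasCompactSupport fun x => fderiv ℝ X x v := hX.2.1.fderiv_apply ℝ v

/-- Integration by parts for a function of class `C¹` against a test function. -/
theorem integral_mul_fderiv_test {U : Set E3} {f η : E3 → ℝ} (hf : ContDiff ℝ 1 f)
    (hη : IsTest U η) (v : E3) :
    ∫ x, f x * fderiv ℝ η x v = -∫ x, fderiv ℝ f x v * η x := by
  have hf' : Continuous fun x => fderiv ℝ f x v :=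
    (hf.continuous_fderiv one_ne_zero).clm_apply continuous_const
  refine integral_mul_fderiv_eq_neg_fderiv_mul_of_integrable ?_ ?_ ?_
    (fun x _ => hf.differentiable one_ne_zero x) fun x _ => hη.differentiable x
  · exact (hf'.mul hη.1.continuous).integrable_of_hasCompactSupport hη.2.1.mul_left
  · exact (hf.continuous.mul (hη.continuous_fderiv v)).integrable_of_hasCompactSupport
      (hη.hasCompactSupport_fderiv v).mul_left
  · exact (hf.continuous.mul hη.1.continuous).integrable_of_hasCompactSupport hη.2.1.mul_left

theorem IsTest.eq_zero_of_notMem {F : Type*} [NormedAddCommGroup F] [NormedSpace ℝ F] {U : Set E3}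
    {X : E3 → F} (hX : IsTest U X) {x : E3} (hx : x ∉ U) : X x = 0 :=
  image_eq_zero_of_notMem_tsupport fun h => hx (hX.2.2 h)

theorem IsTest.fderiv_eq_zero_of_notMem {F : Type*} [NormedAddCommGroup F] [NormedSpace ℝ F]
    {U : Set E3} {X : E3 → F} (hX : IsTest U X) {x : E3} (hx : x ∉ U) : fderiv ℝ X x = 0 :=
  image_eq_zero_of_notMem_tsupport fun h => hx (hX.2.2 (tsupport_fderiv_subset ℝ h))

theorem isWeakPartial_of_contDiff {f : E3 → ℝ} (hf : ContDiff ℝ 1 f) (U : Set E3)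
    (j : Fin 3) : IsWeakPartial U j f fun x => fderiv ℝ f x (basisVec j) := by
  refine ⟨hf.continuous.locallyIntegrable.locallyIntegrableOn _, ((hf.continuous_fderiv
    one_ne_zero).clm_apply continuous_const).locallyIntegrable.locallyIntegrableOn _,
    fun η hη => ?_⟩
  rw [setIntegral_eq_integral_of_forall_compl_eq_zero, setIntegral_eq_integral_of_forall_compl_eq_zero]
  · exact integral_mul_fderiv_test hf hη _
  · intro x hx; rw [hη.eq_zero_of_notMem hx, mul_zero]
  · intro x hx; rw [hη.fderiv_eq_zero_of_notMem hx]; simp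

theorem integrable_mul_of_test {U : Set E3} {f g : E3 → ℝ} (hf : LocallyIntegrableOn f U)
    (hg : Continuous g) (hc : HasCompactSupport g) (hU : tsupport g ⊆ U) :
    IntegrableOn (fun x => f x * g x) U := by
  have h1 : IntegrableOn f (tsupport g) := hf.integrableOn_compact_subset hU hc
  have h2 : IntegrableOn (fun x => f x * g x) (tsupport g) :=
    h1.mul_continuousOn hg.continuousOn hc
  exact (h2.integrable_of_forall_notMem_eq_zero fun x hx => by
    rw [image_eq_zero_of_notMem_tsupport hx, mul_zero]).integrableOn

theorem integral_add_three {α : Type*} [MeasurableSpace α] {μ : Measure α} {f g h : α → ℝ}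
    (hf : Integrable f μ) (hg : Integrable g μ) (hh : Integrable h μ) :
    ∫ x, (f x + g x + h x) ∂μ = ∫ x, f x ∂μ + ∫ x, g x ∂μ + ∫ x, h x ∂μ := by
  have hfg : Integrable (fun x => f x + g x) μ := hf.add hg
  rw [integral_add hfg hh, integral_add hf hg]

/-- The weak curl of a field in `H¹_loc` tested against a smooth field. -/
theorem MemH1Loc.integral_curl {A : E3 → E3} {D : E3 → Matrix (Fin 3) (Fin 3) ℝ}
    (hA : MemH1Loc A D) {X : E3 → E3} (hX : IsTest univ X) :
    Integrable (fun x => inner ℝ (curlOf (D x)) (X x)) ∧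
    Integrable (fun x => inner ℝ (A x) (curl X x)) ∧
    ∫ x, inner ℝ (curlOf (D x)) (X x) = ∫ x, inner ℝ (A x) (curl X x) := by
  have hw := fun i j k => (hA.weak i j).2.2 _ (hX.coord k)
  have i1 : ∀ i j k, Integrable fun x => A x i * fderiv ℝ (fun y => X y k) x (basisVec j) := by
    intro i j k
    have := integrable_mul_of_test (hA.weak i j).1 ((hX.coord k).continuous_fderiv (basisVec j))
      ((hX.coord k).hasCompactSupport_fderiv _) (subset_univ _)
    simpa using this
  have i2 : ∀ i j k, Integrable fun x => D x i j * X x k := by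
    intro i j k
    have := integrable_mul_of_test (hA.weak i j).2.1 (hX.coord k).1.continuous
      (hX.coord k).2.1 (subset_univ _)
    simpa using this
  simp only [Measure.restrict_univ] at hw
  have e1 : (fun x => inner ℝ (curlOf (D x)) (X x)) = fun x =>
      ((D x 2 1 * X x 0 - D x 1 2 * X x 0) + (D x 0 2 * X x 1 - D x 2 0 * X x 1)) +
        (D x 1 0 * X x 2 - D x 0 1 * X x 2) := by
    funext x; rw [inner_coord]; simp; ring
  have e2 : (fun x => inner ℝ (A x) (curl X x)) = fun x =>
      ((A x 1 * fderiv ℝ (fun y => X y 0) x (basisVec 2) -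
        A x 2 * fderiv ℝ (fun y => X y 0) x (basisVec 1)) +
       (A x 2 * fderiv ℝ (fun y => X y 1) x (basisVec 0) -
        A x 0 * fderiv ℝ (fun y => X y 1) x (basisVec 2))) +
       (A x 0 * fderiv ℝ (fun y => X y 2) x (basisVec 1) -
        A x 1 * fderiv ℝ (fun y => X y 2) x (basisVec 0)) := by
    funext x
    simp only [fderiv_coord (hX.differentiable x)]
    rw [inner_coord]; simp [curl]; ring
  rw [e1, e2]
  have a1 : Integrable (fun x => D x 2 1 * X x 0 - D x 1 2 * X x 0) := (i2 _ _ _).sub (i2 _ _ _)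
  have a2 : Integrable (fun x => D x 0 2 * X x 1 - D x 2 0 * X x 1) := (i2 _ _ _).sub (i2 _ _ _)
  have a3 : Integrable (fun x => D x 1 0 * X x 2 - D x 0 1 * X x 2) := (i2 _ _ _).sub (i2 _ _ _)
  have b1 : Integrable (fun x => A x 1 * fderiv ℝ (fun y => X y 0) x (basisVec 2) -
        A x 2 * fderiv ℝ (fun y => X y 0) x (basisVec 1)) := (i1 _ _ _).sub (i1 _ _ _)
  have b2 : Integrable (fun x => A x 2 * fderiv ℝ (fun y => X y 1) x (basisVec 0) -
        A x 0 * fderiv ℝ (fun y => X y 1) x (basisVec 2)) := (i1 _ _ _).sub (i1 _ _ _)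
  have b3 : Integrable (fun x => A x 0 * fderiv ℝ (fun y => X y 2) x (basisVec 1) -
        A x 1 * fderiv ℝ (fun y => X y 2) x (basisVec 0)) := (i1 _ _ _).sub (i1 _ _ _)
  refine ⟨(a1.add a2).add a3, (b1.add b2).add b3, ?_⟩
  rw [integral_add_three a1 a2 a3, integral_add_three b1 b2 b3,
    integral_sub (i2 _ _ _) (i2 _ _ _), integral_sub (i2 _ _ _) (i2 _ _ _),
    integral_sub (i2 _ _ _) (i2 _ _ _), integral_sub (i1 _ _ _) (i1 _ _ _),
    integral_sub (i1 _ _ _) (i1 _ _ _), integral_sub (i1 _ _ _) (i1 _ _ _)]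
  simp only [hw]
  ring

/-- The weak gradient of a function in `H¹` tested against a smooth field. -/
theorem MemH1.integral_grad {U : Set E3} {φ : E3 → ℝ} {G : E3 → E3}
    (h : MemH1 U φ G) {X : E3 → E3} (hX : IsTest U X) :
    ∫ x in U, inner ℝ (G x) (X x) = -∫ x in U, φ x * (jacobian (fderiv ℝ X x)).trace := by
  have hw := fun j => (h.weak j).2.2 _ (hX.coord j)
  have i1 : ∀ j, IntegrableOn (fun x => φ x * fderiv ℝ (fun y => X y j) x (basisVec j)) U :=
    fun j => integrable_mul_of_test (h.weak j).1 ((hX.coord j).continuous_fderiv (basisVec j))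
      ((hX.coord j).hasCompactSupport_fderiv _)
      ((tsupport_fderiv_apply_subset ℝ _).trans (hX.coord j).2.2)
  have i2 : ∀ j, IntegrableOn (fun x => G x j * X x j) U := fun j =>
    integrable_mul_of_test (h.weak j).2.1 (hX.coord j).1.continuous (hX.coord j).2.1
      (hX.coord j).2.2
  have e1 : (fun x => inner ℝ (G x) (X x)) = fun x =>
      (G x 0 * X x 0 + G x 1 * X x 1) + G x 2 * X x 2 := by
    funext x; rw [inner_coord]
  have e2 : (fun x => φ x * (jacobian (fderiv ℝ X x)).trace) = fun x =>
      (φ x * fderiv ℝ (fun y => X y 0) x (basisVec 0) +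
        φ x * fderiv ℝ (fun y => X y 1) x (basisVec 1)) +
        φ x * fderiv ℝ (fun y => X y 2) x (basisVec 2) := by
    funext x
    simp only [fderiv_coord (hX.differentiable x)]
    simp [Matrix.trace, Fin.sum_univ_three, jacobian]; ring
  rw [e1, e2]
  rw [integral_add_three (i2 0) (i2 1) (i2 2), integral_add_three (i1 0) (i1 1) (i1 2)]
  simp only [hw]
  ring

/-! ### The explicit Meissner state of a ball -/

/-- The amplitude of the supercurrent, fixed by matching with a dipole field outside the ball. -/
noncomputable def amplitude (ρ : ℝ) : ℝ :=
  1 / (2 * (london (ρ ^ 2) + 2 / 3 * ρ ^ 2 * deriv london (ρ ^ 2)))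

/-- The dipole moment of the field outside the ball. -/
noncomputable def dipole (ρ : ℝ) : ℝ := -(2 / 3) * ρ ^ 5 * amplitude ρ * deriv london (ρ ^ 2)

/-- The profile, as a function of `‖x‖²`, of the azimuthal potential of the Meissner state:
a multiple of the London profile in the ball, and the potential of the uniform field corrected by a
dipole outside. -/
noncomputable def profile (ρ s : ℝ) : ℝ :=
  if s ≤ ρ ^ 2 then amplitude ρ * london s else 1 / 2 + dipole ρ * s ^ (-(3 / 2) : ℝ)

/-- The derivative of `profile`. -/
noncomputable def profileD (ρ s : ℝ) : ℝ :=
  if s ≤ ρ ^ 2 then amplitude ρ * deriv london s else -(3 / 2) * dipole ρ * s ^ (-(5 / 2) : ℝ)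

theorem london_hasDerivAt (s : ℝ) : HasDerivAt london (deriv london s) s :=
  (london_contDiff.differentiable (by simp) s).hasDerivAt

theorem deriv_london_contDiff : ContDiff ℝ ∞ (deriv london) :=
  (contDiff_infty_iff_deriv.1 london_contDiff).2

theorem amplitude_pos (ρ : ℝ) : 0 < amplitude ρ := by
  have h1 := one_le_london (sq_nonneg ρ)
  have h2 := deriv_london_pos (sq_nonneg ρ)
  rw [amplitude]; positivity

theorem amplitude_spec (ρ : ℝ) :
    amplitude ρ * (london (ρ ^ 2) + 2 / 3 * ρ ^ 2 * deriv london (ρ ^ 2)) = 1 / 2 := by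
  have h1 := one_le_london (sq_nonneg ρ)
  have h2 := deriv_london_pos (sq_nonneg ρ)
  have : london (ρ ^ 2) + 2 / 3 * ρ ^ 2 * deriv london (ρ ^ 2) ≠ 0 := by positivity
  rw [amplitude]; field_simp

theorem sq_rpow_neg_three_halves {ρ : ℝ} (hρ : 0 < ρ) : (ρ ^ 2) ^ (-(3 / 2) : ℝ) = (ρ ^ 3)⁻¹ := by
  rw [← Real.rpow_natCast, ← Real.rpow_mul hρ.le, ← Real.rpow_natCast, ← Real.rpow_neg hρ.le]
  norm_num

theorem sq_rpow_neg_five_halves {ρ : ℝ} (hρ : 0 < ρ) : (ρ ^ 2) ^ (-(5 / 2) : ℝ) = (ρ ^ 5)⁻¹ := by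
  rw [← Real.rpow_natCast, ← Real.rpow_mul hρ.le, ← Real.rpow_natCast, ← Real.rpow_neg hρ.le]
  norm_num

theorem hasDerivAt_dipole {s : ℝ} (hs : 0 < s) (c : ℝ) :
    HasDerivAt (fun s => c * s ^ (-(3 / 2) : ℝ)) (-(3 / 2) * c * s ^ (-(5 / 2) : ℝ)) s := by
  have h := (Real.hasDerivAt_rpow_const (x := s) (p := -(3 / 2)) (Or.inl hs.ne')).const_mul c
  refine h.congr_deriv ?_
  rw [show (-(3 / 2) - 1 : ℝ) = -(5 / 2) by norm_num]; ring

/-- Two functions that agree to first order at the junction glue to a differentiable function. -/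
theorem hasDerivAt_glue {f g h : ℝ → ℝ} {c d : ℝ} (hf : HasDerivAt f d c) (hg : HasDerivAt g d c)
    (h1 : ∀ s ≤ c, h s = f s) (h2 : ∀ s, c < s → h s = g s) (hc : f c = g c) :
    HasDerivAt h d c := by
  have a : HasDerivWithinAt h d (Iic c) c :=
    hf.hasDerivWithinAt.congr (fun s hs => h1 s hs) (h1 c le_rfl)
  have b : HasDerivWithinAt h d (Ici c) c := by
    refine hg.hasDerivWithinAt.congr (fun s hs => ?_) ((h1 c le_rfl).trans hc)
    rcases (mem_Ici.1 hs).eq_or_lt with rfl | hs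
    · exact (h1 _ le_rfl).trans hc
    · exact h2 s hs
  have := a.union b
  rwa [Iic_union_Ici, hasDerivWithinAt_univ] at this

theorem profile_hasDerivAt {ρ : ℝ} (hρ : 0 < ρ) (s : ℝ) :
    HasDerivAt (profile ρ) (profileD ρ s) s := by
  have h1 : HasDerivAt (fun s => amplitude ρ * london s) (amplitude ρ * deriv london s) s :=
    (london_hasDerivAt s).const_mul _
  have hσ : 0 < ρ ^ 2 := by positivity
  rcases lt_trichotomy s (ρ ^ 2) with hs | rfl | hs
  · rw [profileD, if_pos hs.le]
    refine h1.congr_of_eventuallyEq ?_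
    filter_upwards [Iio_mem_nhds hs] with t ht
    rw [profile, if_pos (le_of_lt ht)]
  · rw [profileD, if_pos le_rfl]
    have h2 := (hasDerivAt_dipole hσ (dipole ρ)).const_add (1 / 2)
    refine hasDerivAt_glue (g := fun s => 1 / 2 + dipole ρ * s ^ (-(3 / 2) : ℝ)) h1
      (h2.congr_deriv ?_) (fun s hs => ?_) (fun s hs => ?_) ?_
    · rw [sq_rpow_neg_five_halves hρ, dipole]; field_simp
    · rw [profile, if_pos hs]
    · rw [profile, if_neg (not_le.2 hs)]
    · simp only [sq_rpow_neg_three_halves hρ, ← amplitude_spec ρ, dipole]; field_simp; ring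
  · rw [profileD, if_neg (not_le.2 hs)]
    have h2 := (hasDerivAt_dipole (hσ.trans hs) (dipole ρ)).const_add (1 / 2)
    refine h2.congr_of_eventuallyEq ?_
    filter_upwards [Ioi_mem_nhds hs] with t ht
    rw [profile, if_neg (not_le.2 ht)]

theorem profileD_continuous {ρ : ℝ} (hρ : 0 < ρ) : Continuous (profileD ρ) := by
  have hσ : 0 < ρ ^ 2 := by positivity
  have e : profileD ρ = fun s => if s ≤ ρ ^ 2 then amplitude ρ * deriv london s else
      -(3 / 2) * dipole ρ * (max s (ρ ^ 2)) ^ (-(5 / 2) : ℝ) := by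
    funext s
    rw [profileD]
    split_ifs with h
    · rfl
    · rw [max_eq_left (not_le.1 h).le]
  rw [e]
  refine Continuous.if_le ?_ ?_ continuous_id continuous_const ?_
  · exact continuous_const.mul deriv_london_contDiff.continuous
  · refine continuous_const.mul ((continuous_id.max continuous_const).rpow_const fun s => ?_)
    exact Or.inl (hσ.trans_le (le_max_right _ _)).ne'
  · rintro s rfl
    simp only [max_self, sq_rpow_neg_five_halves hρ, dipole]; field_simp

theorem profile_contDiff {ρ : ℝ} (hρ : 0 < ρ) : ContDiff ℝ 1 (profile ρ) := by
  rw [contDiff_one_iff_deriv]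
  refine ⟨fun s => (profile_hasDerivAt hρ s).differentiableAt, ?_⟩
  rw [show deriv (profile ρ) = profileD ρ from funext fun s => (profile_hasDerivAt hρ s).deriv]
  exact profileD_continuous hρ

/-- The potential of the Meissner state of the ball of radius `ρ`. -/
noncomputable def meissnerPotential (ρ : ℝ) : E3 → E3 := azim (profile ρ)

/-- The Jacobian of the potential of the Meissner state. -/
noncomputable def meissnerJacobian (ρ : ℝ) (x : E3) : Matrix (Fin 3) (Fin 3) ℝ :=
  jacobian (fderiv ℝ (meissnerPotential ρ) x)

/-- The induced magnetic field `curl A - e_z` of the Meissner state. -/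
noncomputable def inducedField (ρ : ℝ) : E3 → E3 :=
  polar (fun s => 2 * profile ρ s + 2 * s * profileD ρ s - 1) (fun s => -2 * profileD ρ s)

theorem meissnerPotential_contDiff {ρ : ℝ} (hρ : 0 < ρ) : ContDiff ℝ 1 (meissnerPotential ρ) :=
  contDiff_azim (profile_contDiff hρ)

theorem curlOf_meissnerJacobian {ρ : ℝ} (hρ : 0 < ρ) (x : E3) :
    curlOf (meissnerJacobian ρ x) - eZ = inducedField ρ x := by
  rw [meissnerJacobian, meissnerPotential, (hasFDerivAt_azim (profile_hasDerivAt hρ _)).fderiv,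
    curlOf_azimD, inducedField, polar]
  module

theorem inducedField_continuous {ρ : ℝ} (hρ : 0 < ρ) : Continuous (inducedField ρ) := by
  have h1 := (profile_contDiff hρ).continuous
  have h2 := profileD_continuous hρ
  exact (contDiff_zero.1 (contDiff_polar (n := 0) (contDiff_zero.2 (by fun_prop))
    (contDiff_zero.2 (by fun_prop))))

/-- The weight that controls the decay of the induced fields. -/
noncomputable def decay (x : E3) : ℝ := (1 + ‖x‖ ^ 2) ^ (-(3 / 2) : ℝ)

theorem decay_pos (x : E3) : 0 < decay x := by rw [decay]; positivity

theorem decay_continuous : Continuous decay :=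
  (continuous_const.add (continuous_norm.pow 2)).rpow_const fun x =>
    Or.inl (show (1 + ‖x‖ ^ 2 : ℝ) ≠ 0 by positivity)

theorem memLp_decay : MemLp decay 2 (volume : Measure E3) := by
  rw [memLp_two_iff_integrable_sq decay_continuous.aestronglyMeasurable]
  have h := integrable_rpow_neg_one_add_norm_sq (E := E3) (μ := volume) (r := 6) (by simp; norm_num)
  refine h.congr (Eventually.of_forall fun x => ?_)
  simp only [decay]
  rw [← Real.rpow_natCast ((1 + ‖x‖ ^ 2) ^ _), ← Real.rpow_mul (by positivity)]
  norm_num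

theorem one_le_decay {R : ℝ} {x : E3} (hx : ‖x‖ ^ 2 ≤ R) : 1 ≤ (1 + R) ^ (3 / 2 : ℝ) * decay x := by
  have h1 : 0 < 1 + ‖x‖ ^ 2 := by positivity
  rw [decay, Real.rpow_neg h1.le, ← div_eq_mul_inv, one_le_div (by positivity)]
  exact Real.rpow_le_rpow h1.le (by linarith) (by norm_num)

theorem rpow_le_decay {r : ℝ} (hr : 0 < r) {x : E3} (hx : r ≤ ‖x‖ ^ 2) :
    (‖x‖ ^ 2) ^ (-(3 / 2) : ℝ) ≤ (1 + r⁻¹) ^ (3 / 2 : ℝ) * decay x := by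
  have h1 : 0 < 1 + ‖x‖ ^ 2 := by positivity
  have h2 : 0 < ‖x‖ ^ 2 := hr.trans_le hx
  have h3 : 0 < 1 + r⁻¹ := by positivity
  rw [decay, Real.rpow_neg h1.le, Real.rpow_neg h2.le, ← div_eq_mul_inv, ← Real.inv_rpow h2.le,
    ← Real.div_rpow h3.le h1.le]
  refine Real.rpow_le_rpow (by positivity) ?_ (by norm_num)
  rw [inv_eq_one_div, div_le_div_iff₀ h2 h1, one_mul, add_mul, one_mul, add_comm]
  have : 1 ≤ r⁻¹ * ‖x‖ ^ 2 := by
    rw [← div_eq_inv_mul, one_le_div hr]; exact hx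
  linarith

theorem norm_inducedField_le {ρ : ℝ} (hρ : 0 < ρ) :
    ∃ K : ℝ, ∀ x, ‖inducedField ρ x‖ ≤ K * decay x := by
  have hσ : 0 < ρ ^ 2 := by positivity
  obtain ⟨M, hM⟩ := (isCompact_closedBall (0 : E3) ρ).exists_bound_of_continuousOn
    (inducedField_continuous hρ).continuousOn
  refine ⟨max (M * (1 + ρ ^ 2) ^ (3 / 2 : ℝ)) (4 * |dipole ρ| * (1 + (ρ ^ 2)⁻¹) ^ (3 / 2 : ℝ)),
    fun x => ?_⟩
  have hd := decay_pos x
  rcases le_or_gt (‖x‖ ^ 2) (ρ ^ 2) with hx | hx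
  · have h1 := hM x (by simpa using (abs_le_of_sq_le_sq hx hρ.le |> abs_le.1).2)
    have h0 : 0 ≤ M := (norm_nonneg _).trans h1
    calc ‖inducedField ρ x‖ ≤ M * 1 := by simpa using h1
      _ ≤ M * ((1 + ρ ^ 2) ^ (3 / 2 : ℝ) * decay x) := by gcongr; exact one_le_decay hx
      _ ≤ _ := by rw [← mul_assoc]; gcongr; exact le_max_left _ _
  · have hs : 0 < ‖x‖ ^ 2 := hσ.trans hx
    have e : ‖x‖ ^ 2 * (‖x‖ ^ 2) ^ (-(5 / 2) : ℝ) = (‖x‖ ^ 2) ^ (-(3 / 2) : ℝ) := by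
      rw [← Real.rpow_one_add' hs.le (by norm_num)]; norm_num
    have h0 : 0 < (‖x‖ ^ 2) ^ (-(3 / 2) : ℝ) := by positivity
    calc ‖inducedField ρ x‖ ≤ 4 * |dipole ρ| * (‖x‖ ^ 2) ^ (-(3 / 2) : ℝ) := by
          refine (norm_polar_le _ _ x).trans ?_
          rw [profile, profileD, if_neg (not_le.2 hx), if_neg (not_le.2 hx)]
          have e1 : 2 * (1 / 2 + dipole ρ * (‖x‖ ^ 2) ^ (-(3 / 2) : ℝ)) +
              2 * ‖x‖ ^ 2 * (-(3 / 2) * dipole ρ * (‖x‖ ^ 2) ^ (-(5 / 2) : ℝ)) - 1 =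
              -dipole ρ * (‖x‖ ^ 2) ^ (-(3 / 2) : ℝ) := by
            linear_combination (-3 * dipole ρ) * e
          have e2 : |-2 * (-(3 / 2) * dipole ρ * (‖x‖ ^ 2) ^ (-(5 / 2) : ℝ))| * ‖x‖ ^ 2 =
              3 * |dipole ρ| * (‖x‖ ^ 2) ^ (-(3 / 2) : ℝ) := by
            rw [← e, show -2 * (-(3 / 2) * dipole ρ * (‖x‖ ^ 2) ^ (-(5 / 2) : ℝ)) =
              3 * dipole ρ * (‖x‖ ^ 2) ^ (-(5 / 2) : ℝ) by ring, abs_mul, abs_mul,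
              abs_of_nonneg (Real.rpow_nonneg hs.le _), abs_of_pos (by norm_num : (0 : ℝ) < 3)]
            ring
          rw [e1, e2, abs_mul, abs_neg, abs_of_pos h0]
          linarith
      _ ≤ 4 * |dipole ρ| * ((1 + (ρ ^ 2)⁻¹) ^ (3 / 2 : ℝ) * decay x) := by
          gcongr; exact rpow_le_decay hσ hx.le
      _ ≤ _ := by rw [← mul_assoc]; gcongr; exact le_max_right _ _

theorem memLp_of_norm_le_decay {X : E3 → E3} (hX : Continuous X) {K : ℝ}
    (hK : ∀ x, ‖X x‖ ≤ K * decay x) : MemLp X 2 volume :=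
  memLp_decay.of_le_mul hX.aestronglyMeasurable <| Eventually.of_forall fun x => by
    rw [Real.norm_of_nonneg (decay_pos x).le]; exact hK x

theorem memLp_restrict_of_continuous {F : Type*} [NormedAddCommGroup F] [SecondCountableTopology F]
    {f : E3 → F} (hf : Continuous f) {K : Set E3}
    (hK : IsCompact K) : MemLp f 2 (volume.restrict K) := by
  obtain ⟨M, hM⟩ := hK.exists_bound_of_continuousOn hf.continuousOn
  have : IsFiniteMeasure (volume.restrict K) := ⟨by simpa using hK.measure_lt_top⟩
  exact MemLp.of_bound hf.aestronglyMeasurable M ((ae_restrict_iff' hK.measurableSet).2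
    (Eventually.of_forall hM))

theorem memH1Loc_of_contDiff {A : E3 → E3} (hA : ContDiff ℝ 1 A) :
    MemH1Loc A fun x => jacobian (fderiv ℝ A x) := by
  have hd : ∀ x, DifferentiableAt ℝ A x := hA.differentiable one_ne_zero
  refine ⟨fun K hK => memLp_restrict_of_continuous hA.continuous hK, fun K hK i j =>
    memLp_restrict_of_continuous ?_ hK, fun i j => ?_⟩
  · exact (EuclideanSpace.proj (𝕜 := ℝ) i).continuous.comp
      ((hA.continuous_fderiv one_ne_zero).clm_apply continuous_const)
  · have h1 : ContDiff ℝ 1 fun x => A x i :=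
      (EuclideanSpace.proj (𝕜 := ℝ) i).contDiff.comp hA
    have := isWeakPartial_of_contDiff h1 univ j
    simp only [fderiv_coord (hd _)] at this
    exact this

theorem meissnerPotential_admissible {ρ : ℝ} (hρ : 0 < ρ) :
    Admissible (fun _ => eZ) (meissnerPotential ρ) (meissnerJacobian ρ) := by
  refine ⟨memH1Loc_of_contDiff (meissnerPotential_contDiff hρ), ?_⟩
  simp only [curlOf_meissnerJacobian hρ]
  obtain ⟨K, hK⟩ := norm_inducedField_le hρ
  exact memLp_of_norm_le_decay (inducedField_continuous hρ) hK

/-! ### Compactly supported approximations of the induced field -/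

theorem smoothTransition_contDiff : ContDiff ℝ ∞ Real.smoothTransition :=
  Real.smoothTransition.contDiff

theorem smoothTransition_hasDerivAt (x : ℝ) :
    HasDerivAt Real.smoothTransition (deriv Real.smoothTransition x) x :=
  (smoothTransition_contDiff.differentiable (by simp) x).hasDerivAt

theorem deriv_smoothTransition_of_nonpos {x : ℝ} (hx : x ≤ 0) :
    deriv Real.smoothTransition x = 0 := by
  apply IsLocalMin.deriv_eq_zero
  exact Eventually.of_forall fun y => by
    rw [Real.smoothTransition.zero_of_nonpos hx]; exact Real.smoothTransition.nonneg y

theorem deriv_smoothTransition_of_one_le {x : ℝ} (hx : 1 ≤ x) :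
    deriv Real.smoothTransition x = 0 := by
  apply IsLocalMax.deriv_eq_zero
  exact Eventually.of_forall fun y => by
    rw [Real.smoothTransition.one_of_one_le hx]; exact Real.smoothTransition.le_one y

theorem exists_bound_deriv_smoothTransition :
    ∃ S : ℝ, 0 ≤ S ∧ ∀ x, |deriv Real.smoothTransition x| ≤ S := by
  obtain ⟨S, hS⟩ := (isCompact_Icc (a := (0 : ℝ)) (b := 1)).exists_bound_of_continuousOn
    (contDiff_infty_iff_deriv.1 smoothTransition_contDiff).2.continuous.continuousOn
  have h0 : 0 ≤ S := (norm_nonneg _).trans (hS 0 (by simp))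
  refine ⟨S, h0, fun x => ?_⟩
  rcases le_or_gt x 0 with h | h
  · rwa [deriv_smoothTransition_of_nonpos h, abs_zero]
  rcases le_or_gt 1 x with h' | h'
  · rwa [deriv_smoothTransition_of_one_le h', abs_zero]
  · exact hS x ⟨h.le, h'.le⟩

/-- A cutoff in `s = ‖x‖²` that exhausts the ball of radius `ρ` from inside as `N → ∞`. -/
noncomputable def innerCutoff (ρ N s : ℝ) : ℝ := Real.smoothTransition (N * (ρ ^ 2 - s) - 1)

/-- A cutoff in `s = ‖x‖²` that exhausts the whole space as `N → ∞`. -/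
noncomputable def outerCutoff (N s : ℝ) : ℝ := Real.smoothTransition (2 - s / N)

/-- The coefficient of `e_z` in the induced field inside the ball. -/
noncomputable def axialIn (ρ s : ℝ) : ℝ :=
  amplitude ρ * (2 * london s + 2 * s * deriv london s) - 1

/-- The coefficient of `e_z` in the dipole field outside the ball. -/
noncomputable def axialOut (ρ s : ℝ) : ℝ := -dipole ρ * s ^ (-(3 / 2) : ℝ)

/-- A smooth compactly supported approximation of the coefficient of `e_z` in the induced field. -/
noncomputable def axialTest (ρ N s : ℝ) : ℝ :=
  (1 - innerCutoff ρ N s) * (axialOut ρ s * outerCutoff N s) + innerCutoff ρ N s * axialIn ρ s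

/-- The coefficient of `x₂ x` that makes the curl of the approximating field an exact cutoff of the
supercurrent. -/
noncomputable def radialTest (ρ N s : ℝ) : ℝ :=
  2 * deriv (axialTest ρ N) s - amplitude ρ * london s * innerCutoff ρ N s

/-- Smooth compactly supported fields that approximate the induced field. -/
noncomputable def testField (ρ N : ℝ) : E3 → E3 := polar (axialTest ρ N) (radialTest ρ N)

theorem innerCutoff_eq_one {ρ N s : ℝ} (h : 2 ≤ N * (ρ ^ 2 - s)) : innerCutoff ρ N s = 1 :=
  Real.smoothTransition.one_of_one_le (by linarith)

theorem innerCutoff_eq_zero {ρ N s : ℝ} (h : N * (ρ ^ 2 - s) ≤ 1) : innerCutoff ρ N s = 0 :=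
  Real.smoothTransition.zero_of_nonpos (by linarith)

theorem innerCutoff_mem (ρ N s : ℝ) : 0 ≤ innerCutoff ρ N s ∧ innerCutoff ρ N s ≤ 1 :=
  ⟨Real.smoothTransition.nonneg _, Real.smoothTransition.le_one _⟩

theorem outerCutoff_mem (N s : ℝ) : 0 ≤ outerCutoff N s ∧ outerCutoff N s ≤ 1 :=
  ⟨Real.smoothTransition.nonneg _, Real.smoothTransition.le_one _⟩

theorem outerCutoff_eq_one {N s : ℝ} (hN : 0 < N) (h : s ≤ N) : outerCutoff N s = 1 := by
  refine Real.smoothTransition.one_of_one_le ?_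
  have : s / N ≤ 1 := (div_le_one hN).2 h
  linarith

theorem outerCutoff_eq_zero {N s : ℝ} (hN : 0 < N) (h : 2 * N ≤ s) : outerCutoff N s = 0 := by
  refine Real.smoothTransition.zero_of_nonpos ?_
  have : 2 ≤ s / N := (le_div_iff₀ hN).2 h
  linarith

theorem innerCutoff_contDiff (ρ N : ℝ) : ContDiff ℝ ∞ (innerCutoff ρ N) :=
  smoothTransition_contDiff.comp (by fun_prop)

theorem outerCutoff_contDiff (N : ℝ) : ContDiff ℝ ∞ (outerCutoff N) :=
  smoothTransition_contDiff.comp ((contDiff_const).sub (contDiff_id.div_const N))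

theorem innerCutoff_hasDerivAt (ρ N s : ℝ) : HasDerivAt (innerCutoff ρ N)
    (-N * deriv Real.smoothTransition (N * (ρ ^ 2 - s) - 1)) s := by
  have h : HasDerivAt (fun s => N * (ρ ^ 2 - s) - 1) (N * (-1)) s :=
    (((hasDerivAt_id s).const_sub (ρ ^ 2)).const_mul N).sub_const 1
  exact ((smoothTransition_hasDerivAt _).comp s h).congr_deriv (by ring)

theorem outerCutoff_hasDerivAt (N s : ℝ) : HasDerivAt (outerCutoff N)
    (-(deriv Real.smoothTransition (2 - s / N) / N)) s := by
  have h : HasDerivAt (fun s => 2 - s / N) (-(1 / N)) s :=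
    ((hasDerivAt_id s).div_const N).const_sub 2
  exact ((smoothTransition_hasDerivAt _).comp s h).congr_deriv (by ring)

theorem axialIn_contDiff (ρ : ℝ) : ContDiff ℝ ∞ (axialIn ρ) := by
  have h1 := london_contDiff
  have h2 := deriv_london_contDiff
  unfold axialIn
  fun_prop

theorem axialIn_hasDerivAt (ρ s : ℝ) : HasDerivAt (axialIn ρ) (deriv (axialIn ρ) s) s :=
  ((axialIn_contDiff ρ).differentiable (by simp) s).hasDerivAt

theorem deriv_axialIn (ρ s : ℝ) :
    2 * deriv (axialIn ρ) s - amplitude ρ * london s = -2 * (amplitude ρ * deriv london s) := by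
  have h2 : HasDerivAt (deriv london) (deriv (deriv london) s) s :=
    (deriv_london_contDiff.differentiable (by simp) s).hasDerivAt
  have h : HasDerivAt (axialIn ρ) (amplitude ρ * (2 * deriv london s +
      (2 * 1 * deriv london s + 2 * s * deriv (deriv london) s))) s :=
    ((((london_hasDerivAt s).const_mul 2).add
      (((hasDerivAt_id s).const_mul 2).mul h2)).const_mul _).sub_const 1
  rw [h.deriv]
  linear_combination amplitude ρ * london_ode s

theorem axialOut_hasDerivAt (ρ : ℝ) {s : ℝ} (hs : 0 < s) :
    HasDerivAt (axialOut ρ) (3 / 2 * dipole ρ * s ^ (-(5 / 2) : ℝ)) s :=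
  (hasDerivAt_dipole hs (-dipole ρ)).congr_deriv (by ring)

theorem axialTest_eventuallyEq_axialIn {ρ N s : ℝ} (h : 2 < N * (ρ ^ 2 - s)) :
    axialTest ρ N =ᶠ[𝓝 s] axialIn ρ := by
  have hc : ContinuousAt (fun t => N * (ρ ^ 2 - t)) s := by fun_prop
  filter_upwards [hc.eventually (lt_mem_nhds h)] with t ht
  rw [axialTest, innerCutoff_eq_one ht.le]; ring

theorem axialTest_hasDerivAt (ρ N : ℝ) {s : ℝ} (hs : 0 < s) : HasDerivAt (axialTest ρ N)
    (-(-N * deriv Real.smoothTransition (N * (ρ ^ 2 - s) - 1)) *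
        (axialOut ρ s * outerCutoff N s) + (1 - innerCutoff ρ N s) *
        (3 / 2 * dipole ρ * s ^ (-(5 / 2) : ℝ) * outerCutoff N s +
          axialOut ρ s * -(deriv Real.smoothTransition (2 - s / N) / N)) +
      (-N * deriv Real.smoothTransition (N * (ρ ^ 2 - s) - 1) * axialIn ρ s +
        innerCutoff ρ N s * deriv (axialIn ρ) s)) s :=
  (((innerCutoff_hasDerivAt ρ N s).const_sub 1).mul
    ((axialOut_hasDerivAt ρ hs).mul (outerCutoff_hasDerivAt N s))).add
    ((innerCutoff_hasDerivAt ρ N s).mul (axialIn_hasDerivAt ρ s))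

theorem axialTest_contDiff {ρ N : ℝ} (hρ : 0 < ρ) (hN : 4 / ρ ^ 2 < N) :
    ContDiff ℝ ∞ (axialTest ρ N) := by
  have hσ : 0 < ρ ^ 2 := by positivity
  have hN0 : 0 < N := lt_trans (by positivity) hN
  rw [contDiff_iff_contDiffAt]
  intro s
  rcases le_or_gt s 0 with hs | hs
  · refine (axialIn_contDiff ρ).contDiffAt.congr_of_eventuallyEq
      (axialTest_eventuallyEq_axialIn ?_)
    have : 4 < N * ρ ^ 2 := by rwa [div_lt_iff₀ hσ] at hN
    nlinarith
  · have h1 : ContDiffAt ℝ ∞ (axialOut ρ) s :=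
      contDiffAt_const.mul (Real.contDiffAt_rpow_const_of_ne hs.ne')
    have h2 := (innerCutoff_contDiff ρ N).contDiffAt (x := s)
    exact ((contDiffAt_const.sub h2).mul (h1.mul (outerCutoff_contDiff N).contDiffAt)).add
      (h2.mul (axialIn_contDiff ρ).contDiffAt)

theorem radialTest_contDiff {ρ N : ℝ} (hρ : 0 < ρ) (hN : 4 / ρ ^ 2 < N) :
    ContDiff ℝ ∞ (radialTest ρ N) :=
  (contDiff_const.mul (contDiff_infty_iff_deriv.1 (axialTest_contDiff hρ hN)).2).sub
    ((contDiff_const.mul london_contDiff).mul (innerCutoff_contDiff ρ N))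

theorem hasCompactSupport_of_forall_norm {F : Type*} [NormedAddCommGroup F] {X : E3 → F} {R : ℝ}
    (h : ∀ x, R < ‖x‖ → X x = 0) : HasCompactSupport X :=
  HasCompactSupport.intro (isCompact_closedBall (0 : E3) R) fun x hx =>
    h x (by simpa using hx)

theorem testField_isTest {ρ N : ℝ} (hρ : 0 < ρ) (hN : 4 / ρ ^ 2 < N) (hN' : ρ ^ 2 ≤ N) :
    IsTest univ (testField ρ N) := by
  have hσ : 0 < ρ ^ 2 := by positivity
  have hN0 : 0 < N := lt_trans (by positivity) hN
  refine ⟨contDiff_polar (axialTest_contDiff hρ hN) (radialTest_contDiff hρ hN), ?_,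
    subset_univ _⟩
  have key : ∀ t, 2 * N < t → axialTest ρ N t = 0 := by
    intro t ht
    rw [axialTest, outerCutoff_eq_zero hN0 ht.le, innerCutoff_eq_zero (by nlinarith)]; ring
  refine hasCompactSupport_of_forall_norm (R := 2 * N + 1) fun x hx => ?_
  have hs : 2 * N < ‖x‖ ^ 2 := by nlinarith
  have e : axialTest ρ N =ᶠ[𝓝 (‖x‖ ^ 2)] fun _ => 0 := by
    filter_upwards [Ioi_mem_nhds hs] with t ht using key t ht
  rw [testField, polar, radialTest, e.deriv_eq, key _ hs, innerCutoff_eq_zero (by nlinarith)]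
  simp

theorem curl_testField {ρ N : ℝ} (hρ : 0 < ρ) (hN : 4 / ρ ^ 2 < N) (x : E3) :
    curl (testField ρ N) x =
      -(innerCutoff ρ N (‖x‖ ^ 2) • (amplitude ρ * london (‖x‖ ^ 2)) • rot x) := by
  have h1 := ((axialTest_contDiff hρ hN).differentiable (by simp) (‖x‖ ^ 2)).hasDerivAt
  have h2 := ((radialTest_contDiff hρ hN).differentiable (by simp) (‖x‖ ^ 2)).hasDerivAt
  rw [curl_eq_curlOf_jacobian, testField, (hasFDerivAt_polar h1 h2).fderiv, curlOf_polarD,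
    radialTest]
  module

theorem testField_eventually_eq {ρ : ℝ} (hρ : 0 < ρ) {x : E3} (hx : ‖x‖ ^ 2 ≠ ρ ^ 2) :
    ∀ᶠ N in atTop, testField ρ N x = inducedField ρ x := by
  have hσ : 0 < ρ ^ 2 := by positivity
  set s := ‖x‖ ^ 2 with hs
  rcases hx.lt_or_gt with h | h
  · filter_upwards [eventually_gt_atTop (2 / (ρ ^ 2 - s))] with N hN
    have hN' : 2 < N * (ρ ^ 2 - s) := by rwa [div_lt_iff₀ (by linarith)] at hN
    have e := axialTest_eventuallyEq_axialIn hN'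
    rw [testField, polar, radialTest, ← hs, e.deriv_eq, e.eq_of_nhds, innerCutoff_eq_one hN'.le,
      mul_one, deriv_axialIn, inducedField, polar, ← hs, profile, profileD, if_pos h.le,
      if_pos h.le, axialIn]
    ring_nf
  · filter_upwards [eventually_gt_atTop s] with N hN
    have hN0 : 0 < N := (hσ.trans h).trans hN
    have e : axialTest ρ N =ᶠ[𝓝 s] axialOut ρ := by
      filter_upwards [Ioo_mem_nhds h hN] with t ht
      rw [axialTest, outerCutoff_eq_one hN0 ht.2.le,
        innerCutoff_eq_zero (by nlinarith [ht.1])]; ring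
    have hs0 := hσ.trans h
    have e1 : s * s ^ (-(5 / 2) : ℝ) = s ^ (-(3 / 2) : ℝ) := by
      rw [← Real.rpow_one_add' hs0.le (by norm_num)]; norm_num
    rw [testField, polar, radialTest, ← hs, e.deriv_eq, e.eq_of_nhds,
      innerCutoff_eq_zero (by nlinarith), (axialOut_hasDerivAt ρ hs0).deriv, inducedField, polar,
      ← hs, profile, profileD, if_neg (not_le.2 h), if_neg (not_le.2 h), axialOut]
    congr 2
    · linear_combination (3 * dipole ρ) * e1
    · ring

theorem exists_bound_axialIn (ρ : ℝ) : ∃ K : ℝ, 0 ≤ K ∧ ∀ s ∈ Icc 0 (ρ ^ 2),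
    |axialIn ρ s| ≤ K ∧ |deriv (axialIn ρ) s| ≤ K ∧ |amplitude ρ * london s| ≤ K := by
  have h := isCompact_Icc (a := (0 : ℝ)) (b := ρ ^ 2)
  obtain ⟨K1, h1⟩ := h.exists_bound_of_continuousOn (axialIn_contDiff ρ).continuous.continuousOn
  obtain ⟨K2, h2⟩ := h.exists_bound_of_continuousOn
    (contDiff_infty_iff_deriv.1 (axialIn_contDiff ρ)).2.continuous.continuousOn
  obtain ⟨K3, h3⟩ := h.exists_bound_of_continuousOn
    (continuous_const.mul london_contDiff.continuous).continuousOn (f := fun s => amplitude ρ * london s)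
  refine ⟨max (max K1 K2) K3, ?_, fun s hs => ⟨?_, ?_, ?_⟩⟩
  · exact (norm_nonneg _).trans ((h3 0 ⟨le_rfl, sq_nonneg ρ⟩).trans (le_max_right _ _))
  · exact (h1 s hs).trans ((le_max_left _ _).trans (le_max_left _ _))
  · exact (h2 s hs).trans ((le_max_right _ _).trans (le_max_left _ _))
  · exact (h3 s hs).trans (le_max_right _ _)

/-- The axial coefficients inside and outside match on the sphere, so that their difference
is controlled by the distance to it. -/
theorem exists_bound_axialIn_sub_axialOut {ρ : ℝ} (hρ : 0 < ρ) : ∃ K : ℝ, 0 ≤ K ∧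
    ∀ s ∈ Icc (ρ ^ 2 / 2) (ρ ^ 2), |axialIn ρ s - axialOut ρ s| ≤ K * (ρ ^ 2 - s) := by
  have hσ : 0 < ρ ^ 2 := by positivity
  have hpos : ∀ s ∈ Icc (ρ ^ 2 / 2) (ρ ^ 2), 0 < s := fun s hs => lt_of_lt_of_le (by positivity) hs.1
  have hd : ∀ s ∈ Icc (ρ ^ 2 / 2) (ρ ^ 2), HasDerivWithinAt (fun s => axialIn ρ s - axialOut ρ s)
      (deriv (axialIn ρ) s - 3 / 2 * dipole ρ * s ^ (-(5 / 2) : ℝ)) (Icc (ρ ^ 2 / 2) (ρ ^ 2)) s :=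
    fun s hs => ((axialIn_hasDerivAt ρ s).sub (axialOut_hasDerivAt ρ (hpos s hs))).hasDerivWithinAt
  have hc : ContinuousOn (fun s => deriv (axialIn ρ) s - 3 / 2 * dipole ρ * s ^ (-(5 / 2) : ℝ))
      (Icc (ρ ^ 2 / 2) (ρ ^ 2)) := by
    refine (contDiff_infty_iff_deriv.1 (axialIn_contDiff ρ)).2.continuous.continuousOn.sub
      (continuousOn_const.mul ?_)
    exact continuousOn_id.rpow_const fun s hs => Or.inl (hpos s hs).ne'
  obtain ⟨K, hK⟩ := isCompact_Icc.exists_bound_of_continuousOn hc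
  have hmem : ρ ^ 2 ∈ Icc (ρ ^ 2 / 2) (ρ ^ 2) := ⟨by linarith, le_rfl⟩
  have h0 : axialIn ρ (ρ ^ 2) - axialOut ρ (ρ ^ 2) = 0 := by
    rw [axialIn, axialOut, sq_rpow_neg_three_halves hρ, dipole]
    have := amplitude_spec ρ
    field_simp
    linear_combination 6 * this
  refine ⟨K, (norm_nonneg _).trans (hK _ hmem), fun s hs => ?_⟩
  have := (convex_Icc (ρ ^ 2 / 2) (ρ ^ 2)).norm_image_sub_le_of_norm_hasDerivWithin_le hd hK hmem hs
  rw [h0, sub_zero] at this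
  rwa [Real.norm_eq_abs, Real.norm_eq_abs, abs_sub_comm s, abs_of_nonneg (sub_nonneg.2 hs.2)] at this

/-- The approximating coefficients are bounded by the decay of a dipole, uniformly in `N`: here `d`
stands for a weight that dominates `1` in the ball and `s ^ (-3/2)` away from its centre. -/
theorem exists_bound_axialTest {ρ : ℝ} (hρ : 0 < ρ) (c : ℝ) : ∃ K : ℝ, ∀ N s d : ℝ,
    4 / ρ ^ 2 < N → ρ ^ 2 ≤ N → 0 ≤ s → 0 < d → (s ≤ ρ ^ 2 → 1 ≤ c * d) →
    (ρ ^ 2 / 2 ≤ s → s ^ (-(3 / 2) : ℝ) ≤ c * d) →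
      |axialTest ρ N s| + |radialTest ρ N s| * s ≤ K * d := by
  have hσ : 0 < ρ ^ 2 := by positivity
  obtain ⟨S, hS0, hS⟩ := exists_bound_deriv_smoothTransition
  obtain ⟨K1, hK10, hK1⟩ := exists_bound_axialIn ρ
  obtain ⟨K2, hK20, hK2⟩ := exists_bound_axialIn_sub_axialOut hρ
  set m := |dipole ρ| with hm
  have hm0 : 0 ≤ m := abs_nonneg _
  refine ⟨c * (m + K1) + c * (2 * ((3 / 2 + 2 * S) * m + (K1 + 2 * S * K2) * ρ ^ 2) + K1 * ρ ^ 2),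
    fun N s d hN hN' hs hd h1 h2 => ?_⟩
  have hN0 : 0 < N := hσ.trans_le hN'
  have hNσ : 4 < N * ρ ^ 2 := by rwa [div_lt_iff₀ hσ] at hN
  have hθ := innerCutoff_mem ρ N s
  have hχ := outerCutoff_mem N s
  have hθ0 : ρ ^ 2 < s → innerCutoff ρ N s = 0 := fun h => innerCutoff_eq_zero (by nlinarith)
  have hθ1 : s < ρ ^ 2 / 2 → innerCutoff ρ N s = 1 := fun h => innerCutoff_eq_one (by nlinarith)
  have hcd : 0 ≤ c * d := by
    rcases le_or_gt s (ρ ^ 2) with h | h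
    · linarith [h1 h]
    · exact (Real.rpow_nonneg hs _).trans (h2 (by linarith))
  have habs : ∀ v : ℝ, |v| * s = |v * s| := fun v => by rw [abs_mul, abs_of_nonneg hs]
  have hIn : ∀ v K : ℝ, 0 ≤ K → (s ≤ ρ ^ 2 → |v| ≤ K) → |innerCutoff ρ N s * v| ≤ K * (c * d) := by
    intro v K hK hv
    rcases le_or_gt s (ρ ^ 2) with h | h
    · rw [abs_mul, abs_of_nonneg hθ.1]
      calc _ ≤ 1 * K := mul_le_mul hθ.2 (hv h) (abs_nonneg _) zero_le_one
        _ = K * 1 := by ring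
        _ ≤ _ := by gcongr; exact h1 h
    · rw [hθ0 h, zero_mul, abs_zero]; positivity
  have hOut : ∀ v K : ℝ, 0 ≤ K → (ρ ^ 2 / 2 ≤ s → |v| ≤ K * s ^ (-(3 / 2) : ℝ)) →
      |(1 - innerCutoff ρ N s) * v| ≤ K * (c * d) := by
    intro v K hK hv
    rcases le_or_gt (ρ ^ 2 / 2) s with h | h
    · rw [abs_mul, abs_of_nonneg (by linarith)]
      calc _ ≤ 1 * (K * s ^ (-(3 / 2) : ℝ)) :=
            mul_le_mul (by linarith) (hv h) (abs_nonneg _) zero_le_one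
        _ = K * s ^ (-(3 / 2) : ℝ) := by ring
        _ ≤ _ := by gcongr; exact h2 h
    · rw [hθ1 h]; simp only [sub_self, zero_mul, abs_zero]; positivity
  have hα : |axialTest ρ N s| ≤ c * (m + K1) * d := by
    have a1 := hOut (axialOut ρ s * outerCutoff N s) m hm0 fun h => by
      have hp : 0 ≤ s ^ (-(3 / 2) : ℝ) := Real.rpow_nonneg hs _
      rw [axialOut, abs_mul, abs_mul, abs_neg, abs_of_nonneg hp, abs_of_nonneg hχ.1]
      exact mul_le_of_le_one_right (by positivity) hχ.2
    have a2 := hIn (axialIn ρ s) K1 hK10 fun h => (hK1 s ⟨hs, h⟩).1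
    calc _ ≤ _ := abs_add_le _ _
      _ ≤ m * (c * d) + K1 * (c * d) := add_le_add a1 a2
      _ = _ := by ring
  have hf : |amplitude ρ * london s * innerCutoff ρ N s| * s ≤ c * (K1 * ρ ^ 2) * d := by
    have := hIn (amplitude ρ * london s * s) (K1 * ρ ^ 2) (by positivity) fun h => by
      rw [abs_mul, abs_of_nonneg hs]
      exact mul_le_mul (hK1 s ⟨hs, h⟩).2.2 h hs hK10
    calc _ = |innerCutoff ρ N s * (amplitude ρ * london s * s)| := by
          rw [habs]; congr 1; ring
      _ ≤ _ := this
      _ = _ := by ring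
  have hα' : |deriv (axialTest ρ N) s| * s ≤
      c * ((3 / 2 + 2 * S) * m + (K1 + 2 * S * K2) * ρ ^ 2) * d := by
    have b2 := hIn (deriv (axialIn ρ) s * s) (K1 * ρ ^ 2) (by positivity) fun h => by
      rw [abs_mul, abs_of_nonneg hs]
      exact mul_le_mul (hK1 s ⟨hs, h⟩).2.1 h hs hK10
    rcases lt_or_ge s (ρ ^ 2 / 2) with h | h
    · have e := axialTest_eventuallyEq_axialIn (ρ := ρ) (N := N) (s := s) (by nlinarith)
      rw [hθ1 h, one_mul, abs_mul, abs_of_nonneg hs] at b2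
      rw [e.deriv_eq]
      refine b2.trans ?_
      have : 0 ≤ ((3 / 2 + 2 * S) * m + 2 * S * K2 * ρ ^ 2) * (c * d) := by positivity
      linarith
    · have hs0 : 0 < s := lt_of_lt_of_le (by positivity) h
      have hp : 0 < s ^ (-(3 / 2) : ℝ) := by positivity
      have e1 : s * s ^ (-(5 / 2) : ℝ) = s ^ (-(3 / 2) : ℝ) := by
        rw [← Real.rpow_one_add' hs (by norm_num)]; norm_num
      have b1 := hOut ((3 / 2 * dipole ρ * s ^ (-(5 / 2) : ℝ) * outerCutoff N s +
          axialOut ρ s * -(deriv Real.smoothTransition (2 - s / N) / N)) * s)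
          ((3 / 2 + 2 * S) * m) (by positivity) fun _ => by
        have c1 : |3 / 2 * m * s ^ (-(3 / 2) : ℝ) * outerCutoff N s| ≤
            3 / 2 * m * s ^ (-(3 / 2) : ℝ) := by
          rw [abs_mul, abs_of_nonneg hχ.1, abs_of_nonneg (by positivity)]
          exact mul_le_of_le_one_right (by positivity) hχ.2
        have c2 : |deriv Real.smoothTransition (2 - s / N) / N * s| ≤ 2 * S := by
          rcases le_or_gt (2 * N) s with h' | h'
          · have : 2 ≤ s / N := (le_div_iff₀ hN0).2 h'
            rw [deriv_smoothTransition_of_nonpos (by linarith)]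
            simpa using hS0
          · have : s / N ≤ 2 := ((div_lt_iff₀ hN0).2 h').le
            have h3 : 0 ≤ s / N := by positivity
            rw [div_mul_eq_mul_div, mul_div_assoc, abs_mul, abs_of_nonneg h3, mul_comm]
            exact mul_le_mul this (hS _) (abs_nonneg _) (by norm_num)
        calc _ = |3 / 2 * dipole ρ * s ^ (-(3 / 2) : ℝ) * outerCutoff N s +
              dipole ρ * s ^ (-(3 / 2) : ℝ) *
                (deriv Real.smoothTransition (2 - s / N) / N * s)| := by
              rw [axialOut, ← e1]; congr 1; ring
          _ ≤ _ := abs_add_le _ _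
          _ ≤ 3 / 2 * m * s ^ (-(3 / 2) : ℝ) + m * s ^ (-(3 / 2) : ℝ) * (2 * S) := by
              refine add_le_add ?_ ?_
              · rw [abs_mul, abs_mul, abs_mul] at c1 ⊢
                rwa [hm, abs_abs] at c1
              · rw [abs_mul, abs_mul, ← hm, abs_of_pos hp]
                gcongr
          _ = _ := by ring
      have b3 : |N * deriv Real.smoothTransition (N * (ρ ^ 2 - s) - 1) *
          (axialIn ρ s - axialOut ρ s * outerCutoff N s) * s| ≤ 2 * S * K2 * ρ ^ 2 * (c * d) := by
        rcases le_or_gt (N * (ρ ^ 2 - s)) 1 with h3 | h3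
        · rw [deriv_smoothTransition_of_nonpos (by linarith)]; simp; positivity
        rcases le_or_gt 2 (N * (ρ ^ 2 - s)) with h4 | h4
        · rw [deriv_smoothTransition_of_one_le (by linarith)]; simp; positivity
        have h5 : s < ρ ^ 2 := by
          by_contra hh
          nlinarith
        rw [outerCutoff_eq_one hN0 (h5.le.trans hN'), mul_one, abs_mul, abs_mul, abs_mul,
          abs_of_pos hN0, abs_of_pos hs0]
        calc _ ≤ N * S * (K2 * (ρ ^ 2 - s)) * ρ ^ 2 := by
              gcongr
              · exact hS _
              · exact hK2 s ⟨h, h5.le⟩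
          _ = S * K2 * ρ ^ 2 * (N * (ρ ^ 2 - s)) := by ring
          _ ≤ S * K2 * ρ ^ 2 * 2 := by gcongr
          _ = 2 * S * K2 * ρ ^ 2 * 1 := by ring
          _ ≤ _ := by gcongr; exact h1 h5.le
      rw [(axialTest_hasDerivAt ρ N hs0).deriv]
      rw [habs]
      calc _ = |(1 - innerCutoff ρ N s) * ((3 / 2 * dipole ρ * s ^ (-(5 / 2) : ℝ) *
            outerCutoff N s +
            axialOut ρ s * -(deriv Real.smoothTransition (2 - s / N) / N)) * s) +
            innerCutoff ρ N s * (deriv (axialIn ρ) s * s) -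
            N * deriv Real.smoothTransition (N * (ρ ^ 2 - s) - 1) *
            (axialIn ρ s - axialOut ρ s * outerCutoff N s) * s| := by congr 1; ring
        _ ≤ _ := abs_sub _ _
        _ ≤ _ := add_le_add_left (abs_add_le _ _) _
        _ ≤ (3 / 2 + 2 * S) * m * (c * d) + K1 * ρ ^ 2 * (c * d) + 2 * S * K2 * ρ ^ 2 * (c * d) :=
            add_le_add (add_le_add b1 b2) b3
        _ = _ := by ring
  have hβ : |radialTest ρ N s| * s ≤ 2 * (|deriv (axialTest ρ N) s| * s) +
      |amplitude ρ * london s * innerCutoff ρ N s| * s := by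
    rw [← mul_assoc, ← add_mul]
    refine mul_le_mul_of_nonneg_right ?_ hs
    rw [radialTest]
    refine (abs_sub _ _).trans ?_
    rw [abs_mul, abs_of_pos (by norm_num : (0 : ℝ) < 2)]
  linarith

theorem exists_bound_testField {ρ : ℝ} (hρ : 0 < ρ) : ∃ K : ℝ, ∀ N : ℝ, 4 / ρ ^ 2 < N →
    ρ ^ 2 ≤ N → ∀ x, ‖testField ρ N x‖ ≤ K * decay x := by
  have hσ : 0 < ρ ^ 2 := by positivity
  set c := max ((1 + ρ ^ 2) ^ (3 / 2 : ℝ)) ((1 + (ρ ^ 2 / 2)⁻¹) ^ (3 / 2 : ℝ))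
  obtain ⟨K, hK⟩ := exists_bound_axialTest hρ c
  refine ⟨K, fun N hN hN' x => (norm_polar_le _ _ x).trans ?_⟩
  have hd := decay_pos x
  refine hK N _ _ hN hN' (sq_nonneg _) hd (fun h => ?_) (fun h => ?_)
  · exact (one_le_decay h).trans (by gcongr; exact le_max_left _ _)
  · exact (rpow_le_decay (by positivity) h).trans (by gcongr; exact le_max_right _ _)

/-! ### The Euler-Lagrange equations and uniqueness of the supercurrent -/

theorem integrable_inner_of_memLp_two {μ : Measure E3} {f g : E3 → E3} (hf : MemLp f 2 μ)
    (hg : MemLp g 2 μ) : Integrable (fun x => inner ℝ (f x) (g x)) μ :=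
  (hf.norm.integrable_mul hg.norm).mono' (hf.1.inner hg.1)
    (Eventually.of_forall fun x => norm_inner_le_norm (𝕜 := ℝ) (f x) (g x))

theorem integral_norm_sq_eq {μ : Measure E3} {u v : E3 → E3} (hu : MemLp u 2 μ)
    (hv : MemLp v 2 μ) : ∫ x, ‖u x‖ ^ 2 ∂μ = ∫ x, ‖u x - v x‖ ^ 2 ∂μ +
      2 * ∫ x, inner ℝ (u x - v x) (v x) ∂μ + ∫ x, ‖v x‖ ^ 2 ∂μ := by
  have hw : MemLp (fun x => u x - v x) 2 μ := hu.sub hv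
  rw [← integral_const_mul, ← integral_add_three hw.norm.integrable_sq
    ((integrable_inner_of_memLp_two hw hv).const_mul 2) hv.norm.integrable_sq]
  congr 1
  funext x
  rw [← norm_add_sq_real, sub_add_cancel]

theorem memLp_ball {A : E3 → E3} (hA : ∀ K : Set E3, IsCompact K → MemLp A 2 (volume.restrict K))
    (ρ : ℝ) : MemLp A 2 (volume.restrict (Metric.ball 0 ρ)) :=
  (hA _ (isCompact_closedBall 0 ρ)).mono_measure
    (Measure.restrict_mono Metric.ball_subset_closedBall le_rfl)

theorem norm_sq_lt_of_mem_ball {ρ : ℝ} {x : E3} (hx : x ∈ Metric.ball (0 : E3) ρ) :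
    ‖x‖ ^ 2 < ρ ^ 2 := by
  have : ‖x‖ < ρ := by simpa using hx
  nlinarith [norm_nonneg x]

theorem norm_sq_ge_of_notMem_ball {ρ : ℝ} (hρ : 0 < ρ) {x : E3}
    (hx : x ∉ Metric.ball (0 : E3) ρ) : ρ ^ 2 ≤ ‖x‖ ^ 2 := by
  have : ρ ≤ ‖x‖ := by simpa using hx
  nlinarith [norm_nonneg x]

theorem meissnerPotential_of_le {ρ : ℝ} {x : E3} (hx : ‖x‖ ^ 2 ≤ ρ ^ 2) :
    meissnerPotential ρ x = (amplitude ρ * london (‖x‖ ^ 2)) • rot x := by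
  rw [meissnerPotential, azim, profile, if_pos hx]

theorem ae_norm_sq_ne {ρ : ℝ} (hρ : 0 < ρ) : ∀ᵐ x : E3, ‖x‖ ^ 2 ≠ ρ ^ 2 := by
  have h : volume (Metric.sphere (0 : E3) ρ) = 0 := Measure.addHaar_sphere _ _ _
  filter_upwards [measure_eq_zero_iff_ae_notMem.1 h] with x hx e
  exact hx (by simpa using (pow_left_inj₀ (norm_nonneg x) hρ.le two_ne_zero).1 e)

theorem tendsto_integral_innerCutoff {ρ : ℝ} {g : E3 → ℝ}
    (hg : IntegrableOn g (Metric.ball 0 ρ)) :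
    Tendsto (fun N => ∫ x in Metric.ball 0 ρ, innerCutoff ρ N (‖x‖ ^ 2) * g x) atTop
      (𝓝 (∫ x in Metric.ball 0 ρ, g x)) := by
  refine tendsto_integral_filter_of_dominated_convergence (fun x => ‖g x‖)
    (Eventually.of_forall fun N => ?_) (Eventually.of_forall fun N => ?_) hg.norm ?_
  · exact ((innerCutoff_contDiff ρ N).continuous.comp
      (continuous_norm.pow 2)).aestronglyMeasurable.mul hg.1
  · refine Eventually.of_forall fun x => ?_
    have h := innerCutoff_mem ρ N (‖x‖ ^ 2)
    rw [norm_mul, Real.norm_of_nonneg h.1]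
    exact mul_le_of_le_one_left (norm_nonneg _) h.2
  · refine (ae_restrict_iff' measurableSet_ball).2 (Eventually.of_forall fun x hx => ?_)
    have hx' := norm_sq_lt_of_mem_ball hx
    refine tendsto_const_nhds.congr' ?_
    filter_upwards [eventually_gt_atTop (2 / (ρ ^ 2 - ‖x‖ ^ 2))] with N hN
    rw [div_lt_iff₀ (by linarith)] at hN
    rw [innerCutoff_eq_one hN.le, one_mul]

/-- The Euler-Lagrange equation for the potential. The compactly supported approximations of the
induced field make it hold without any decay of `A` at infinity. -/
theorem eulerLagrange_potential {ρ : ℝ} (hρ : 0 < ρ) {A : E3 → E3}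
    {D : E3 → Matrix (Fin 3) (Fin 3) ℝ} (hA : Admissible (fun _ => eZ) A D) :
    ∫ x, inner ℝ (curlOf (D x) - eZ - inducedField ρ x) (inducedField ρ x) =
      -∫ x in Metric.ball 0 ρ, inner ℝ (A x - meissnerPotential ρ x) (meissnerPotential ρ x) := by
  have hA' := meissnerPotential_admissible hρ
  obtain ⟨K, hK⟩ := exists_bound_testField hρ
  obtain ⟨K', hK'⟩ := norm_inducedField_le hρ
  have hh : MemLp (inducedField ρ) 2 volume :=
    memLp_of_norm_le_decay (inducedField_continuous hρ) hK'
  have hc : MemLp (fun x => curlOf (D x) - eZ - inducedField ρ x) 2 volume := hA.memLp_curl.sub hh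
  have hball : MemLp (fun x => A x - meissnerPotential ρ x) 2
      (volume.restrict (Metric.ball 0 ρ)) :=
    (memLp_ball hA.memH1Loc.memLp ρ).sub (memLp_ball hA'.memH1Loc.memLp ρ)
  have hev : ∀ᶠ N : ℝ in atTop, 4 / ρ ^ 2 < N ∧ ρ ^ 2 ≤ N :=
    (eventually_gt_atTop _).and (eventually_ge_atTop _)
  have key : ∀ᶠ N : ℝ in atTop,
      ∫ x, inner ℝ (curlOf (D x) - eZ - inducedField ρ x) (testField ρ N x) =
      -∫ x in Metric.ball 0 ρ, innerCutoff ρ N (‖x‖ ^ 2) *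
        inner ℝ (A x - meissnerPotential ρ x) (meissnerPotential ρ x) := by
    filter_upwards [hev] with N hN
    have hX := testField_isTest hρ hN.1 hN.2
    obtain ⟨i1, i2, e1⟩ := hA.memH1Loc.integral_curl hX
    obtain ⟨j1, j2, e2⟩ := hA'.memH1Loc.integral_curl hX
    have hN0 : 0 < N := lt_of_lt_of_le (by positivity) hN.2
    calc _ = ∫ x, (inner ℝ (curlOf (D x)) (testField ρ N x) -
          inner ℝ (curlOf (meissnerJacobian ρ x)) (testField ρ N x)) := by
          congr 1; funext x
          rw [← curlOf_meissnerJacobian hρ, ← inner_sub_left]; congr 1; abel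
      _ = ∫ x, (inner ℝ (A x) (curl (testField ρ N) x) -
          inner ℝ (meissnerPotential ρ x) (curl (testField ρ N) x)) := by
          rw [integral_sub i1 j1, integral_sub i2 j2, e1, e2]
      _ = ∫ x in Metric.ball 0 ρ, (inner ℝ (A x) (curl (testField ρ N) x) -
          inner ℝ (meissnerPotential ρ x) (curl (testField ρ N) x)) := by
          refine (setIntegral_eq_integral_of_forall_compl_eq_zero fun x hx => ?_).symm
          rw [curl_testField hρ hN.1, innerCutoff_eq_zero]
          · simp
          · nlinarith [norm_sq_ge_of_notMem_ball hρ hx]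
      _ = _ := by
          rw [← integral_neg]
          refine setIntegral_congr_fun measurableSet_ball fun x hx => ?_
          rw [curl_testField hρ hN.1, ← meissnerPotential_of_le (norm_sq_lt_of_mem_ball hx).le,
            ← inner_sub_left, inner_neg_right, inner_smul_right]
  have lim1 : Tendsto (fun N => ∫ x, inner ℝ (curlOf (D x) - eZ - inducedField ρ x)
      (testField ρ N x)) atTop
      (𝓝 (∫ x, inner ℝ (curlOf (D x) - eZ - inducedField ρ x) (inducedField ρ x))) := by
    refine tendsto_integral_filter_of_dominated_convergence
      (fun x => ‖curlOf (D x) - eZ - inducedField ρ x‖ * (K * decay x)) ?_ ?_ ?_ ?_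
    · filter_upwards [hev] with N hN
      exact hc.1.inner (testField_isTest hρ hN.1 hN.2).1.continuous.aestronglyMeasurable
    · filter_upwards [hev] with N hN
      refine Eventually.of_forall fun x => (norm_inner_le_norm (𝕜 := ℝ) _ _).trans ?_
      exact mul_le_mul_of_nonneg_left (hK N hN.1 hN.2 x) (norm_nonneg _)
    · exact hc.norm.integrable_mul (memLp_decay.const_mul K)
    · filter_upwards [ae_norm_sq_ne hρ] with x hx
      refine tendsto_const_nhds.congr' ?_
      filter_upwards [testField_eventually_eq hρ hx] with N hN
      rw [hN]
  have lim2 := (tendsto_integral_innerCutoff (ρ := ρ)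
    (integrable_inner_of_memLp_two hball (memLp_ball hA'.memH1Loc.memLp ρ))).neg
  exact tendsto_nhds_unique lim1 (lim2.congr' (key.mono fun N hN => hN.symm))

/-- The Euler-Lagrange equation for the phase: the supercurrent is divergence free and tangential to
the sphere, hence orthogonal to gradients. -/
theorem eulerLagrange_phase {ρ : ℝ} (hρ : 0 < ρ) {φ : E3 → ℝ} {G : E3 → E3}
    (h : MemH1 (Metric.ball 0 ρ) φ G) :
    ∫ x in Metric.ball 0 ρ, inner ℝ (G x) (meissnerPotential ρ x) = 0 := by
  have hA' := meissnerPotential_admissible hρ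
  have lim := tendsto_integral_innerCutoff (ρ := ρ)
    (integrable_inner_of_memLp_two h.memLp_grad (memLp_ball hA'.memH1Loc.memLp ρ))
  refine tendsto_nhds_unique lim (tendsto_const_nhds.congr' ?_)
  filter_upwards [eventually_gt_atTop 0, eventually_ge_atTop (1 / ρ ^ 2)] with N hN hN1
  have hsm : ContDiff ℝ ∞ fun s => amplitude ρ * london s * innerCutoff ρ N s :=
    (contDiff_const.mul london_contDiff).mul (innerCutoff_contDiff ρ N)
  have hσ : 0 < ρ ^ 2 := by positivity
  have hN1' : 1 / N ≤ ρ ^ 2 := by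
    rw [div_le_iff₀ hN]; rwa [div_le_iff₀ hσ, mul_comm] at hN1
  have h0 : 0 ≤ ρ ^ 2 - 1 / N := by linarith
  have hts : tsupport (azim fun s => amplitude ρ * london s * innerCutoff ρ N s) ⊆
      Metric.closedBall 0 (√(ρ ^ 2 - 1 / N)) := by
    refine closure_minimal (fun x hx => ?_) Metric.isClosed_closedBall
    by_contra hc
    apply hx
    have : √(ρ ^ 2 - 1 / N) < ‖x‖ := by simpa using hc
    have h2 : ρ ^ 2 - 1 / N < ‖x‖ ^ 2 := (Real.sqrt_lt' ((Real.sqrt_nonneg _).trans_lt this)).1 this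
    rw [azim, innerCutoff_eq_zero, mul_zero, zero_smul]
    have : ρ ^ 2 - ‖x‖ ^ 2 ≤ 1 / N := by linarith
    calc N * (ρ ^ 2 - ‖x‖ ^ 2) ≤ N * (1 / N) := by gcongr
      _ = 1 := by field_simp
  have hX : IsTest (Metric.ball 0 ρ) (azim fun s => amplitude ρ * london s * innerCutoff ρ N s) := by
    refine ⟨contDiff_azim hsm, ?_, hts.trans (Metric.closedBall_subset_ball ?_)⟩
    · exact (isCompact_closedBall _ _).of_isClosed_subset (isClosed_tsupport _) hts
    · rw [Real.sqrt_lt' hρ]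
      have : 0 < 1 / N := by positivity
      linarith
  have e := h.integral_grad hX
  have hdiv : ∀ x, (jacobian (fderiv ℝ
      (azim fun s => amplitude ρ * london s * innerCutoff ρ N s) x)).trace = 0 := fun x => by
    rw [(hasFDerivAt_azim ((hsm.differentiable (by simp) (‖x‖ ^ 2)).hasDerivAt)).fderiv, trace_azimD]
  simp only [hdiv, mul_zero, integral_zero, neg_zero] at e
  rw [← e]
  refine setIntegral_congr_fun measurableSet_ball fun x hx => ?_
  rw [meissnerPotential_of_le (norm_sq_lt_of_mem_ball hx).le, azim, ← smul_smul, inner_smul_right,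
    inner_smul_right, inner_smul_right]
  ring

theorem memH1_zero (U : Set E3) : MemH1 U 0 0 := by
  refine ⟨MemLp.zero, MemLp.zero, fun j => ⟨?_, ?_, fun η _ => by simp⟩⟩
  · exact (continuous_const (X := E3) (y := (0 : ℝ))).locallyIntegrable.locallyIntegrableOn _
  · exact (continuous_const (X := E3) (y := (0 : ℝ))).locallyIntegrable.locallyIntegrableOn _

/-- The energy is strictly convex in the supercurrent, so that every Meissner state has the explicit
one. -/
theorem IsMeissnerState.current_eq {ρ : ℝ} (hρ : 0 < ρ) {A : E3 → E3}
    {D : E3 → Matrix (Fin 3) (Fin 3) ℝ} {φ : E3 → ℝ} {G : E3 → E3}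
    (h : IsMeissnerState (Metric.ball 0 ρ) (fun _ => eZ) A D φ G) :
    ∀ᵐ x ∂volume.restrict (Metric.ball 0 ρ), A x - G x = meissnerPotential ρ x := by
  have hA' := meissnerPotential_admissible hρ
  have hmin := h.minimal _ _ _ _ hA' (memH1_zero (Metric.ball 0 ρ))
  have hA := memLp_ball h.admissible.memH1Loc.memLp ρ
  have hP := memLp_ball hA'.memH1Loc.memLp ρ
  have hG := h.phase.memLp_grad
  have hGA : MemLp (fun x => G x - A x) 2 (volume.restrict (Metric.ball 0 ρ)) := hG.sub hA
  have hP' : MemLp (fun x => -meissnerPotential ρ x) 2 (volume.restrict (Metric.ball 0 ρ)) := hP.neg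
  have hh : MemLp (inducedField ρ) 2 volume := by
    have := hA'.memLp_curl
    simpa only [curlOf_meissnerJacobian hρ] using this
  have e1 := integral_norm_sq_eq hGA hP'
  have e2 := integral_norm_sq_eq h.admissible.memLp_curl hh
  have EL1 := eulerLagrange_potential hρ h.admissible
  have EL2 := eulerLagrange_phase hρ h.phase
  have e3 : ∫ x in Metric.ball 0 ρ, inner ℝ (G x - A x - -meissnerPotential ρ x)
      (-meissnerPotential ρ x) = ∫ x in Metric.ball 0 ρ,
        inner ℝ (A x - meissnerPotential ρ x) (meissnerPotential ρ x) := by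
    rw [← sub_zero (∫ x in Metric.ball 0 ρ,
      inner ℝ (A x - meissnerPotential ρ x) (meissnerPotential ρ x)), ← EL2,
      ← integral_sub (integrable_inner_of_memLp_two
        (f := fun x => A x - meissnerPotential ρ x) (hA.sub hP) hP) (integrable_inner_of_memLp_two hG hP)]
    congr 1; funext x
    simp only [inner_neg_right, inner_sub_left, inner_neg_left]; ring
  simp only [meissnerEnergy, curlOf_meissnerJacobian hρ, Pi.zero_apply, zero_sub] at hmin
  simp only [e1, e2, e3, EL1] at hmin
  have hpos : 0 ≤ ∫ x, ‖curlOf (D x) - eZ - inducedField ρ x‖ ^ 2 :=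
    integral_nonneg fun x => by positivity
  have hz : ∫ x in Metric.ball 0 ρ, ‖G x - A x - -meissnerPotential ρ x‖ ^ 2 = 0 :=
    le_antisymm (by linarith) (integral_nonneg fun x => by positivity)
  have hw : MemLp (fun x => G x - A x - -meissnerPotential ρ x) 2
    (volume.restrict (Metric.ball 0 ρ)) := hGA.sub hP'
  rw [integral_eq_zero_iff_of_nonneg (fun x => by positivity) hw.norm.integrable_sq] at hz
  filter_upwards [hz] with x hx
  have : G x - A x - -meissnerPotential ρ x = 0 := by simpa using hx
  rw [sub_neg_eq_add] at this
  rw [← sub_eq_zero, ← neg_eq_zero, ← this]; abel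

/-! ### Uniqueness in the div-curl problem on a ball -/

theorem not_isLocalMax_of_deriv_pos {h h' : ℝ → ℝ} {q : ℝ} (hh : ∀ᶠ t in 𝓝 0, HasDerivAt h (h' t) t)
    (h0 : h' 0 = 0) (hq : HasDerivAt h' q 0) (hpos : 0 < q) : ¬IsLocalMax h 0 := by
  intro hmax
  have e1 : ∀ᶠ t in 𝓝[>] (0 : ℝ), 0 < h' t := by
    have := hq.tendsto_slope.eventually (lt_mem_nhds hpos)
    filter_upwards [nhdsWithin_mono (0 : ℝ) (fun t (ht : 0 < t) => ht.ne') this,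
      self_mem_nhdsWithin] with t ht (ht0 : 0 < t)
    rw [slope_def_field, h0, sub_zero, sub_zero] at ht
    exact (div_pos_iff_of_pos_right ht0).1 ht
  obtain ⟨τ, hτ, hτ1⟩ := mem_nhdsGT_iff_exists_Ioo_subset.1 e1
  obtain ⟨τ', hτ', hτ1'⟩ := Metric.eventually_nhds_iff_ball.1 (hh.and hmax)
  set t := min τ τ' / 2 with ht
  have ht0 : 0 < t := half_pos (lt_min hτ hτ')
  have hlt : t < min τ τ' := half_lt_self (lt_min hτ hτ')
  have hball : ∀ s ∈ Icc 0 t, s ∈ Metric.ball (0 : ℝ) τ' := fun s hs => by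
    rw [mem_ball_zero_iff, Real.norm_of_nonneg hs.1]
    exact hs.2.trans_lt (hlt.trans_le (min_le_right _ _))
  have hmono : StrictMonoOn h (Icc 0 t) := by
    refine strictMonoOn_of_deriv_pos (convex_Icc _ _) (fun s hs => ?_) fun s hs => ?_
    · exact (hτ1' s (hball s hs)).1.continuousAt.continuousWithinAt
    · rw [interior_Icc] at hs
      rw [(hτ1' s (hball s ⟨hs.1.le, hs.2.le⟩)).1.deriv]
      exact hτ1 ⟨hs.1, hs.2.trans (hlt.trans_le (min_le_left _ _))⟩
  have := hmono (left_mem_Icc.2 ht0.le) (right_mem_Icc.2 ht0.le) ht0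
  exact absurd (hτ1' t (hball t (right_mem_Icc.2 ht0.le))).2 (not_le.2 this)

theorem inner_basisVec (x : E3) (j : Fin 3) : inner ℝ x (basisVec j) = x j := by
  simp [basisVec, EuclideanSpace.inner_single_right]

/-- The weak maximum principle on a ball, for a potential of a divergence free field. -/
theorem le_of_le_on_sphere {r : ℝ} {f : E3 → ℝ} {V : E3 → E3}
    (hf : ∀ x ∈ Metric.closedBall 0 r, HasFDerivAt f (innerSL ℝ (V x)) x)
    (hV : ∀ x, DifferentiableAt ℝ V x)
    (hdiv : ∀ x ∈ Metric.closedBall 0 r, (jacobian (fderiv ℝ V x)).trace = 0) {M : ℝ}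
    (hM : ∀ x ∈ Metric.sphere 0 r, f x ≤ M) : ∀ x ∈ Metric.closedBall 0 r, f x ≤ M := by
  intro x₀ hx₀
  by_contra! hlt
  -- perturb `f` into a strictly subharmonic function whose maximum is still interior
  obtain ⟨δ, hδ, hδ1⟩ : ∃ δ : ℝ, 0 < δ ∧ δ * r ^ 2 < f x₀ - M := by
    refine ⟨(f x₀ - M) / (r ^ 2 + 1), div_pos (by linarith) (by positivity), ?_⟩
    rw [div_mul_eq_mul_div, div_lt_iff₀ (by positivity)]
    nlinarith
  set g : E3 → ℝ := fun x => f x + δ * ‖x‖ ^ 2 with hg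
  have hgd : ∀ x ∈ Metric.closedBall 0 r,
      HasFDerivAt g (innerSL ℝ (V x) + (2 * δ) • innerSL ℝ x) x := fun x hx => by
    have h1 : HasDerivAt (fun s : ℝ => δ * s) (δ * 1) (‖x‖ ^ 2) := (hasDerivAt_id _).const_mul δ
    have h2 := (hf x hx).add (hasFDerivAt_comp_normSq h1)
    rw [mul_one] at h2
    exact h2
  obtain ⟨y, hy, hymax⟩ := (isCompact_closedBall (0 : E3) r).exists_isMaxOn ⟨x₀, hx₀⟩
    (fun x hx => (hgd x hx).continuousAt.continuousWithinAt)
  have hyx : f x₀ + δ * ‖x₀‖ ^ 2 ≤ f y + δ * ‖y‖ ^ 2 := hymax hx₀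
  have hyball : y ∈ Metric.ball (0 : E3) r := by
    by_contra hc
    have hs : y ∈ Metric.sphere (0 : E3) r := by
      rw [mem_sphere_zero_iff_norm]
      rw [mem_closedBall_zero_iff] at hy
      rw [mem_ball_zero_iff, not_lt] at hc
      exact le_antisymm hy hc
    have h1 := hM y hs
    rw [mem_sphere_zero_iff_norm] at hs
    rw [hs] at hyx
    nlinarith [mul_nonneg hδ.le (sq_nonneg ‖x₀‖)]
  have hloc : IsLocalMax g y :=
    (hymax.on_subset Metric.ball_subset_closedBall).isLocalMax (Metric.isOpen_ball.mem_nhds hyball)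
  have hgrad : innerSL ℝ (V y) + (2 * δ) • innerSL ℝ y = 0 :=
    hloc.hasFDerivAt_eq_zero (hgd y hy)
  obtain ⟨j, hj⟩ : ∃ j, 0 < fderiv ℝ V y (basisVec j) j + 2 * δ := by
    by_contra! hc
    have h0 := hdiv y hy
    simp only [Matrix.trace, Fin.sum_univ_three, jacobian, Matrix.diag_apply, Matrix.of_apply] at h0
    linarith [hc 0, hc 1, hc 2]
  have hline : ∀ t : ℝ, HasDerivAt (fun t : ℝ => y + t • basisVec j) (basisVec j) t := fun t => by
    simpa using ((hasDerivAt_id t).smul_const (basisVec j)).const_add y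
  have hcont : Tendsto (fun t : ℝ => y + t • basisVec j) (𝓝 0) (𝓝 y) := by
    simpa using (hline 0).continuousAt.tendsto
  refine not_isLocalMax_of_deriv_pos (h := fun t => g (y + t • basisVec j))
    (h' := fun t => V (y + t • basisVec j) j + 2 * δ * (y j + t)) ?_ ?_ ?_ hj ?_
  · filter_upwards [hcont.eventually (Metric.isOpen_ball.mem_nhds hyball)] with t ht
    have := (hgd _ (Metric.ball_subset_closedBall ht)).comp_hasDerivAt t (hline t)
    refine this.congr_deriv ?_
    change inner ℝ (V (y + t • basisVec j)) (basisVec j) +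
      2 * δ * inner ℝ (y + t • basisVec j) (basisVec j) = _
    rw [inner_basisVec, inner_basisVec]
    simp
  · have h1 : inner ℝ (V y) (basisVec j) + 2 * δ * inner ℝ y (basisVec j) = 0 :=
      congrArg (fun L => L (basisVec j)) hgrad
    rw [inner_basisVec, inner_basisVec] at h1
    simpa using h1
  · have h1 : HasDerivAt (fun t : ℝ => V (y + t • basisVec j)) (fderiv ℝ V y (basisVec j)) 0 := by
      have := (hV (y + (0 : ℝ) • basisVec j)).hasFDerivAt.comp_hasDerivAt (0 : ℝ) (hline 0)
      rw [zero_smul, add_zero] at this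
      exact this
    have h2 := (EuclideanSpace.proj (𝕜 := ℝ) j).hasFDerivAt.comp_hasDerivAt (0 : ℝ) h1
    have h3 : HasDerivAt (fun t : ℝ => 2 * δ * (y j + t)) (2 * δ * 1) 0 :=
      ((hasDerivAt_id (0 : ℝ)).const_add (y j)).const_mul _
    exact (h2.add h3).congr_deriv (by simp)
  · have h0 : g y = g (y + (0 : ℝ) • basisVec j) := by simp
    have := hcont.eventually hloc
    filter_upwards [this] with t ht
    rw [← h0]; exact ht

theorem exists_ne_zero_orthogonal (a : E3) : ∃ u : E3, u ≠ 0 ∧ inner ℝ a u = 0 := by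
  by_cases h : rot a = 0
  · refine ⟨basisVec 0, fun h0 => by simpa using congrArg (fun x : E3 => x 0) h0, ?_⟩
    have h1 := congrArg (fun x : E3 => x 1) h
    simp at h1
    simp [inner_coord, h1]
  · exact ⟨rot a, h, by simp [inner_coord]; ring⟩

/-- Two points of a sphere are joined by an arc of a great circle. -/
theorem exists_great_circle {r : ℝ} (hr : 0 < r) {a b : E3} (ha : ‖a‖ = r) (hb : ‖b‖ = r) :
    ∃ (c : E3) (t : ℝ), inner ℝ a c = 0 ∧ ‖c‖ = r ∧ 0 ≤ t ∧ t ≤ Real.pi ∧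
      b = Real.cos t • a + Real.sin t • c := by
  set k : ℝ := inner ℝ a b / r ^ 2 with hk
  have hr2 : 0 < r ^ 2 := by positivity
  have hab : |inner ℝ a b| ≤ r ^ 2 := by
    have := abs_real_inner_le_norm a b
    rwa [ha, hb, ← sq] at this
  have hk1 : -1 ≤ k ∧ k ≤ 1 := by
    rw [abs_le] at hab
    exact ⟨by rw [hk, le_div_iff₀ hr2]; linarith, by rw [hk, div_le_iff₀ hr2]; linarith⟩
  set e : E3 := b - k • a with he
  have hae : inner ℝ a e = 0 := by
    rw [he, inner_sub_right, inner_smul_right, real_inner_self_eq_norm_sq, ha, hk]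
    field_simp; ring
  have hne : ‖e‖ ^ 2 = r ^ 2 * (1 - k ^ 2) := by
    have h1 : inner ℝ a b = k * r ^ 2 := by rw [hk]; field_simp
    rw [he, norm_sub_sq_real, inner_smul_right, real_inner_comm, h1, norm_smul, mul_pow, ha, hb,
      Real.norm_eq_abs, sq_abs]
    ring
  have hsin : Real.sin (Real.arccos k) = ‖e‖ / r := by
    rw [Real.sin_arccos, Real.sqrt_eq_iff_mul_self_eq (by nlinarith) (by positivity)]
    field_simp
    linarith
  have hcos : Real.cos (Real.arccos k) = k := Real.cos_arccos hk1.1 hk1.2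
  by_cases h0 : e = 0
  · obtain ⟨u, hu, hau⟩ := exists_ne_zero_orthogonal a
    refine ⟨(r / ‖u‖) • u, Real.arccos k, ?_, ?_, Real.arccos_nonneg _, Real.arccos_le_pi _, ?_⟩
    · rw [inner_smul_right, hau, mul_zero]
    · rw [norm_smul, Real.norm_of_nonneg (by positivity)]
      have : ‖u‖ ≠ 0 := norm_ne_zero_iff.2 hu
      field_simp
    · rw [hsin, hcos, h0, norm_zero, zero_div, zero_smul, add_zero]
      exact sub_eq_zero.1 h0
  · have : ‖e‖ ≠ 0 := norm_ne_zero_iff.2 h0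
    refine ⟨(r / ‖e‖) • e, Real.arccos k, ?_, ?_, Real.arccos_nonneg _, Real.arccos_le_pi _, ?_⟩
    · rw [inner_smul_right, hae, mul_zero]
    · rw [norm_smul, Real.norm_of_nonneg (by positivity)]
      field_simp
    · rw [hsin, hcos, smul_smul, show ‖e‖ / r * (r / ‖e‖) = 1 by field_simp, one_smul, he]
      abel

/-- A potential whose gradient is almost normal to a sphere is almost constant on it. -/
theorem abs_sub_le_on_sphere {r C : ℝ} (hr : 0 < r) {f : E3 → ℝ} {V : E3 → E3}
    (hf : ∀ x ∈ Metric.sphere 0 r, HasFDerivAt f (innerSL ℝ (V x)) x)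
    (hV : ∀ x ∈ Metric.sphere 0 r, ∀ w, inner ℝ x w = 0 → |inner ℝ (V x) w| ≤ C * ‖w‖)
    {a b : E3} (ha : a ∈ Metric.sphere 0 r) (hb : b ∈ Metric.sphere 0 r) :
    |f b - f a| ≤ C * r * Real.pi := by
  rw [mem_sphere_zero_iff_norm] at ha hb
  obtain ⟨c, t, hac, hc, ht0, ht1, hbt⟩ := exists_great_circle hr ha hb
  set γ : ℝ → E3 := fun s => Real.cos s • a + Real.sin s • c with hγ
  set γ' : ℝ → E3 := fun s => (-Real.sin s) • a + Real.cos s • c with hγ'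
  have hd : ∀ s, HasDerivAt γ (γ' s) s := fun s =>
    ((Real.hasDerivAt_cos s).smul_const a).add ((Real.hasDerivAt_sin s).smul_const c)
  have haa : inner ℝ a a = r ^ 2 := by rw [real_inner_self_eq_norm_sq, ha]
  have hcc : inner ℝ c c = r ^ 2 := by rw [real_inner_self_eq_norm_sq, hc]
  have hca : inner ℝ c a = 0 := by rw [real_inner_comm, hac]
  have hn : ∀ s, ‖γ s‖ = r := fun s => by
    rw [← sq_eq_sq₀ (norm_nonneg _) hr.le, ← real_inner_self_eq_norm_sq]
    simp only [hγ, inner_add_left, inner_add_right, inner_smul_left, inner_smul_right, haa, hcc,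
      hac, hca]
    simp
    linear_combination r ^ 2 * Real.sin_sq_add_cos_sq s
  have hn' : ∀ s, ‖γ' s‖ = r := fun s => by
    rw [← sq_eq_sq₀ (norm_nonneg _) hr.le, ← real_inner_self_eq_norm_sq]
    simp only [hγ', inner_add_left, inner_add_right, inner_smul_left, inner_smul_right, haa, hcc,
      hac, hca]
    simp
    linear_combination r ^ 2 * Real.sin_sq_add_cos_sq s
  have hort : ∀ s, inner ℝ (γ s) (γ' s) = 0 := fun s => by
    simp only [hγ, hγ', inner_add_left, inner_add_right, inner_smul_left, inner_smul_right, haa, hcc,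
      hac, hca]
    simp
    ring
  have hC : 0 ≤ C * r := by
    have := (abs_nonneg _).trans (hV (γ 0) (by simpa using hn 0) (γ' 0) (hort 0))
    rwa [hn'] at this
  have h1 : ∀ s, HasDerivAt (fun s => f (γ s)) (inner ℝ (V (γ s)) (γ' s)) s := fun s =>
    (hf (γ s) (by simpa using hn s)).comp_hasDerivAt s (hd s)
  have h2 := norm_image_sub_le_of_norm_deriv_le_segment' (a := 0) (b := t) (C := C * r)
    (fun s _ => (h1 s).hasDerivWithinAt) (fun s _ => by
      have := hV (γ s) (by simpa using hn s) (γ' s) (hort s)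
      rwa [hn'] at this) t (right_mem_Icc.2 ht0)
  have e1 : γ t = b := hbt.symm
  have e2 : γ 0 = a := by simp [hγ]
  simp only [e1, e2, sub_zero, Real.norm_eq_abs] at h2
  exact h2.trans (mul_le_mul_of_nonneg_left ht1 hC)

/-- The partial derivatives of a weakly curl free field are symmetric in the weak sense. -/
theorem weak_symm_of_weak_curl {U : Set E3} {W : E3 → E3} (hW : ContinuousOn W U)
    (hcurl : ∀ X : E3 → E3, IsTest U X → ∫ x in U, inner ℝ (W x) (curl X x) = 0)
    {η : E3 → ℝ} (hη : IsTest U η) (hU : MeasurableSet U) (i j : Fin 3) :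
    ∫ x in U, W x i * fderiv ℝ η x (basisVec j) = ∫ x in U, W x j * fderiv ℝ η x (basisVec i) := by
  have hint : ∀ i j : Fin 3, IntegrableOn (fun x => W x i * fderiv ℝ η x (basisVec j)) U := by
    intro i j
    refine integrable_mul_of_test ?_ (hη.continuous_fderiv _) (hη.hasCompactSupport_fderiv _)
      ((tsupport_fderiv_apply_subset ℝ _).trans hη.2.2)
    exact ((EuclideanSpace.proj (𝕜 := ℝ) i).continuous.comp_continuousOn hW).locallyIntegrableOn hU
  have hX : ∀ k : Fin 3, IsTest U (fun x => η x • basisVec k) := fun k =>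
    ⟨hη.1.smul contDiff_const, hη.2.1.smul_right,
      (closure_mono (Function.support_smul_subset_left _ _)).trans hη.2.2⟩
  have hf : ∀ k x v, fderiv ℝ (fun x => η x • basisVec k) x v = fderiv ℝ η x v • basisVec k :=
    fun k x v => by
      rw [((hη.differentiable x).hasFDerivAt.smul_const (basisVec k)).fderiv]; rfl
  have key : ∀ k, ∫ x in U, (W x 0 * curl (fun x => η x • basisVec k) x 0 +
      W x 1 * curl (fun x => η x • basisVec k) x 1 +
      W x 2 * curl (fun x => η x • basisVec k) x 2) = 0 := fun k => by
    rw [← hcurl _ (hX k)]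
    congr 1; funext x; rw [inner_coord]
  have h01 := key 2
  have h02 := key 1
  have h12 := key 0
  simp only [curl, curlOf_zero, curlOf_one, curlOf_two, Matrix.of_apply, hf, PiLp.smul_apply,
    basisVec_apply, smul_eq_mul] at h01 h02 h12
  have e01 : ∫ x in U, W x 0 * fderiv ℝ η x (basisVec 1) =
      ∫ x in U, W x 1 * fderiv ℝ η x (basisVec 0) := by
    rw [← sub_eq_zero, ← integral_sub (hint 0 1) (hint 1 0), ← h01]
    congr 1; funext x; simp; ring
  have e02 : ∫ x in U, W x 0 * fderiv ℝ η x (basisVec 2) =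
      ∫ x in U, W x 2 * fderiv ℝ η x (basisVec 0) := by
    rw [eq_comm, ← sub_eq_zero, ← integral_sub (hint 2 0) (hint 0 2), ← h02]
    congr 1; funext x; simp; ring
  have e12 : ∫ x in U, W x 1 * fderiv ℝ η x (basisVec 2) =
      ∫ x in U, W x 2 * fderiv ℝ η x (basisVec 1) := by
    rw [← sub_eq_zero, ← integral_sub (hint 1 2) (hint 2 1), ← h12]
    congr 1; funext x; simp; ring
  fin_cases i <;> fin_cases j <;> first | rfl | assumption | exact Eq.symm (by assumption)

/-- The mollification of a field with a bump function. -/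
noncomputable def mollify (φ : ContDiffBump (0 : E3)) (W : E3 → E3) : E3 → E3 :=
  φ.normed volume ⋆[ContinuousLinearMap.lsmul ℝ ℝ, volume] W

theorem mollify_contDiff (φ : ContDiffBump (0 : E3)) {W : E3 → E3} (hW : Continuous W) :
    ContDiff ℝ ∞ (mollify φ W) :=
  φ.hasCompactSupport_normed.contDiff_convolution_left _ φ.contDiff_normed hW.locallyIntegrable

/-- The translated and reflected mollifier, as a test function. -/
theorem isTest_mollifier (φ : ContDiffBump (0 : E3)) {U : Set E3} {x : E3}
    (hx : Metric.closedBall x φ.rOut ⊆ U) : IsTest U (fun y => φ.normed volume (x - y)) := by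
  have hs : tsupport (fun y => φ.normed volume (x - y)) ⊆ Metric.closedBall x φ.rOut := by
    refine closure_minimal (fun y hy => ?_) Metric.isClosed_closedBall
    have h1 : x - y ∈ Function.support (φ.normed volume) := hy
    rw [φ.support_normed_eq, mem_ball_zero_iff] at h1
    rw [mem_closedBall_iff_norm']
    exact h1.le
  exact ⟨φ.contDiff_normed.comp (contDiff_const.sub contDiff_id),
    (isCompact_closedBall _ _).of_isClosed_subset (isClosed_tsupport _) hs, hs.trans hx⟩

theorem fderiv_mollify (φ : ContDiffBump (0 : E3)) {W : E3 → E3} (hW : Continuous W) {U : Set E3}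
    {x : E3} (hx : Metric.closedBall x φ.rOut ⊆ U) (v : E3) (i : Fin 3) :
    fderiv ℝ (mollify φ W) x v i =
      -∫ y in U, W y i * fderiv ℝ (fun y => φ.normed volume (x - y)) y v := by
  have hφ : ContDiff ℝ ∞ (φ.normed (volume : Measure E3)) := φ.contDiff_normed
  have hφd : Differentiable ℝ (φ.normed (volume : Measure E3)) := hφ.differentiable (by simp)
  have h1 := (φ.hasCompactSupport_normed (μ := volume)).hasFDerivAt_convolution_right
    (ContinuousLinearMap.lsmul ℝ ℝ).flip hW.locallyIntegrable (hφ.of_le (by simp)) x (μ := volume)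
  have h2 : ∀ y, fderiv ℝ (fun y => φ.normed volume (x - y)) y v =
      -fderiv ℝ (φ.normed volume) (x - y) v := fun y => by
    have := (hφd (x - y)).hasFDerivAt.comp y ((hasFDerivAt_id y).const_sub x)
    have h3 : HasFDerivAt (fun y => φ.normed volume (x - y)) _ y := this
    rw [h3.fderiv]; simp
  have hT := isTest_mollifier φ hx
  have hint : Integrable fun y => fderiv ℝ (φ.normed volume) (x - y) v • W y := by
    have e : (fun y => fderiv ℝ (φ.normed volume) (x - y) v • W y) =
        fun y => (-fderiv ℝ (fun y => φ.normed volume (x - y)) y v) • W y := by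
      funext y; rw [h2, neg_neg]
    rw [e]
    refine Continuous.integrable_of_hasCompactSupport
      ((hT.continuous_fderiv v).neg.smul hW) ?_
    exact (hT.hasCompactSupport_fderiv v).neg.smul_right
  have h4 : fderiv ℝ (mollify φ W) x v = ∫ y, fderiv ℝ (φ.normed volume) (x - y) v • W y := by
    rw [mollify, ← convolution_flip, h1.fderiv, convolution_precompR_apply _ hW.locallyIntegrable
      (φ.hasCompactSupport_normed.fderiv ℝ) (hφ.continuous_fderiv (by simp))]
    rfl
  have h5 := (EuclideanSpace.proj (𝕜 := ℝ) i).integral_comp_comm hint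
  rw [h4, setIntegral_eq_integral_of_forall_compl_eq_zero, ← integral_neg]
  · change EuclideanSpace.proj (𝕜 := ℝ) i _ = _
    rw [← h5]
    congr 1; funext y
    rw [h2]; simp [mul_comm]
  · intro y hy
    rw [hT.fderiv_eq_zero_of_notMem hy]; simp

/-- A Lipschitz field on a closed ball that is weakly divergence free and curl free and has no
tangential component on the sphere vanishes. The mollified field is the gradient of a harmonic
function that is almost constant on a slightly smaller sphere. -/
theorem eq_zero_of_div_curl {ρ : ℝ} (hρ : 0 < ρ) {W : E3 → E3} {K : NNReal}
    (hL : LipschitzOnWith K W (Metric.closedBall 0 ρ))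
    (htan : ∀ x ∈ Metric.sphere (0 : E3) ρ, ∀ w : E3, inner ℝ x w = 0 → inner ℝ (W x) w = 0)
    (hdiv : ∀ η : E3 → ℝ, IsTest (Metric.ball 0 ρ) η →
      ∫ x in Metric.ball 0 ρ, fderiv ℝ η x (W x) = 0)
    (hcurl : ∀ X : E3 → E3, IsTest (Metric.ball 0 ρ) X →
      ∫ x in Metric.ball 0 ρ, inner ℝ (W x) (curl X x) = 0) :
    ∀ x ∈ Metric.closedBall 0 ρ, W x = 0 := by
  obtain ⟨Y, hY, hWY⟩ := hL.extend_finite_dimension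
  set k : ℝ := ((lipschitzExtensionConstant E3 * K : NNReal) : ℝ) with hk
  have hk0 : 0 ≤ k := NNReal.coe_nonneg _
  have hYk : ∀ x y, ‖Y x - Y y‖ ≤ k * ‖x - y‖ := fun x y => by
    simpa only [dist_eq_norm] using hY.dist_le_mul x y
  have hYc : Continuous Y := hY.continuous
  have hball : ∀ x ∈ Metric.ball (0 : E3) ρ, W x = Y x := fun x hx =>
    hWY (Metric.ball_subset_closedBall hx)
  replace hdiv : ∀ η : E3 → ℝ, IsTest (Metric.ball 0 ρ) η →
      ∫ x in Metric.ball 0 ρ, fderiv ℝ η x (Y x) = 0 := fun η hη => by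
    rw [← hdiv η hη]
    exact setIntegral_congr_fun measurableSet_ball fun x hx => by simp only [hball x hx]
  replace hcurl : ∀ X : E3 → E3, IsTest (Metric.ball 0 ρ) X →
      ∫ x in Metric.ball 0 ρ, inner ℝ (Y x) (curl X x) = 0 := fun X hX => by
    rw [← hcurl X hX]
    exact setIntegral_congr_fun measurableSet_ball fun x hx => by simp only [hball x hx]
  -- the potential of the mollified field
  have main : ∀ ε : ℝ, 0 < ε → 2 * ε < ρ → ∃ (f : E3 → ℝ) (V : E3 → E3),
      (∀ x ∈ Metric.ball (0 : E3) (ρ - ε), HasFDerivAt f (innerSL ℝ (V x)) x) ∧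
      (∀ x, ‖V x - Y x‖ ≤ k * ε) ∧
      ∀ x ∈ Metric.closedBall (0 : E3) (ρ - 2 * ε), ∀ y ∈ Metric.closedBall (0 : E3) (ρ - 2 * ε),
        |f y - f x| ≤ 2 * (3 * k * ε * ρ * Real.pi) := by
    intro ε hε hερ
    let φ : ContDiffBump (0 : E3) := ⟨ε / 2, ε, by positivity, by linarith⟩
    set V := mollify φ Y with hV
    have hVs : ContDiff ℝ ∞ V := mollify_contDiff φ hYc
    have hVd : Differentiable ℝ V := hVs.differentiable (by simp)
    have hsub : ∀ x ∈ Metric.ball (0 : E3) (ρ - ε),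
        Metric.closedBall x φ.rOut ⊆ Metric.ball (0 : E3) ρ := fun x hx =>
      Metric.closedBall_subset_ball' (by
        rw [Metric.mem_ball] at hx
        change ε + dist x 0 < ρ
        linarith)
    have hclose : ∀ x, ‖V x - Y x‖ ≤ k * ε := fun x => by
      rw [← dist_eq_norm]
      refine φ.dist_normed_convolution_le hYc.aestronglyMeasurable fun y hy => ?_
      rw [dist_eq_norm]
      rw [mem_ball_iff_norm] at hy
      exact (hYk y x).trans (mul_le_mul_of_nonneg_left hy.le hk0)
    have hsymm : ∀ x ∈ Metric.ball (0 : E3) (ρ - ε), ∀ i j,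
        fderiv ℝ V x (basisVec j) i = fderiv ℝ V x (basisVec i) j := fun x hx i j => by
      rw [hV, fderiv_mollify φ hYc (hsub x hx), fderiv_mollify φ hYc (hsub x hx),
        weak_symm_of_weak_curl hYc.continuousOn hcurl (isTest_mollifier φ (hsub x hx))
          measurableSet_ball]
    have htr : ∀ x ∈ Metric.ball (0 : E3) (ρ - ε), (jacobian (fderiv ℝ V x)).trace = 0 := by
      intro x hx
      have hη := isTest_mollifier φ (hsub x hx)
      have hint : ∀ j : Fin 3, IntegrableOn (fun y => Y y j *
          fderiv ℝ (fun y => φ.normed volume (x - y)) y (basisVec j)) (Metric.ball 0 ρ) := fun j =>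
        integrable_mul_of_test (f := fun y => Y y j) (((EuclideanSpace.proj (𝕜 := ℝ) j).continuous.comp
            hYc).locallyIntegrable.locallyIntegrableOn _)
          (hη.continuous_fderiv _) (hη.hasCompactSupport_fderiv _)
          ((tsupport_fderiv_apply_subset ℝ _).trans hη.2.2)
      simp only [Matrix.trace, Fin.sum_univ_three, jacobian, Matrix.diag_apply, Matrix.of_apply]
      rw [hV, fderiv_mollify φ hYc (hsub x hx), fderiv_mollify φ hYc (hsub x hx),
        fderiv_mollify φ hYc (hsub x hx), ← neg_add, ← neg_add,
        ← integral_add_three (hint 0) (hint 1) (hint 2), neg_eq_zero, ← hdiv _ hη]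
      congr 1; funext y
      have e : Y y = Y y 0 • basisVec 0 + Y y 1 • basisVec 1 + Y y 2 • basisVec 2 := by
        apply ext_coord <;> simp
      conv_rhs => rw [e]
      simp only [map_add, map_smul, smul_eq_mul]
    have hD : ∀ x, HasFDerivAt (fun x => innerSL ℝ (V x)) ((innerSL ℝ).comp (fderiv ℝ V x)) x :=
      fun x => (innerSL ℝ (E := E3)).hasFDerivAt.comp x (hVd x).hasFDerivAt
    have hdo : DifferentiableOn ℝ (fun x => innerSL ℝ (V x)) (Metric.ball 0 (ρ - ε)) :=
      fun x _ => (hD x).differentiableAt.differentiableWithinAt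
    obtain ⟨f, hf⟩ := (convex_ball (0 : E3) (ρ - ε)).exists_forall_hasFDerivAt_of_fderiv_symmetric
      Metric.isOpen_ball hdo (fun a ha x y => by
        rw [(hD a).fderiv]
        change inner ℝ (fderiv ℝ V a x) y = inner ℝ (fderiv ℝ V a y) x
        have e : ∀ x : E3, fderiv ℝ V a x = x 0 • fderiv ℝ V a (basisVec 0) +
            x 1 • fderiv ℝ V a (basisVec 1) + x 2 • fderiv ℝ V a (basisVec 2) := fun x => by
          rw [← map_smul, ← map_smul, ← map_smul, ← map_add, ← map_add]
          congr 1
          apply ext_coord <;> simp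
        rw [e x, e y]
        simp only [inner_coord, PiLp.add_apply, PiLp.smul_apply, smul_eq_mul, hsymm a ha 1 0,
          hsymm a ha 2 0, hsymm a ha 2 1]
        ring)
    refine ⟨f, V, hf, hclose, ?_⟩
    set r := ρ - 2 * ε with hr
    have hr0 : 0 < r := by linarith
    have hrsub : Metric.closedBall (0 : E3) r ⊆ Metric.ball 0 (ρ - ε) :=
      Metric.closedBall_subset_ball (by linarith)
    have htanV : ∀ x ∈ Metric.sphere (0 : E3) r, ∀ w, inner ℝ x w = 0 →
        |inner ℝ (V x) w| ≤ 3 * k * ε * ‖w‖ := by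
      intro x hx w hw
      rw [mem_sphere_zero_iff_norm] at hx
      have hx' : ‖(ρ / r) • x‖ = ρ := by
        rw [norm_smul, hx, Real.norm_of_nonneg (by positivity)]; field_simp
      have h1 : inner ℝ (Y ((ρ / r) • x)) w = 0 := by
        rw [← hWY (by simpa using hx'.le)]
        exact htan _ (by simpa using hx') w (by rw [inner_smul_left, hw, mul_zero])
      have h2 : ‖x - (ρ / r) • x‖ = 2 * ε := by
        have : x - (ρ / r) • x = (1 - ρ / r) • x := by rw [sub_smul, one_smul]
        rw [this, norm_smul, hx, Real.norm_eq_abs, ← abs_of_pos hr0, ← abs_mul, abs_of_pos hr0,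
          sub_mul, one_mul, div_mul_cancel₀ _ hr0.ne', abs_sub_comm, abs_of_pos (by linarith)]
        linarith
      have h3 : inner ℝ (V x) w = inner ℝ (V x - Y ((ρ / r) • x)) w := by
        rw [inner_sub_left, h1, sub_zero]
      rw [h3]
      refine (abs_real_inner_le_norm _ _).trans (mul_le_mul_of_nonneg_right ?_ (norm_nonneg _))
      calc _ = ‖(V x - Y x) + (Y x - Y ((ρ / r) • x))‖ := by congr 1; abel
        _ ≤ k * ε + k * (2 * ε) := by
          refine (norm_add_le _ _).trans (add_le_add (hclose x) ?_)
          rw [← h2]; exact hYk _ _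
        _ = _ := by ring
    have hosc : ∀ a ∈ Metric.sphere (0 : E3) r, ∀ b ∈ Metric.sphere (0 : E3) r,
        |f b - f a| ≤ 3 * k * ε * ρ * Real.pi := fun a ha b hb => by
      refine (abs_sub_le_on_sphere hr0 (fun x hx => hf x (hrsub (Metric.sphere_subset_closedBall hx)))
        htanV ha hb).trans ?_
      have := Real.pi_pos
      gcongr
      linarith
    have ha : r • eZ ∈ Metric.sphere (0 : E3) r := by
      rw [mem_sphere_zero_iff_norm, norm_smul, norm_eZ, mul_one, Real.norm_of_nonneg hr0.le]
    set C := 3 * k * ε * ρ * Real.pi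
    have hup := le_of_le_on_sphere (fun x hx => hf x (hrsub hx)) hVd (fun x hx => htr x (hrsub hx))
      (M := f (r • eZ) + C) (fun x hx => by linarith [(abs_le.1 (hosc _ ha x hx)).2])
    have hdn := le_of_le_on_sphere (f := fun x => -f x) (V := fun x => -V x)
      (fun x hx => by rw [map_neg]; exact (hf x (hrsub hx)).neg) (fun x => (hVd x).neg)
      (fun x hx => by
        have := htr x (hrsub hx)
        simp only [Matrix.trace, Fin.sum_univ_three, jacobian, Matrix.diag_apply,
          Matrix.of_apply] at this ⊢
        rw [fderiv_fun_neg]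
        simp only [neg_apply, PiLp.neg_apply]
        linarith)
      (M := -f (r • eZ) + C) (fun x hx => by linarith [(abs_le.1 (hosc _ ha x hx)).1])
    intro x hx y hy
    rw [abs_le]
    constructor <;> linarith [hup x hx, hup y hy, hdn x hx, hdn y hy]
  -- the limit of vanishing mollification, at an interior point
  have hin : ∀ x ∈ Metric.ball (0 : E3) ρ, Y x = 0 := by
    intro x hx
    set v := Y x with hv
    rw [mem_ball_zero_iff] at hx
    set R := (‖x‖ + ρ) / 2 with hR
    have hsmall : ∀ t : ℝ, 0 < t → ‖x‖ + t * ‖v‖ < R → t * ‖v‖ ^ 2 ≤ k * t ^ 2 * ‖v‖ ^ 2 := by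
      intro t ht htR
      have hev : ∀ᶠ ε in 𝓝[>] (0 : ℝ), t * ‖v‖ ^ 2 ≤
          2 * (3 * k * ε * ρ * Real.pi) + (k * ε + k * t * ‖v‖) * (t * ‖v‖) := by
        have hpos : 0 < (ρ - R) / 2 := by rw [hR]; linarith
        filter_upwards [Ioo_mem_nhdsGT hpos] with ε hε
        have hRpos : 0 < R := by rw [hR]; linarith [norm_nonneg x]
        obtain ⟨f, V, hf, hVY, hosc⟩ := main ε hε.1 (by linarith [hε.2])
        have hsub : Metric.ball (0 : E3) R ⊆ Metric.ball 0 (ρ - ε) :=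
          Metric.ball_subset_ball (by linarith [hε.2, hε.1])
        have hsub' : Metric.ball (0 : E3) R ⊆ Metric.closedBall 0 (ρ - 2 * ε) := fun y hy =>
          Metric.closedBall_subset_closedBall (by linarith [hε.2]) (Metric.ball_subset_closedBall hy)
        have hseg : ∀ s ∈ Icc (0 : ℝ) t, x + s • v ∈ Metric.ball (0 : E3) R := fun s hs => by
          rw [mem_ball_zero_iff]
          refine (norm_add_le _ _).trans_lt (lt_of_le_of_lt ?_ htR)
          rw [norm_smul, Real.norm_of_nonneg hs.1]
          gcongr
          exact hs.2
        have hd : ∀ s ∈ Icc (0 : ℝ) t, HasDerivWithinAt (fun s : ℝ => f (x + s • v) - s * ‖v‖ ^ 2)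
            (inner ℝ (V (x + s • v) - v) v) (Icc 0 t) s := fun s hs => by
          have h1 : HasDerivAt (fun s : ℝ => x + s • v) v s := by
            simpa using ((hasDerivAt_id s).smul_const v).const_add x
          have h2 := (hf _ (hsub (hseg s hs))).comp_hasDerivAt s h1
          have h3 := h2.sub ((hasDerivAt_id s).mul_const (‖v‖ ^ 2))
          refine (h3.congr_deriv ?_).hasDerivWithinAt
          rw [inner_sub_left, real_inner_self_eq_norm_sq, one_mul]; rfl
        have hb : ∀ s ∈ Ico (0 : ℝ) t, ‖inner ℝ (V (x + s • v) - v) v‖ ≤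
            (k * ε + k * t * ‖v‖) * ‖v‖ := fun s hs => by
          refine (norm_inner_le_norm _ _).trans (mul_le_mul_of_nonneg_right ?_ (norm_nonneg _))
          calc _ = ‖(V (x + s • v) - Y (x + s • v)) + (Y (x + s • v) - Y x)‖ := by
                congr 1; rw [hv]; abel
            _ ≤ k * ε + k * ‖x + s • v - x‖ :=
                (norm_add_le _ _).trans (add_le_add (hVY _) (hYk _ _))
            _ ≤ _ := by
                rw [add_sub_cancel_left, norm_smul, Real.norm_of_nonneg hs.1, ← mul_assoc]
                gcongr
                exact hs.2.le
        have h1 := norm_image_sub_le_of_norm_deriv_le_segment' hd hb t (right_mem_Icc.2 ht.le)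
        have h2 := hosc x (hsub' (by simpa using hseg 0 (left_mem_Icc.2 ht.le))) (x + t • v)
          (hsub' (hseg t (right_mem_Icc.2 ht.le)))
        simp only [zero_smul, add_zero, zero_mul, sub_zero, Real.norm_eq_abs] at h1
        have h3 := (abs_le.1 h1).1
        have h4 := (abs_le.1 h2).2
        linarith
      have hlim : Tendsto (fun ε : ℝ => 2 * (3 * k * ε * ρ * Real.pi) +
          (k * ε + k * t * ‖v‖) * (t * ‖v‖)) (𝓝[>] 0)
          (𝓝 (2 * (3 * k * 0 * ρ * Real.pi) + (k * 0 + k * t * ‖v‖) * (t * ‖v‖))) := by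
        refine (Continuous.tendsto ?_ 0).mono_left nhdsWithin_le_nhds
        fun_prop
      have := ge_of_tendsto hlim hev
      linarith
    by_contra hv0
    have hvp : 0 < ‖v‖ := norm_pos_iff.2 hv0
    have hev : ∀ᶠ t in 𝓝[>] (0 : ℝ), 1 ≤ k * t := by
      have h1 : Tendsto (fun t : ℝ => ‖x‖ + t * ‖v‖) (𝓝[>] 0) (𝓝 (‖x‖ + 0 * ‖v‖)) :=
        (Continuous.tendsto (by fun_prop) 0).mono_left nhdsWithin_le_nhds
      filter_upwards [self_mem_nhdsWithin, h1.eventually (gt_mem_nhds (show _ < R by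
        rw [hR]; linarith))] with t (ht : 0 < t) htR
      have h2 := hsmall t ht htR
      have h3 : 0 < t * ‖v‖ ^ 2 := by positivity
      by_contra! hc
      nlinarith
    have h1 : Tendsto (fun t : ℝ => k * t) (𝓝[>] 0) (𝓝 (k * 0)) :=
      (Continuous.tendsto (by fun_prop) 0).mono_left nhdsWithin_le_nhds
    have := ge_of_tendsto h1 hev
    linarith
  have hcl : ∀ x ∈ closure (Metric.ball (0 : E3) ρ), Y x = 0 := fun x hx =>
    closure_minimal hin (isClosed_eq hYc continuous_const) hx
  rw [closure_ball _ hρ.ne'] at hcl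
  intro x hx
  rw [hWY hx, hcl x hx]

/-! ### The explicit Meissner magnetic field -/

theorem londonMean_hasDerivAt (s : ℝ) : HasDerivAt londonMean (deriv londonMean s) s :=
  (londonMean_contDiff.differentiable (by simp) s).hasDerivAt

theorem deriv_londonMean_contDiff : ContDiff ℝ ∞ (deriv londonMean) :=
  (contDiff_infty_iff_deriv.1 londonMean_contDiff).2

/-- The explicit field whose curl is the supercurrent and which is normal to the sphere: minus the
magnetic field of the Meissner state, up to a uniform field. -/
noncomputable def meissnerB (ρ : ℝ) : E3 → E3 :=
  polar (fun s => axialIn ρ (ρ ^ 2) - axialIn ρ s) (fun s => 2 * (amplitude ρ * deriv london s))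

theorem meissnerB_contDiff (ρ : ℝ) : ContDiff ℝ ∞ (meissnerB ρ) :=
  contDiff_polar (contDiff_const.sub (axialIn_contDiff ρ))
    (contDiff_const.mul (contDiff_const.mul deriv_london_contDiff))

theorem hasFDerivAt_meissnerB (ρ : ℝ) (x : E3) :
    HasFDerivAt (meissnerB ρ) (polarD (-deriv (axialIn ρ) (‖x‖ ^ 2))
      (2 * (amplitude ρ * deriv london (‖x‖ ^ 2)))
      (2 * (amplitude ρ * deriv (deriv london) (‖x‖ ^ 2))) x) x :=
  hasFDerivAt_polar ((axialIn_hasDerivAt ρ _).const_sub _)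
    (((deriv_london_contDiff.differentiable (by simp) _).hasDerivAt.const_mul _).const_mul _)

theorem curl_meissnerB (ρ : ℝ) (x : E3) :
    curlOf (jacobian (fderiv ℝ (meissnerB ρ) x)) =
      (amplitude ρ * london (‖x‖ ^ 2)) • rot x := by
  rw [(hasFDerivAt_meissnerB ρ x).fderiv, curlOf_polarD]
  congr 1
  linear_combination deriv_axialIn ρ (‖x‖ ^ 2)

theorem div_meissnerB (ρ : ℝ) (x : E3) : (jacobian (fderiv ℝ (meissnerB ρ) x)).trace = 0 := by
  rw [(hasFDerivAt_meissnerB ρ x).fderiv, trace_polarD]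
  linear_combination (-x 2) * deriv_axialIn ρ (‖x‖ ^ 2) +
    x 2 * amplitude ρ * london_ode (‖x‖ ^ 2)

theorem meissnerB_normal {ρ : ℝ} {x : E3} (hx : x ∈ Metric.sphere (0 : E3) ρ) {w : E3}
    (hw : inner ℝ x w = 0) : inner ℝ (meissnerB ρ x) w = 0 := by
  rw [mem_sphere_zero_iff_norm] at hx
  rw [meissnerB, polar, hx, sub_self, zero_smul, zero_add, inner_smul_left, hw, mul_zero]

/-- The divergence theorem for a field of class `C¹` against a test function. -/
theorem integral_fderiv_test {U : Set E3} {M : E3 → E3} (hM : ContDiff ℝ 1 M) {η : E3 → ℝ}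
    (hη : IsTest U η) : ∫ x in U, fderiv ℝ η x (M x) =
      -∫ x, (jacobian (fderiv ℝ M x)).trace * η x := by
  have hc : ∀ j : Fin 3, ContDiff ℝ 1 fun x => M x j := fun j =>
    (EuclideanSpace.proj (𝕜 := ℝ) j).contDiff.comp hM
  have hd : ∀ x, DifferentiableAt ℝ M x := hM.differentiable one_ne_zero
  have h := fun j => integral_mul_fderiv_test (hc j) hη (basisVec j)
  simp only [fderiv_coord (hd _)] at h
  have i1 : ∀ j : Fin 3, Integrable fun x => M x j * fderiv ℝ η x (basisVec j) := fun j =>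
    ((hc j).continuous.mul (hη.continuous_fderiv _)).integrable_of_hasCompactSupport
      (hη.hasCompactSupport_fderiv _).mul_left
  have i2 : ∀ j : Fin 3, Integrable fun x => fderiv ℝ M x (basisVec j) j * η x := fun j =>
    (((EuclideanSpace.proj (𝕜 := ℝ) j).continuous.comp ((hM.continuous_fderiv
      one_ne_zero).clm_apply continuous_const)).mul
        hη.1.continuous).integrable_of_hasCompactSupport hη.2.1.mul_left
  rw [setIntegral_eq_integral_of_forall_compl_eq_zero
    (fun x hx => by rw [hη.fderiv_eq_zero_of_notMem hx]; rfl)]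
  calc _ = ∫ x, (M x 0 * fderiv ℝ η x (basisVec 0) + M x 1 * fderiv ℝ η x (basisVec 1) +
        M x 2 * fderiv ℝ η x (basisVec 2)) := by
        congr 1; funext x
        have e : M x = M x 0 • basisVec 0 + M x 1 • basisVec 1 + M x 2 • basisVec 2 := by
          apply ext_coord <;> simp
        conv_lhs => rw [e]
        simp only [map_add, map_smul, smul_eq_mul]
    _ = -∫ x, (fderiv ℝ M x (basisVec 0) 0 * η x + fderiv ℝ M x (basisVec 1) 1 * η x +
        fderiv ℝ M x (basisVec 2) 2 * η x) := by
        rw [integral_add_three (i1 0) (i1 1) (i1 2), integral_add_three (i2 0) (i2 1) (i2 2),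
          h, h, h]
        ring
    _ = _ := by
        congr 2; funext x
        simp only [Matrix.trace, Fin.sum_univ_three, jacobian, Matrix.diag_apply, Matrix.of_apply]
        ring

theorem IsTest.continuous_curl {U : Set E3} {X : E3 → E3} (hX : IsTest U X) :
    Continuous (curl X) := by
  have h : ∀ i j : Fin 3, Continuous fun x => fderiv ℝ X x (basisVec j) i := fun i j =>
    (EuclideanSpace.proj (𝕜 := ℝ) i).continuous.comp (hX.continuous_fderiv _)
  refine (PiLp.continuous_toLp 2 _).comp (continuous_pi fun i => ?_)
  fin_cases i
  · exact (h 2 1).sub (h 1 2)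
  · exact (h 0 2).sub (h 2 0)
  · exact (h 1 0).sub (h 0 1)

/-- The Meissner magnetic field of a ball is the explicit one. -/
theorem IsMeissnerField.eq_meissnerB {ρ : ℝ} (hρ : 0 < ρ) {B : E3 → E3}
    (hB : IsMeissnerField ρ B) : ∀ x ∈ Metric.closedBall 0 ρ, B x = meissnerB ρ x := by
  obtain ⟨A, D, φ, G, hst, ⟨K, hL⟩, htan, hdiv, hcurl⟩ := hB
  have hM := meissnerB_contDiff ρ
  have hM1 : ContDiff ℝ 1 (meissnerB ρ) := hM.of_le (by simp)
  have hBc : ContinuousOn B (Metric.closedBall 0 ρ) := hL.continuousOn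
  obtain ⟨C, hC⟩ := (isCompact_closedBall (0 : E3) ρ).exists_bound_of_continuousOn
    (hM1.continuous_fderiv one_ne_zero).continuousOn
  have hML : LipschitzOnWith C.toNNReal (meissnerB ρ) (Metric.closedBall 0 ρ) :=
    (convex_closedBall (0 : E3) ρ).lipschitzOnWith_of_nnnorm_fderiv_le
      (fun x _ => hM1.differentiable one_ne_zero x) fun x hx => by
        rw [← NNReal.coe_le_coe, coe_nnnorm]
        exact (hC x hx).trans (Real.le_coe_toNNReal C)
  have hsubL := hL.sub hML
  have int : ∀ f : E3 → ℝ, ContinuousOn f (Metric.closedBall 0 ρ) →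
      IntegrableOn f (Metric.ball 0 ρ) := fun f hf =>
    (hf.integrableOn_compact (isCompact_closedBall _ _)).mono_set Metric.ball_subset_closedBall
  have key := eq_zero_of_div_curl hρ (W := fun x => B x - meissnerB ρ x) hsubL ?_ ?_ ?_
  · exact fun x hx => sub_eq_zero.1 (key x hx)
  · intro x hx w hw
    rw [inner_sub_left, htan x hx w hw, meissnerB_normal hx hw, sub_zero]
  · intro η hη
    have hf : Continuous (fderiv ℝ η) := hη.1.continuous_fderiv (by simp)
    simp only [map_sub]
    rw [integral_sub (int _ (hf.continuousOn.clm_apply hBc))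
      (int _ (hf.continuousOn.clm_apply hM1.continuous.continuousOn)), hdiv η hη,
      integral_fderiv_test hM1 hη]
    simp [div_meissnerB]
  · intro X hX
    have hcX := hX.continuous_curl.continuousOn (s := Metric.closedBall 0 ρ)
    simp only [inner_sub_left]
    rw [integral_sub (int _ (hBc.inner hcX)) (int _ (hM1.continuous.continuousOn.inner hcX)),
      hcurl X hX, sub_eq_zero]
    have e1 := ((memH1Loc_of_contDiff hM1).integral_curl (hX.mono (subset_univ _))).2.2
    have e2 : ∫ x in Metric.ball 0 ρ, inner ℝ (meissnerB ρ x) (curl X x) =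
        ∫ x, inner ℝ (meissnerB ρ x) (curl X x) :=
      setIntegral_eq_integral_of_forall_compl_eq_zero fun x hx => by
        rw [curl_eq_curlOf_jacobian, hX.fderiv_eq_zero_of_notMem hx]
        have : curlOf (jacobian 0) = 0 := by apply ext_coord <;> simp [jacobian]
        rw [this, inner_zero_right]
    have e3 : ∫ x in Metric.ball 0 ρ, inner ℝ (curlOf (jacobian (fderiv ℝ (meissnerB ρ) x))) (X x) =
        ∫ x, inner ℝ (curlOf (jacobian (fderiv ℝ (meissnerB ρ) x))) (X x) :=
      setIntegral_eq_integral_of_forall_compl_eq_zero fun x hx => by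
        rw [hX.eq_zero_of_notMem hx, inner_zero_right]
    rw [e2, ← e1, ← e3]
    refine integral_congr_ae ?_
    filter_upwards [hst.current_eq hρ, ae_restrict_mem measurableSet_ball] with x hx hxb
    rw [hx, curl_meissnerB, meissnerPotential_of_le (norm_sq_lt_of_mem_ball hxb).le]

/-! ### The calibration -/

/-- The coefficient of `x₂ x` in the calibration. -/
noncomputable def calQ (ρ s : ℝ) : ℝ := 2 * amplitude ρ * (deriv london s + 2 * deriv londonMean s)

/-- The ratio of the vertical diameter. -/
noncomputable def maxRatio (ρ : ℝ) : ℝ := ρ ^ 2 * calQ ρ (ρ ^ 2)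

/-- A field that differs from the Meissner magnetic field by the gradient of a function vanishing
on the sphere, whose norm is at most `maxRatio ρ` in the ball, and which equals `maxRatio ρ • e_z` on
the vertical diameter. -/
noncomputable def calibration (ρ : ℝ) : E3 → E3 :=
  polar (fun s => maxRatio ρ - s * calQ ρ s) (calQ ρ)

/-- The profile of the potential of `meissnerB ρ - calibration ρ`. -/
noncomputable def potentialProfile (ρ s : ℝ) : ℝ :=
  2 * amplitude ρ * (londonMean (ρ ^ 2) - londonMean s)

/-- The potential of `meissnerB ρ - calibration ρ`; it vanishes on the sphere. -/
noncomputable def calPotential (ρ : ℝ) (x : E3) : ℝ := x 2 * potentialProfile ρ (‖x‖ ^ 2)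

theorem potentialProfile_hasDerivAt (ρ s : ℝ) :
    HasDerivAt (potentialProfile ρ) (-(2 * amplitude ρ * deriv londonMean s)) s :=
  (((londonMean_hasDerivAt s).const_sub _).const_mul _).congr_deriv (by ring)

theorem hasFDerivAt_calPotential (ρ : ℝ) (x : E3) :
    HasFDerivAt (calPotential ρ) (innerSL ℝ (meissnerB ρ x - calibration ρ x)) x := by
  have h1 := (EuclideanSpace.proj (𝕜 := ℝ) (2 : Fin 3)).hasFDerivAt (x := x)
  have h2 := h1.mul (hasFDerivAt_comp_normSq (potentialProfile_hasDerivAt ρ (‖x‖ ^ 2)))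
  refine h2.congr_fderiv ?_
  ext v
  have e1 := londonMean_ode (‖x‖ ^ 2)
  have e2 := londonMean_ode (ρ ^ 2)
  change x 2 * (2 * -(2 * amplitude ρ * deriv londonMean (‖x‖ ^ 2)) * inner ℝ x v) +
    potentialProfile ρ (‖x‖ ^ 2) * v 2 = inner ℝ (meissnerB ρ x - calibration ρ x) v
  have e3 : inner ℝ eZ v = v 2 := by simp [inner_coord]
  simp only [meissnerB, calibration, polar, inner_sub_left, inner_add_left, inner_smul_left, e3,
    potentialProfile, maxRatio, calQ, axialIn]
  simp
  linear_combination (2 * amplitude ρ * v 2) * e2 - (2 * amplitude ρ * v 2) * e1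

theorem calQ_pos (ρ : ℝ) {s : ℝ} (hs : 0 ≤ s) : 0 < calQ ρ s := by
  have h1 := amplitude_pos ρ
  have h2 := deriv_london_pos hs
  have h3 := deriv_londonMean_pos hs
  rw [calQ]; positivity

theorem calQ_mono (ρ : ℝ) {s t : ℝ} (hs : 0 ≤ s) (hst : s ≤ t) : calQ ρ s ≤ calQ ρ t := by
  have h1 := amplitude_pos ρ
  have h2 := deriv_london_mono hs hst
  have h3 := deriv_londonMean_mono hs hst
  rw [calQ, calQ]; gcongr

theorem maxRatio_pos {ρ : ℝ} (hρ : 0 < ρ) : 0 < maxRatio ρ :=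
  mul_pos (by positivity) (calQ_pos ρ (sq_nonneg ρ))

theorem mul_calQ_le {ρ s : ℝ} (hs : 0 ≤ s) (hsρ : s ≤ ρ ^ 2) : s * calQ ρ s ≤ maxRatio ρ :=
  mul_le_mul hsρ (calQ_mono ρ hs hsρ) (calQ_pos ρ hs).le (sq_nonneg ρ)

theorem calQ_contDiff (ρ : ℝ) : ContDiff ℝ ∞ (calQ ρ) := by
  have h1 := deriv_london_contDiff
  have h2 := deriv_londonMean_contDiff
  unfold calQ
  fun_prop

theorem calibration_contDiff (ρ : ℝ) : ContDiff ℝ ∞ (calibration ρ) :=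
  contDiff_polar (contDiff_const.sub (contDiff_id.mul (calQ_contDiff ρ))) (calQ_contDiff ρ)

theorem calPotential_contDiff (ρ : ℝ) : ContDiff ℝ ∞ (calPotential ρ) := by
  have h : ContDiff ℝ ∞ (potentialProfile ρ) :=
    contDiff_const.mul (contDiff_const.sub londonMean_contDiff)
  exact (EuclideanSpace.proj (𝕜 := ℝ) (2 : Fin 3)).contDiff.mul (h.comp (contDiff_norm_sq ℝ))

theorem inner_calibration (ρ : ℝ) (x v : E3) :
    inner ℝ (calibration ρ x) v = maxRatio ρ * v 2 + calQ ρ (‖x‖ ^ 2) *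
      (x 2 * (x 0 * v 0 + x 1 * v 1) - (x 0 ^ 2 + x 1 ^ 2) * v 2) := by
  have e3 : inner ℝ eZ v = v 2 := by simp [inner_coord]
  simp only [calibration, polar, inner_add_left, inner_smul_left, e3, inner_coord x v]
  have := norm_sq_coord x
  simp
  linear_combination (-(calQ ρ (‖x‖ ^ 2) * v 2)) * this

/-- The length of the calibration in terms of the distance to the axis; the last factor is positive
in the ball by `mul_calQ_le`. -/
theorem norm_sq_calibration (ρ : ℝ) (x : E3) : ‖calibration ρ x‖ ^ 2 = maxRatio ρ ^ 2 -
    (x 0 ^ 2 + x 1 ^ 2) * (calQ ρ (‖x‖ ^ 2) * (2 * maxRatio ρ - ‖x‖ ^ 2 * calQ ρ (‖x‖ ^ 2))) := by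
  have h := norm_sq_coord x
  set s := ‖x‖ ^ 2 with hs
  have e : ∀ i, calibration ρ x i =
      (maxRatio ρ - s * calQ ρ s) * eZ i + calQ ρ s * x 2 * x i := fun i => by
    simp [calibration, polar, ← hs]
  rw [norm_sq_coord, e, e, e]
  simp
  rw [h]
  ring

theorem norm_calibration_le {ρ : ℝ} (hρ : 0 < ρ) {x : E3} (hx : x ∈ Metric.closedBall 0 ρ) :
    ‖calibration ρ x‖ ≤ maxRatio ρ := by
  rw [mem_closedBall_zero_iff] at hx
  have hs : ‖x‖ ^ 2 ≤ ρ ^ 2 := by gcongr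
  have h1 := mul_calQ_le (sq_nonneg ‖x‖) hs
  have h2 := calQ_pos ρ (sq_nonneg ‖x‖)
  have h3 := maxRatio_pos hρ
  refine (sq_le_sq₀ (norm_nonneg _) h3.le).1 ?_
  rw [norm_sq_calibration]
  have : 0 ≤ (x 0 ^ 2 + x 1 ^ 2) *
      (calQ ρ (‖x‖ ^ 2) * (2 * maxRatio ρ - ‖x‖ ^ 2 * calQ ρ (‖x‖ ^ 2))) :=
    mul_nonneg (by positivity) (mul_nonneg h2.le (by linarith))
  linarith

theorem calPotential_eq_zero {ρ : ℝ} {x : E3} (hx : x ∈ Metric.sphere 0 ρ) :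
    calPotential ρ x = 0 := by
  rw [mem_sphere_zero_iff_norm] at hx
  rw [calPotential, potentialProfile, hx, sub_self, mul_zero, mul_zero]

/-- A normal current with boundary on the sphere does not see the gradient of a function that
vanishes there. -/
theorem integral_grad_calPotential {ρ : ℝ} (hρ : 0 < ρ) {T : FiniteMassCurrent}
    (hT : T ∈ normalCurrents ρ) :
    ∫ x, inner ℝ (meissnerB ρ x - calibration ρ x) (T.τ x) ∂T.μ = 0 := by
  obtain ⟨hsupp, ν₁, ν₂, _, _, h₁, h₂, h⟩ := hT
  set N := ρ ^ 2 + 1 with hN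
  have hN0 : 0 < N := by positivity
  set η : E3 → ℝ := fun x => outerCutoff N (‖x‖ ^ 2) * calPotential ρ x with hη
  have hη1 : IsTest univ η := by
    refine ⟨((outerCutoff_contDiff N).comp (contDiff_norm_sq ℝ)).mul (calPotential_contDiff ρ), ?_,
      subset_univ _⟩
    refine hasCompactSupport_of_forall_norm (R := 2 * N + 1) fun x hx => ?_
    rw [hη]
    simp only
    rw [outerCutoff_eq_zero hN0 (by nlinarith), zero_mul]
  have h0 : ∀ x ∈ Metric.sphere (0 : E3) ρ, η x = 0 := fun x hx => by
    simp only [hη]; rw [calPotential_eq_zero hx, mul_zero]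
  have key := h η hη1
  have z : ∀ ν : Measure E3, ν (Metric.sphere 0 ρ)ᶜ = 0 → ∫ x, η x ∂ν = 0 := fun ν hν => by
    refine integral_eq_zero_of_ae ?_
    filter_upwards [measure_eq_zero_iff_ae_notMem.1 hν] with x hx
    exact h0 x (not_not.1 hx)
  rw [z ν₁ h₁, z ν₂ h₂, sub_zero] at key
  rw [← key]
  refine integral_congr_ae ?_
  filter_upwards [measure_eq_zero_iff_ae_notMem.1 hsupp] with x hx
  have hx' : ‖x‖ ≤ ρ := by simpa using hx
  have hlt : ‖x‖ ^ 2 < N := by nlinarith [norm_nonneg x]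
  have e : η =ᶠ[𝓝 x] calPotential ρ := by
    have hc : ContinuousAt (fun y : E3 => ‖y‖ ^ 2) x := by fun_prop
    filter_upwards [hc.eventually (gt_mem_nhds hlt)] with y hy
    simp only [hη]
    rw [outerCutoff_eq_one hN0 hy.le, one_mul]
  rw [e.fderiv_eq, (hasFDerivAt_calPotential ρ x).fderiv]; rfl

theorem integrable_pairing {X : E3 → E3} (hX : Continuous X) {ρ : ℝ} {T : FiniteMassCurrent}
    (hT : T.μ (Metric.closedBall 0 ρ)ᶜ = 0) : Integrable (fun x => inner ℝ (X x) (T.τ x)) T.μ := by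
  have := T.finite
  obtain ⟨C, hC⟩ := (isCompact_closedBall (0 : E3) ρ).exists_bound_of_continuousOn hX.continuousOn
  refine Integrable.of_bound (hX.measurable.inner T.measurable_τ).aestronglyMeasurable C ?_
  filter_upwards [measure_eq_zero_iff_ae_notMem.1 hT, T.unit] with x hx h1
  have := norm_inner_le_norm (𝕜 := ℝ) (X x) (T.τ x)
  rw [h1, mul_one] at this
  exact this.trans (hC x (not_not.1 hx))

theorem pairing_eq_integral_calibration {ρ : ℝ} (hρ : 0 < ρ) {B : E3 → E3}
    (hB : IsMeissnerField ρ B) {T : FiniteMassCurrent} (hT : T ∈ normalCurrents ρ) :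
    T.pairing B = ∫ x, inner ℝ (calibration ρ x) (T.τ x) ∂T.μ := by
  have i1 := integrable_pairing (meissnerB_contDiff ρ).continuous hT.1
  have i2 := integrable_pairing (calibration_contDiff ρ).continuous hT.1
  have h := integral_grad_calPotential hρ hT
  simp only [inner_sub_left] at h
  rw [integral_sub i1 i2, sub_eq_zero] at h
  rw [← h, FiniteMassCurrent.pairing]
  refine integral_congr_ae ?_
  filter_upwards [measure_eq_zero_iff_ae_notMem.1 hT.1] with x hx
  rw [hB.eq_meissnerB hρ x (not_not.1 hx)]

theorem ratio_le_maxRatio {ρ : ℝ} (hρ : 0 < ρ) {B : E3 → E3} (hB : IsMeissnerField ρ B)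
    {T : FiniteMassCurrent} (hT : T ∈ normalCurrents ρ) (hmass : T.mass ≠ 0) :
    ratio B T ≤ maxRatio ρ := by
  have := T.finite
  have h0 : 0 < T.mass := lt_of_le_of_ne measureReal_nonneg hmass.symm
  rw [ratio, div_le_iff₀ h0, pairing_eq_integral_calibration hρ hB hT]
  calc _ ≤ ∫ _, maxRatio ρ ∂T.μ := by
        refine integral_mono_ae (integrable_pairing (calibration_contDiff ρ).continuous hT.1)
          (integrable_const _) ?_
        filter_upwards [measure_eq_zero_iff_ae_notMem.1 hT.1, T.unit] with x hx h1
        have := real_inner_le_norm (calibration ρ x) (T.τ x)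
        rw [h1, mul_one] at this
        exact this.trans (norm_calibration_le hρ (not_not.1 hx))
    _ = _ := by rw [integral_const, smul_eq_mul, mul_comm]; rfl

theorem measurable_smul_eZ : Measurable fun s : ℝ => s • eZ :=
  (continuous_id.smul continuous_const).measurable

theorem norm_smul_eZ (s : ℝ) : ‖s • eZ‖ = |s| := by
  rw [norm_smul, norm_eZ, mul_one, Real.norm_eq_abs]

theorem diameterCurrent_mem {ρ : ℝ} (hρ : 0 < ρ) : diameterCurrent ρ ∈ normalCurrents ρ := by
  refine ⟨?_, Measure.dirac (ρ • eZ), Measure.dirac ((-ρ) • eZ), inferInstance, inferInstance,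
    ?_, ?_, fun η hη => ?_⟩
  · change Measure.map _ _ _ = 0
    rw [Measure.map_apply measurable_smul_eZ Metric.isClosed_closedBall.measurableSet.compl,
      Measure.restrict_apply (measurable_smul_eZ
        Metric.isClosed_closedBall.measurableSet.compl)]
    convert measure_empty (μ := (volume : Measure ℝ))
    ext s
    simp only [mem_inter_iff, mem_preimage, mem_compl_iff, mem_closedBall_zero_iff, norm_smul_eZ,
      mem_Icc, mem_empty_iff_false, iff_false, not_and, abs_le, not_le]
    grind
  · rw [Measure.dirac_apply' _ Metric.isClosed_sphere.measurableSet.compl]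
    simp [norm_smul_eZ, abs_of_pos hρ]
  · rw [Measure.dirac_apply' _ Metric.isClosed_sphere.measurableSet.compl]
    simp [norm_smul, abs_of_pos hρ]
  · have hc : Continuous fun x => fderiv ℝ η x eZ := hη.continuous_fderiv eZ
    change ∫ x, fderiv ℝ η x eZ ∂(Measure.map (fun s : ℝ => s • eZ)
      (volume.restrict (Icc (-ρ) ρ))) = _
    rw [integral_map measurable_smul_eZ.aemeasurable hc.aestronglyMeasurable,
      integral_Icc_eq_integral_Ioc, ← intervalIntegral.integral_of_le (by linarith),
      integral_dirac, integral_dirac]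
    refine intervalIntegral.integral_eq_sub_of_hasDerivAt (f := fun s : ℝ => η (s • eZ))
      (fun s _ => ?_) ?_
    · have h1 : HasDerivAt (fun s : ℝ => s • eZ) eZ s := by
        simpa using (hasDerivAt_id s).smul_const eZ
      exact (hη.differentiable _).hasFDerivAt.comp_hasDerivAt s h1
    · exact (hc.comp (continuous_id.smul continuous_const)).intervalIntegrable _ _

theorem ratio_diameterCurrent {ρ : ℝ} (hρ : 0 < ρ) {B : E3 → E3} (hB : IsMeissnerField ρ B) :
    ratio B (diameterCurrent ρ) = maxRatio ρ := by
  have hm : (diameterCurrent ρ).mass = 2 * ρ := by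
    change (Measure.map _ _).real univ = _
    rw [measureReal_def, Measure.map_apply measurable_smul_eZ MeasurableSet.univ]
    simp
    rw [ENNReal.toReal_ofReal (by linarith)]
    ring
  rw [ratio, pairing_eq_integral_calibration hρ hB (diameterCurrent_mem hρ), hm,
    div_eq_iff (by positivity)]
  have hc : Continuous fun x => inner ℝ (calibration ρ x) eZ :=
    (calibration_contDiff ρ).continuous.inner continuous_const
  change ∫ x, inner ℝ (calibration ρ x) eZ ∂(Measure.map (fun s : ℝ => s • eZ)
    (volume.restrict (Icc (-ρ) ρ))) = _
  rw [integral_map measurable_smul_eZ.aemeasurable hc.aestronglyMeasurable]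
  simp [inner_calibration]
  rw [max_eq_left (by linarith)]
  ring

theorem diameterMaximizes {ρ : ℝ} (hρ : 0 < ρ) {B : E3 → E3} (hB : IsMeissnerField ρ B) :
    DiameterMaximizes ρ B :=
  ⟨diameterCurrent_mem hρ, fun T hT hm => by
    rw [ratio_diameterCurrent hρ hB]
    exact ratio_le_maxRatio hρ hB hT hm⟩

/-! ### Second derivatives: quotients, norms and parametric integrals -/

/-- The second derivative of a quotient `f / g` at a point where `f = R g` to first order. -/
theorem HasSecondDerivAt.div {f g : ℝ → ℝ} {f' g' : ℝ → ℝ} {p q t : ℝ}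
    (hf : ∀ᶠ s in 𝓝 t, HasDerivAt f (f' s) s) (hf' : HasDerivAt f' p t)
    (hg : ∀ᶠ s in 𝓝 t, HasDerivAt g (g' s) s) (hg' : HasDerivAt g' q t) (h0 : g t ≠ 0) {R : ℝ}
    (hR : f t = R * g t) (hR' : f' t = R * g' t) :
    HasSecondDerivAt (fun s => f s / g s) ((p - R * q) / g t) t := by
  have hft := hf.self_of_nhds
  have hgt := hg.self_of_nhds
  refine ⟨fun s => (f' s * g s - f s * g' s) / g s ^ 2, ?_, ?_⟩
  · filter_upwards [hf, hg, hgt.continuousAt.eventually_ne h0] with s h1 h2 h3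
    exact h1.div h2 h3
  · refine (((hf'.mul hgt).sub (hft.mul hg')).div (hgt.pow 2) (pow_ne_zero 2 h0)).congr_deriv ?_
    simp only [Pi.sub_apply, Pi.mul_apply, Pi.pow_apply, hR, hR']
    field_simp
    ring

/-- The second order Taylor expansion of a function which vanishes to first order at `0`. -/
theorem tendsto_div_sq {f f' : ℝ → ℝ} {q : ℝ} (hf : ∀ᶠ s in 𝓝 0, HasDerivAt f (f' s) s)
    (hf' : HasDerivAt f' q 0) (h0 : f 0 = 0) (h1 : f' 0 = 0) :
    Tendsto (fun t => f t / t ^ 2) (𝓝[≠] 0) (𝓝 (q / 2)) := by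
  have hft := hf.self_of_nhds
  refine HasDerivAt.lhopital_zero_nhdsNE (f' := f') (g' := fun t => 2 * t)
    (hf.filter_mono nhdsWithin_le_nhds) (Eventually.of_forall fun t => ?_) ?_ ?_ ?_ ?_
  · simpa using hasDerivAt_pow 2 t
  · filter_upwards [self_mem_nhdsWithin] with t ht
    exact mul_ne_zero two_ne_zero ht
  · have := hft.continuousAt.tendsto.mono_left (nhdsWithin_le_nhds (s := {0}ᶜ))
    rwa [h0] at this
  · have : Tendsto (fun t : ℝ => t ^ 2) (𝓝 0) (𝓝 (0 ^ 2)) := (continuous_pow 2).tendsto 0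
    simpa using this.mono_left (nhdsWithin_le_nhds (s := {0}ᶜ))
  · have := (hasDerivAt_iff_tendsto_slope.1 hf').div_const 2
    refine this.congr' ?_
    filter_upwards [self_mem_nhdsWithin] with t ht
    simp only [slope_def_field, h1, sub_zero]
    field_simp

theorem hasDerivAt_norm {F : Type*} [NormedAddCommGroup F] [InnerProductSpace ℝ F]
    {v : ℝ → F} {v' : F} {t : ℝ} (hv : HasDerivAt v v' t) (h0 : v t ≠ 0) :
    HasDerivAt (fun s => ‖v s‖) (inner ℝ (v t) v' / ‖v t‖) t := by
  have h1 := (hv.norm_sq).sqrt (by positivity)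
  refine (h1.congr_deriv ?_).congr_of_eventuallyEq (Eventually.of_forall fun s => ?_)
  · rw [Real.sqrt_sq (norm_nonneg _), mul_div_mul_left _ _ two_ne_zero]
  · simp [Real.sqrt_sq (norm_nonneg _)]

/-- First and second derivatives of the norm of a curve which stays away from `0`. -/
theorem hasDerivAt_norm_twice {F : Type*} [NormedAddCommGroup F] [InnerProductSpace ℝ F]
    {v v' : ℝ → F} {v'' : F} {t c : ℝ} (hv : HasDerivAt v (v' t) t) (hv' : HasDerivAt v' v'' t)
    (hc : 0 < c) (h0 : c ≤ ‖v t‖) :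
    HasDerivAt (fun s => inner ℝ (v s) (v' s) / ‖v s‖)
      ((inner ℝ (v t) v'' + inner ℝ (v' t) (v' t)) / ‖v t‖ -
        inner ℝ (v t) (v' t) ^ 2 / ‖v t‖ ^ 3) t ∧
    |inner ℝ (v t) (v' t) / ‖v t‖| ≤ ‖v' t‖ ∧
    |(inner ℝ (v t) v'' + inner ℝ (v' t) (v' t)) / ‖v t‖ -
        inner ℝ (v t) (v' t) ^ 2 / ‖v t‖ ^ 3| ≤ ‖v''‖ + 2 * ‖v' t‖ ^ 2 / c := by
  have hn : 0 < ‖v t‖ := hc.trans_le h0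
  have h1 : |inner ℝ (v t) (v' t) / ‖v t‖| ≤ ‖v' t‖ := by
    rw [abs_div, abs_norm, div_le_iff₀ hn, mul_comm]
    exact abs_real_inner_le_norm _ _
  refine ⟨?_, h1, ?_⟩
  · refine ((hv.inner ℝ hv').div (hasDerivAt_norm hv (norm_pos_iff.1 hn)) hn.ne').congr_deriv ?_
    field_simp
  · have e1 : |inner ℝ (v t) v'' / ‖v t‖| ≤ ‖v''‖ := by
      rw [abs_div, abs_norm, div_le_iff₀ hn, mul_comm]
      exact abs_real_inner_le_norm _ _
    have e2 : |inner ℝ (v' t) (v' t) / ‖v t‖| ≤ ‖v' t‖ ^ 2 / c := by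
      rw [real_inner_self_eq_norm_sq, abs_of_nonneg (by positivity)]
      gcongr
    have e3 : |inner ℝ (v t) (v' t) ^ 2 / ‖v t‖ ^ 3| ≤ ‖v' t‖ ^ 2 / c := by
      have : inner ℝ (v t) (v' t) ^ 2 / ‖v t‖ ^ 3 = (inner ℝ (v t) (v' t) / ‖v t‖) ^ 2 / ‖v t‖ := by
        field_simp
      rw [this, abs_of_nonneg (by positivity), ← sq_abs (_ / _)]
      gcongr
    rw [add_div]
    calc _ ≤ ‖v''‖ + ‖v' t‖ ^ 2 / c + ‖v' t‖ ^ 2 / c :=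
          (abs_sub _ _).trans (add_le_add ((abs_add_le _ _).trans (add_le_add e1 e2)) e3)
      _ = _ := by ring

theorem aestronglyMeasurable_of_hasDerivAt {α : Type*} [MeasurableSpace α] {μ : Measure α}
    {g : ℝ → α → ℝ} {g' : α → ℝ} {t : ℝ} (hm : ∀ᶠ s in 𝓝 t, AEStronglyMeasurable (g s) μ)
    (h : ∀ᵐ z ∂μ, HasDerivAt (fun s => g s z) (g' z) t) : AEStronglyMeasurable g' μ := by
  obtain ⟨ε, hε, hball⟩ := Metric.eventually_nhds_iff.1 hm
  have hseq : ∀ n : ℕ, 0 < ε / (n + 2) ∧ ε / (n + 2) < ε := fun n =>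
    ⟨by positivity, div_lt_self hε (by have : (0 : ℝ) ≤ n := n.cast_nonneg; linarith)⟩
  have hlim : Tendsto (fun n : ℕ => t + ε / (n + 2)) atTop (𝓝[≠] t) := by
    refine tendsto_nhdsWithin_iff.2 ⟨?_, Eventually.of_forall fun n => ?_⟩
    · have h1 : Tendsto (fun n : ℕ => (n : ℝ) + 2) atTop atTop :=
        tendsto_atTop_add_const_right _ _ tendsto_natCast_atTop_atTop
      simpa using (h1.const_div_atTop ε).const_add t
    · have := (hseq n).1
      simp only [mem_compl_iff, mem_singleton_iff]
      linarith
  refine aestronglyMeasurable_of_tendsto_ae atTop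
    (f := fun (n : ℕ) z => slope (fun s => g s z) t (t + ε / (n + 2))) (fun n => ?_) ?_
  · simp only [slope_def_field]
    refine AEStronglyMeasurable.div₀ ?_ aestronglyMeasurable_const
    refine (hball ?_).sub (hball (by simpa using hε))
    rw [Real.dist_eq, add_sub_cancel_left, abs_of_pos (hseq n).1]
    exact (hseq n).2
  · filter_upwards [h] with z hz
    exact (hasDerivAt_iff_tendsto_slope.1 hz).comp hlim

/-- Differentiation under the integral sign, twice, for integrands which are twice
differentiable in a parameter with a common integrable bound. -/
theorem hasDerivAt_integral_twice {α : Type*} [MeasurableSpace α] {μ : Measure α}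
    {g g' g'' : ℝ → α → ℝ} {b : α → ℝ} {ε : ℝ} (hε : 0 < ε) (hb : Integrable b μ)
    (hm : ∀ t, |t| < ε → AEStronglyMeasurable (g t) μ)
    (h : ∀ᵐ z ∂μ, ∀ t, |t| < ε → |g t z| ≤ b z ∧ HasDerivAt (fun s => g s z) (g' t z) t ∧
      |g' t z| ≤ b z ∧ HasDerivAt (fun s => g' s z) (g'' t z) t ∧ |g'' t z| ≤ b z) :
    (∀ᶠ t in 𝓝 0, HasDerivAt (fun s => ∫ z, g s z ∂μ) (∫ z, g' t z ∂μ) t) ∧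
      HasDerivAt (fun s => ∫ z, g' s z ∂μ) (∫ z, g'' 0 z ∂μ) 0 ∧
      Integrable (g 0) μ ∧ Integrable (g' 0) μ ∧ Integrable (g'' 0) μ := by
  have hnhds : ∀ t : ℝ, |t| < ε → ∀ᶠ s in 𝓝 t, |s| < ε := fun t ht =>
    (continuous_abs.tendsto t).eventually_lt_const ht
  have hm' : ∀ t, |t| < ε → AEStronglyMeasurable (g' t) μ := fun t ht =>
    aestronglyMeasurable_of_hasDerivAt ((hnhds t ht).mono hm)
      (h.mono fun z hz => (hz t ht).2.1)
  have h0 : |(0 : ℝ)| < ε := by simpa using hε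
  have hm'' : AEStronglyMeasurable (g'' 0) μ :=
    aestronglyMeasurable_of_hasDerivAt ((hnhds 0 h0).mono hm')
      (h.mono fun z hz => (hz 0 h0).2.2.2.1)
  have hi : ∀ t, |t| < ε → Integrable (g t) μ := fun t ht =>
    hb.mono' (hm t ht) (h.mono fun z hz => (hz t ht).1)
  have hi' : Integrable (g' 0) μ := hb.mono' (hm' 0 h0) (h.mono fun z hz => (hz 0 h0).2.2.1)
  refine ⟨(hnhds 0 h0).mono fun t ht => ?_, ?_, hi 0 h0, hi',
    hb.mono' hm'' (h.mono fun z hz => (hz 0 h0).2.2.2.2)⟩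
  · exact (hasDerivAt_integral_of_dominated_loc_of_deriv_le (bound := b) (hnhds t ht)
      ((hnhds t ht).mono hm) (hi t ht) (hm' t ht) (h.mono fun z hz s hs => (hz s hs).2.2.1) hb
      (h.mono fun z hz s hs => (hz s hs).2.1)).2
  · exact (hasDerivAt_integral_of_dominated_loc_of_deriv_le (bound := b) (hnhds 0 h0)
      ((hnhds 0 h0).mono hm') hi' hm'' (h.mono fun z hz s hs => (hz s hs).2.2.2.2) hb
      (h.mono fun z hz s hs => (hz s hs).2.2.2.1)).2

/-! ### Absolutely continuous functions -/

theorem absolutelyContinuousOnInterval_of_dist_le {f g : ℝ → ℝ} {a b K : ℝ}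
    (hg : AbsolutelyContinuousOnInterval g a b)
    (h : ∀ x ∈ uIcc a b, ∀ y ∈ uIcc a b, dist (f x) (f y) ≤ K * dist (g x) (g y)) :
    AbsolutelyContinuousOnInterval f a b := by
  rw [absolutelyContinuousOnInterval_iff] at hg ⊢
  intro ε hε
  obtain ⟨δ, hδ, hd⟩ := hg (ε / (|K| + 1)) (by positivity)
  refine ⟨δ, hδ, fun E hE hlt => ?_⟩
  have h1 := hd E hE hlt
  have h2 : ∑ i ∈ Finset.range E.1, dist (f (E.2 i).1) (f (E.2 i).2) ≤
      (|K| + 1) * ∑ i ∈ Finset.range E.1, dist (g (E.2 i).1) (g (E.2 i).2) := by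
    rw [Finset.mul_sum]
    refine Finset.sum_le_sum fun i hi => ?_
    have h3 := hE.1 i hi
    refine (h _ h3.1 _ h3.2).trans ?_
    gcongr
    linarith [le_abs_self K]
  refine h2.trans_lt ?_
  rwa [lt_div_iff₀ (by positivity), mul_comm] at h1

/-! ### Slices of operator fields on a cylinder -/

theorem mem_cylinder {δ L : ℝ} {w : E2} {z : ℝ} (hw : ‖w‖ < δ) (hz : z ∈ Icc 0 L) :
    (w, z) ∈ cylinder δ L := ⟨by simpa using hw, hz⟩

theorem uniqueDiffOn_cylinder {δ L : ℝ} (hδ : 0 < δ) (hL : 0 < L) :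
    UniqueDiffOn ℝ (cylinder δ L) := by
  refine uniqueDiffOn_convex ((convex_ball _ _).prod (convex_Icc _ _)) ?_
  rw [cylinder, interior_prod_eq, interior_Icc, Metric.isOpen_ball.interior_eq]
  exact ⟨(0, L / 2), by simpa using hδ, by simp; linarith⟩

/-- The compact cylinder of half the radius. -/
def halfCylinder (δ L : ℝ) : Set (E2 × ℝ) := Metric.closedBall 0 (δ / 2) ×ˢ Icc 0 L

theorem isCompact_halfCylinder (δ L : ℝ) : IsCompact (halfCylinder δ L) :=
  (isCompact_closedBall _ _).prod isCompact_Icc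

theorem convex_halfCylinder (δ L : ℝ) : Convex ℝ (halfCylinder δ L) :=
  (convex_closedBall _ _).prod (convex_Icc _ _)

theorem halfCylinder_subset {δ : ℝ} (hδ : 0 < δ) (L : ℝ) : halfCylinder δ L ⊆ cylinder δ L :=
  prod_mono (Metric.closedBall_subset_ball (by linarith)) subset_rfl

theorem mem_halfCylinder {δ L : ℝ} {w : E2} {z : ℝ} (hw : ‖w‖ ≤ δ / 2) (hz : z ∈ Icc 0 L) :
    (w, z) ∈ halfCylinder δ L := ⟨by simpa using hw, hz⟩

section Slice

variable {F : Type*} [NormedAddCommGroup F] [NormedSpace ℝ F]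

theorem ContDiffOn.hasDerivAt_slice {δ L : ℝ} {Ψ : E2 × ℝ → F}
    (hΨ : ContDiffOn ℝ ∞ Ψ (cylinder δ L)) {u : E2} {z t : ℝ} (hz : z ∈ Icc 0 L)
    (ht : ‖t • u‖ < δ) :
    HasDerivAt (fun s : ℝ => Ψ (s • u, z))
      (fderivWithin ℝ Ψ (cylinder δ L) (t • u, z) (u, 0)) t := by
  have h1 : HasDerivAt (fun s : ℝ => (s • u, z)) (u, (0 : ℝ)) t := by
    have := (hasDerivAt_id t).smul_const u
    rw [one_smul] at this
    exact this.prodMk (hasDerivAt_const t z)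
  have h2 : ∀ᶠ s : ℝ in 𝓝 t, (s • u, z) ∈ cylinder δ L := by
    have hc : Continuous fun s : ℝ => ‖s • u‖ := by fun_prop
    filter_upwards [(hc.tendsto t).eventually_lt_const ht] with s hs
    exact mem_cylinder hs hz
  exact ((hΨ.differentiableOn (by simp) _
    (mem_cylinder ht hz)).hasFDerivWithinAt).comp_hasDerivAt t h1 h2

/-- The value at the point `(t u, z)` of an operator field, applied to the vector `(t h, 1)`. For
the differential of a chart, this is the velocity of the image of a curve `z ↦ (t u(z), z)` with
`u' = h`. -/
noncomputable def slice (Λ : E2 × ℝ → E2 × ℝ →L[ℝ] F) (u h : E2) (z t : ℝ) : F :=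
  Λ (t • u, z) (t • h, 1)

/-- The first derivative in `t` of `slice`. -/
noncomputable def sliceD (δ L : ℝ) (Λ : E2 × ℝ → E2 × ℝ →L[ℝ] F) (u h : E2) (z t : ℝ) : F :=
  fderivWithin ℝ Λ (cylinder δ L) (t • u, z) (u, 0) (t • h, 1) + Λ (t • u, z) (h, 0)

/-- The second derivative in `t` of `slice`. -/
noncomputable def sliceDD (δ L : ℝ) (Λ : E2 × ℝ → E2 × ℝ →L[ℝ] F) (u h : E2) (z t : ℝ) : F :=
  fderivWithin ℝ (fderivWithin ℝ Λ (cylinder δ L)) (cylinder δ L) (t • u, z) (u, 0) (u, 0)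
    (t • h, 1) + (2 : ℝ) • fderivWithin ℝ Λ (cylinder δ L) (t • u, z) (u, 0) (h, 0)

theorem hasDerivAt_smul_prod_one (h : E2) (t : ℝ) :
    HasDerivAt (fun s : ℝ => (s • h, (1 : ℝ))) (h, (0 : ℝ)) t := by
  have := (hasDerivAt_id t).smul_const h
  rw [one_smul] at this
  exact this.prodMk (hasDerivAt_const t (1 : ℝ))

theorem hasDerivAt_slice {δ L : ℝ} {Λ : E2 × ℝ → E2 × ℝ →L[ℝ] F}
    (hΛ : ContDiffOn ℝ ∞ Λ (cylinder δ L)) {u : E2} (h : E2) {z t : ℝ} (hz : z ∈ Icc 0 L)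
    (ht : ‖t • u‖ < δ) : HasDerivAt (slice Λ u h z) (sliceD δ L Λ u h z t) t :=
  (ContDiffOn.hasDerivAt_slice hΛ hz ht).clm_apply (hasDerivAt_smul_prod_one h t)

theorem hasDerivAt_sliceD {δ L : ℝ} (hδ : 0 < δ) (hL : 0 < L) {Λ : E2 × ℝ → E2 × ℝ →L[ℝ] F}
    (hΛ : ContDiffOn ℝ ∞ Λ (cylinder δ L)) {u : E2} (h : E2) {z t : ℝ} (hz : z ∈ Icc 0 L)
    (ht : ‖t • u‖ < δ) : HasDerivAt (sliceD δ L Λ u h z) (sliceDD δ L Λ u h z t) t := by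
  have hD : ContDiffOn ℝ ∞ (fderivWithin ℝ Λ (cylinder δ L)) (cylinder δ L) :=
    hΛ.fderivWithin (uniqueDiffOn_cylinder hδ hL) (by simp)
  have h1 := ((ContDiffOn.hasDerivAt_slice hD hz ht).clm_apply (hasDerivAt_const t (u, (0 : ℝ))))
  have h2 := (ContDiffOn.hasDerivAt_slice hΛ hz ht).clm_apply (hasDerivAt_const t (h, (0 : ℝ)))
  refine ((h1.clm_apply (hasDerivAt_smul_prod_one h t)).add h2).congr_deriv ?_
  simp [sliceDD, two_smul, add_assoc]

theorem norm_smul_prod_one_le {t : ℝ} (ht : |t| ≤ 1) (h : E2) :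
    ‖(t • h, (1 : ℝ))‖ ≤ 1 + ‖h‖ := by
  rw [Prod.norm_def, norm_smul, Real.norm_eq_abs, norm_one]
  have := norm_nonneg h
  exact max_le (by nlinarith) (by linarith)

theorem ContDiffOn.exists_bound_halfCylinder {δ L : ℝ} (hδ : 0 < δ) (hL : 0 < L)
    {Ψ : E2 × ℝ → F} (hΨ : ContDiffOn ℝ ∞ Ψ (cylinder δ L)) :
    ∃ K, 0 ≤ K ∧ ∀ p ∈ halfCylinder δ L, ‖Ψ p‖ ≤ K := by
  obtain ⟨K, hK⟩ := (isCompact_halfCylinder δ L).exists_bound_of_continuousOn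
    (hΨ.continuousOn.mono (halfCylinder_subset hδ L))
  exact ⟨K, (norm_nonneg _).trans
    (hK (0, 0) (mem_halfCylinder (by simp; linarith) ⟨le_rfl, hL.le⟩)), hK⟩

theorem ContDiffOn.exists_bound_fderivWithin {δ L : ℝ} (hδ : 0 < δ) (hL : 0 < L)
    {Ψ : E2 × ℝ → F} (hΨ : ContDiffOn ℝ ∞ Ψ (cylinder δ L)) :
    ∃ K, 0 ≤ K ∧ ∀ p ∈ halfCylinder δ L, ‖fderivWithin ℝ Ψ (cylinder δ L) p‖ ≤ K :=
  ContDiffOn.exists_bound_halfCylinder hδ hL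
    (hΨ.fderivWithin (uniqueDiffOn_cylinder hδ hL) (by simp))

/-- Bounds for a slice and its derivatives over the compact cylinder of half the radius. -/
theorem exists_bound_slice {δ L : ℝ} (hδ : 0 < δ) (hL : 0 < L) {Λ : E2 × ℝ → E2 × ℝ →L[ℝ] F}
    (hΛ : ContDiffOn ℝ ∞ Λ (cylinder δ L)) :
    ∃ K, 0 ≤ K ∧ ∀ (u h : E2) (z t : ℝ), z ∈ Icc 0 L → |t| ≤ 1 → ‖t • u‖ ≤ δ / 2 →
      ‖slice Λ u h z t‖ ≤ K * (1 + ‖h‖) ∧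
      ‖sliceD δ L Λ u h z t‖ ≤ K * (1 + ‖u‖) ^ 2 * (1 + ‖h‖) ∧
      ‖sliceDD δ L Λ u h z t‖ ≤ K * (1 + ‖u‖) ^ 2 * (1 + ‖h‖) := by
  have hU := uniqueDiffOn_cylinder hδ hL
  have hD : ContDiffOn ℝ ∞ (fderivWithin ℝ Λ (cylinder δ L)) (cylinder δ L) :=
    hΛ.fderivWithin hU (by simp)
  obtain ⟨K0, p0, hK0⟩ := ContDiffOn.exists_bound_halfCylinder hδ hL hΛ
  obtain ⟨K1, p1, hK1⟩ := ContDiffOn.exists_bound_halfCylinder hδ hL hD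
  obtain ⟨K2, p2, hK2⟩ := ContDiffOn.exists_bound_fderivWithin hδ hL hD
  refine ⟨K0 + 2 * K1 + K2, by positivity, fun u h z t hz ht hu => ?_⟩
  have hm := mem_halfCylinder hu hz
  have nu := norm_nonneg u
  have nh := norm_nonneg h
  have hu' : ‖(u, (0 : ℝ))‖ = ‖u‖ := by simp [Prod.norm_def]
  have hh' : ‖(h, (0 : ℝ))‖ = ‖h‖ := by simp [Prod.norm_def]
  have hv := norm_smul_prod_one_le ht h
  have b0 : ‖slice Λ u h z t‖ ≤ K0 * (1 + ‖h‖) :=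
    (ContinuousLinearMap.le_opNorm _ _).trans (mul_le_mul (hK0 _ hm) hv (norm_nonneg _) p0)
  have b0' : ‖Λ (t • u, z) (h, 0)‖ ≤ K0 * ‖h‖ :=
    (ContinuousLinearMap.le_opNorm _ _).trans
      (mul_le_mul (hK0 _ hm) hh'.le (norm_nonneg _) p0)
  have b1 : ‖fderivWithin ℝ Λ (cylinder δ L) (t • u, z) (u, 0)‖ ≤ K1 * ‖u‖ :=
    (ContinuousLinearMap.le_opNorm _ _).trans
      (mul_le_mul (hK1 _ hm) hu'.le (norm_nonneg _) p1)
  have b1' : ‖fderivWithin ℝ Λ (cylinder δ L) (t • u, z) (u, 0) (t • h, 1)‖ ≤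
      K1 * ‖u‖ * (1 + ‖h‖) :=
    (ContinuousLinearMap.le_opNorm _ _).trans (mul_le_mul b1 hv (norm_nonneg _) (by positivity))
  have b1'' : ‖fderivWithin ℝ Λ (cylinder δ L) (t • u, z) (u, 0) (h, 0)‖ ≤ K1 * ‖u‖ * ‖h‖ :=
    (ContinuousLinearMap.le_opNorm _ _).trans
      (mul_le_mul b1 hh'.le (norm_nonneg _) (by positivity))
  have b2 : ‖fderivWithin ℝ (fderivWithin ℝ Λ (cylinder δ L)) (cylinder δ L) (t • u, z)
      (u, 0)‖ ≤ K2 * ‖u‖ :=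
    (ContinuousLinearMap.le_opNorm _ _).trans
      (mul_le_mul (hK2 _ hm) hu'.le (norm_nonneg _) p2)
  have b2' : ‖fderivWithin ℝ (fderivWithin ℝ Λ (cylinder δ L)) (cylinder δ L) (t • u, z)
      (u, 0) (u, 0)‖ ≤ K2 * ‖u‖ * ‖u‖ :=
    (ContinuousLinearMap.le_opNorm _ _).trans
      (mul_le_mul b2 hu'.le (norm_nonneg _) (by positivity))
  have b2'' : ‖fderivWithin ℝ (fderivWithin ℝ Λ (cylinder δ L)) (cylinder δ L) (t • u, z)
      (u, 0) (u, 0) (t • h, 1)‖ ≤ K2 * ‖u‖ * ‖u‖ * (1 + ‖h‖) :=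
    (ContinuousLinearMap.le_opNorm _ _).trans (mul_le_mul b2' hv (norm_nonneg _) (by positivity))
  have q1 : ‖u‖ ≤ (1 + ‖u‖) ^ 2 := by nlinarith
  have q2 : ‖u‖ * ‖u‖ ≤ (1 + ‖u‖) ^ 2 := by nlinarith
  have q3 : 1 ≤ (1 + ‖u‖) ^ 2 := by nlinarith
  have r1 : K1 * ‖u‖ * (1 + ‖h‖) ≤ K1 * (1 + ‖u‖) ^ 2 * (1 + ‖h‖) := by gcongr
  have r1' : K1 * ‖u‖ * ‖h‖ ≤ K1 * (1 + ‖u‖) ^ 2 * (1 + ‖h‖) := by gcongr; linarith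
  have r2 : K2 * ‖u‖ * ‖u‖ * (1 + ‖h‖) ≤ K2 * (1 + ‖u‖) ^ 2 * (1 + ‖h‖) := by
    rw [mul_assoc K2]; gcongr
  have r0 : K0 * ‖h‖ ≤ K0 * (1 + ‖u‖) ^ 2 * (1 + ‖h‖) := by
    calc K0 * ‖h‖ ≤ K0 * 1 * (1 + ‖h‖) := by rw [mul_one]; gcongr; linarith
      _ ≤ _ := by gcongr
  have z0 : 0 ≤ K0 * (1 + ‖u‖) ^ 2 * (1 + ‖h‖) := by positivity
  have z1 : 0 ≤ K1 * (1 + ‖u‖) ^ 2 * (1 + ‖h‖) := by positivity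
  have z2 : 0 ≤ K2 * (1 + ‖u‖) ^ 2 * (1 + ‖h‖) := by positivity
  refine ⟨b0.trans ?_, ?_, ?_⟩
  · gcongr
    linarith
  · refine (norm_add_le _ _).trans ?_
    linarith
  · refine (norm_add_le _ _).trans ?_
    rw [norm_smul, Real.norm_ofNat]
    linarith

end Slice

/-! ### Functions in `H¹` -/

theorem H1.memLp {L : ℝ} (u : H1 L) : MemLp u.2 2 (volume.restrict (Ioo 0 L)) := Lp.memLp u.2

theorem H1.intervalIntegrable {L : ℝ} (hL : 0 ≤ L) (u : H1 L) :
    IntervalIntegrable u.2 volume 0 L := by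
  rw [intervalIntegrable_iff_integrableOn_Ioo_of_le hL]
  exact u.memLp.integrable (by norm_num)

theorem H1.intervalIntegrable' {L : ℝ} (u : H1 L) {a b : ℝ} (ha : a ∈ Icc 0 L)
    (hb : b ∈ Icc 0 L) : IntervalIntegrable u.2 volume a b := by
  have hL : 0 ≤ L := ha.1.trans ha.2
  refine (u.intervalIntegrable hL).mono_set ?_
  rw [uIcc_of_le hL]
  exact uIcc_subset_Icc ha hb

theorem H1.eval_sub {L : ℝ} (u : H1 L) {a b : ℝ} (ha : a ∈ Icc 0 L) (hb : b ∈ Icc 0 L) :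
    u.eval b - u.eval a = ∫ s in a..b, u.2 s := by
  have h0 : (0 : ℝ) ∈ Icc 0 L := ⟨le_rfl, ha.1.trans ha.2⟩
  rw [H1.eval, H1.eval, add_sub_add_left_eq_sub]
  exact intervalIntegral.integral_interval_sub_left (u.intervalIntegrable' h0 hb)
    (u.intervalIntegrable' h0 ha)

theorem H1.ae_hasDerivAt {L : ℝ} (hL : 0 ≤ L) (u : H1 L) :
    ∀ᵐ z ∂volume.restrict (Ioo 0 L), HasDerivAt u.eval (u.2 z) z := by
  rw [ae_restrict_iff' measurableSet_Ioo]
  filter_upwards [(u.intervalIntegrable hL).ae_hasDerivAt_integral] with z hz hm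
  rw [uIcc_of_le hL] at hz
  exact (hz (Ioo_subset_Icc_self hm) 0 ⟨le_rfl, hL⟩).const_add _

theorem H1.continuousOn_eval {L : ℝ} (hL : 0 ≤ L) (u : H1 L) : ContinuousOn u.eval (Icc 0 L) := by
  have := intervalIntegral.continuousOn_primitive_interval'
    (u.intervalIntegrable hL) left_mem_uIcc
  rw [uIcc_of_le hL] at this
  exact continuousOn_const.add this

theorem H1.eval_add {L : ℝ} (u v : H1 L) {z : ℝ} (hz : z ∈ Icc 0 L) :
    (u + v).eval z = u.eval z + v.eval z := by
  have h0 : (0 : ℝ) ∈ Icc 0 L := ⟨le_rfl, hz.1.trans hz.2⟩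
  have : ∫ s in (0 : ℝ)..z, (u + v).2 s = ∫ s in (0 : ℝ)..z, (u.2 s + v.2 s) := by
    refine intervalIntegral.integral_congr_ae_restrict ?_
    rw [uIoc_of_le hz.1, ← restrict_Ioo_eq_restrict_Ioc]
    exact ae_restrict_of_ae_restrict_of_subset (Ioo_subset_Ioo_right hz.2)
      (Lp.coeFn_add u.2 v.2)
  rw [H1.eval, this, intervalIntegral.integral_add (u.intervalIntegrable' h0 hz)
    (v.intervalIntegrable' h0 hz), H1.eval, H1.eval, Prod.fst_add]
  abel

theorem H1.eval_smul {L : ℝ} (c : ℝ) (u : H1 L) {z : ℝ} (hz : z ∈ Icc 0 L) :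
    (c • u).eval z = c • u.eval z := by
  have : ∫ s in (0 : ℝ)..z, (c • u).2 s = ∫ s in (0 : ℝ)..z, c • u.2 s := by
    refine intervalIntegral.integral_congr_ae_restrict ?_
    rw [uIoc_of_le hz.1, ← restrict_Ioo_eq_restrict_Ioc]
    exact ae_restrict_of_ae_restrict_of_subset (Ioo_subset_Ioo_right hz.2)
      (Lp.coeFn_smul c u.2)
  rw [H1.eval, this, intervalIntegral.integral_smul, H1.eval, Prod.smul_fst, smul_add]

theorem H1.integrable_norm_sq {L : ℝ} (u : H1 L) :
    Integrable (fun z => ‖u.2 z‖ ^ 2) (volume.restrict (Ioo 0 L)) :=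
  u.memLp.integrable_norm_pow (by norm_num)

theorem H1.exists_bound_eval {L : ℝ} (hL : 0 ≤ L) (u : H1 L) :
    ∃ U, 0 ≤ U ∧ ∀ z ∈ Icc 0 L, ‖u.eval z‖ ≤ U := by
  obtain ⟨U, hU⟩ := isCompact_Icc.exists_bound_of_continuousOn (u.continuousOn_eval hL)
  exact ⟨U, (norm_nonneg _).trans (hU 0 ⟨le_rfl, hL⟩), hU⟩

/-! ### Quadratic forms on `H¹` with continuous coefficients -/

/-- The value and the derivative of an element of `H¹`. -/
noncomputable def H1.jet {L : ℝ} (u : H1 L) (z : ℝ) : E2 × E2 := (u.eval z, u.2 z)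

theorem H1.jet_add_ae {L : ℝ} (u v : H1 L) :
    ∀ᵐ z ∂volume.restrict (Ioo 0 L), (u + v).jet z = u.jet z + v.jet z := by
  filter_upwards [Lp.coeFn_add u.2 v.2, ae_restrict_mem measurableSet_Ioo] with z hz hm
  exact Prod.ext (H1.eval_add u v (Ioo_subset_Icc_self hm)) hz

theorem H1.jet_smul_ae {L : ℝ} (c : ℝ) (u : H1 L) :
    ∀ᵐ z ∂volume.restrict (Ioo 0 L), (c • u).jet z = c • u.jet z := by
  filter_upwards [Lp.coeFn_smul c u.2, ae_restrict_mem measurableSet_Ioo] with z hz hm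
  exact Prod.ext (H1.eval_smul c u (Ioo_subset_Icc_self hm)) hz

theorem H1.memLp_eval {L : ℝ} (hL : 0 ≤ L) (u : H1 L) :
    MemLp u.eval 2 (volume.restrict (Ioo 0 L)) := by
  obtain ⟨U, -, hU⟩ := u.exists_bound_eval hL
  refine MemLp.of_bound (((u.continuousOn_eval hL).mono
    Ioo_subset_Icc_self).aestronglyMeasurable measurableSet_Ioo) U ?_
  filter_upwards [ae_restrict_mem measurableSet_Ioo] with z hz
  exact hU z (Ioo_subset_Icc_self hz)

theorem H1.memLp_jet {L : ℝ} (hL : 0 ≤ L) (u : H1 L) :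
    MemLp u.jet 2 (volume.restrict (Ioo 0 L)) := by
  have h1 := u.memLp_eval hL
  have h2 := u.memLp
  refine (h1.norm.add h2.norm).mono (h1.1.prodMk h2.1) (Eventually.of_forall fun z => ?_)
  simp only [H1.jet, Pi.add_apply, Prod.norm_def, Real.norm_eq_abs]
  rw [abs_of_nonneg (by positivity)]
  exact max_le (by linarith [norm_nonneg (u.2 z)]) (by linarith [norm_nonneg (u.eval z)])

theorem exists_bound_bilinear {V : Type*} [NormedAddCommGroup V] [NormedSpace ℝ V] {L : ℝ}
    {β : ℝ → V →L[ℝ] V →L[ℝ] ℝ} (hβ : ContinuousOn β (Icc 0 L)) :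
    ∃ K, ∀ z ∈ Icc 0 L, ∀ v w, ‖β z v w‖ ≤ K * (‖v‖ * ‖w‖) := by
  obtain ⟨K, hK⟩ := isCompact_Icc.exists_bound_of_continuousOn
    (E := V →L[ℝ] V →L[ℝ] ℝ) hβ
  refine ⟨K, fun z hz v w => ((β z).le_opNorm₂ v w).trans ?_⟩
  rw [mul_assoc]
  gcongr
  exact hK z hz

theorem integrable_jet {L : ℝ} (hL : 0 ≤ L) {β : ℝ → (E2 × E2) →L[ℝ] (E2 × E2) →L[ℝ] ℝ}
    (hβ : ContinuousOn β (Icc 0 L)) (u v : H1 L) :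
    Integrable (fun z => β z (u.jet z) (v.jet z)) (volume.restrict (Ioo 0 L)) := by
  obtain ⟨K, hK⟩ := exists_bound_bilinear hβ
  have h1 := u.memLp_jet hL
  have h2 := v.memLp_jet hL
  have hm : AEStronglyMeasurable β (volume.restrict (Ioo 0 L)) :=
    (hβ.mono Ioo_subset_Icc_self).aestronglyMeasurable measurableSet_Ioo
  have hi : Integrable (fun z => K * (‖u.jet z‖ * ‖v.jet z‖)) (volume.restrict (Ioo 0 L)) :=
    (h1.norm.integrable_mul h2.norm).const_mul K
  refine hi.mono' ?_ ?_
  · have hm1 : AEStronglyMeasurable (fun z => β z (u.jet z)) (volume.restrict (Ioo 0 L)) :=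
      (isBoundedBilinearMap_apply.continuous.comp_aestronglyMeasurable (hm.prodMk h1.1))
    exact isBoundedBilinearMap_apply.continuous.comp_aestronglyMeasurable (hm1.prodMk h2.1)
  · filter_upwards [ae_restrict_mem measurableSet_Ioo] with z hz
    exact hK z (Ioo_subset_Icc_self hz) _ _

/-- The bilinear form on `H¹` with density `β`. -/
noncomputable def jetForm {L : ℝ} (hL : 0 ≤ L) (β : ℝ → (E2 × E2) →L[ℝ] (E2 × E2) →L[ℝ] ℝ)
    (hβ : ContinuousOn β (Icc 0 L)) : LinearMap.BilinMap ℝ (H1 L) ℝ :=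
  LinearMap.mk₂ ℝ (fun u v => ∫ z in Ioo 0 L, β z (u.jet z) (v.jet z))
    (fun u u' v => by
      rw [← integral_add (integrable_jet hL hβ u v) (integrable_jet hL hβ u' v)]
      refine integral_congr_ae ?_
      filter_upwards [u.jet_add_ae u'] with z hz
      rw [hz, map_add, add_apply])
    (fun c u v => by
      rw [← integral_smul]
      refine integral_congr_ae ?_
      filter_upwards [u.jet_smul_ae c] with z hz
      rw [hz, map_smul, smul_apply])
    (fun u v v' => by
      rw [← integral_add (integrable_jet hL hβ u v) (integrable_jet hL hβ u v')]
      refine integral_congr_ae ?_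
      filter_upwards [v.jet_add_ae v'] with z hz
      rw [hz, map_add])
    (fun c u v => by
      rw [← integral_smul]
      refine integral_congr_ae ?_
      filter_upwards [v.jet_smul_ae c] with z hz
      rw [hz, map_smul])

/-- By compactness, a continuous family of positive definite bilinear forms is uniformly
positive definite. -/
theorem exists_coercive {L : ℝ} (hL : 0 ≤ L) {V : Type*} [NormedAddCommGroup V] [NormedSpace ℝ V]
    [FiniteDimensional ℝ V] [Nontrivial V] {β : ℝ → V →L[ℝ] V →L[ℝ] ℝ}
    (hβ : ContinuousOn β (Icc 0 L)) (hpos : ∀ z ∈ Icc 0 L, ∀ v, v ≠ 0 → 0 < β z v v) :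
    ∃ c, 0 < c ∧ ∀ z ∈ Icc 0 L, ∀ v, c * ‖v‖ ^ 2 ≤ β z v v := by
  have : ProperSpace V := FiniteDimensional.proper ℝ V
  have hK : IsCompact (Icc 0 L ×ˢ Metric.sphere (0 : V) 1) :=
    isCompact_Icc.prod (isCompact_sphere _ _)
  have hne : (Icc 0 L ×ˢ Metric.sphere (0 : V) 1).Nonempty :=
    Nonempty.prod ⟨0, le_rfl, hL⟩ (NormedSpace.sphere_nonempty.2 zero_le_one)
  have hc : ContinuousOn (fun p : ℝ × V => β p.1 p.2 p.2)
      (Icc 0 L ×ˢ Metric.sphere (0 : V) 1) := by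
    have h1 : ContinuousOn (fun p : ℝ × V => β p.1) (Icc 0 L ×ˢ Metric.sphere (0 : V) 1) :=
      hβ.comp continuousOn_fst fun p hp => hp.1
    exact (h1.clm_apply continuousOn_snd).clm_apply continuousOn_snd
  obtain ⟨p, hp, hmin⟩ := hK.exists_isMinOn hne hc
  have hp1 : p.2 ≠ 0 := by
    have := hp.2
    rw [mem_sphere_zero_iff_norm] at this
    intro h
    simp [h] at this
  refine ⟨β p.1 p.2 p.2, hpos _ hp.1 _ hp1, fun z hz v => ?_⟩
  by_cases hv : v = 0
  · simp [hv]
  have hn : 0 < ‖v‖ := norm_pos_iff.2 hv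
  have hmem : (z, ‖v‖⁻¹ • v) ∈ Icc 0 L ×ˢ Metric.sphere (0 : V) 1 :=
    ⟨hz, by simp [norm_smul, hn.ne']⟩
  have h2 : β p.1 p.2 p.2 ≤ β z (‖v‖⁻¹ • v) (‖v‖⁻¹ • v) := hmin hmem
  simp only [map_smul, smul_apply, smul_eq_mul] at h2
  calc _ ≤ (‖v‖⁻¹ * (‖v‖⁻¹ * β z v v)) * ‖v‖ ^ 2 := by gcongr
    _ = _ := by field_simp

/-- A quadratic form on `H¹` whose density is continuous and positive definite at each point is
positive definite with respect to the `H¹` norm. -/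
theorem exists_quadraticForm {L : ℝ} (hL : 0 ≤ L)
    {β : ℝ → (E2 × E2) →L[ℝ] (E2 × E2) →L[ℝ] ℝ} (hβ : ContinuousOn β (Icc 0 L))
    (hpos : ∀ z ∈ Icc 0 L, ∀ v, v ≠ 0 → 0 < β z v v) :
    ∃ Q : QuadraticForm ℝ (H1 L),
      (∀ u : H1 L, Q u = ∫ z in Ioo 0 L, β z (u.jet z) (u.jet z)) ∧
      ∃ c : ℝ, 0 < c ∧ ∀ u : H1 L, c * H1.normSq u ≤ Q u := by
  obtain ⟨c, hc, hcoer⟩ := exists_coercive hL hβ hpos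
  have hQ : ∀ u : H1 L, (jetForm hL β hβ).toQuadraticMap u =
      ∫ z in Ioo 0 L, β z (u.jet z) (u.jet z) := fun u => rfl
  refine ⟨(jetForm hL β hβ).toQuadraticMap, hQ, c / 2, by positivity, fun u => ?_⟩
  have h1 : Integrable (fun z => ‖u.eval z‖ ^ 2) (volume.restrict (Ioo 0 L)) :=
    (u.memLp_eval hL).integrable_norm_pow (by norm_num)
  have h2 := u.integrable_norm_sq
  rw [hQ, H1.normSq, ← integral_add h1 h2, ← integral_const_mul]
  refine integral_mono_ae ((h1.add h2).const_mul _) (integrable_jet hL hβ u u) ?_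
  filter_upwards [ae_restrict_mem measurableSet_Ioo] with z hz
  refine le_trans ?_ (hcoer z (Ioo_subset_Icc_self hz) _)
  have e1 : ‖u.eval z‖ ^ 2 ≤ ‖u.jet z‖ ^ 2 :=
    pow_le_pow_left₀ (norm_nonneg _) (norm_fst_le (u.jet z)) 2
  have e2 : ‖u.2 z‖ ^ 2 ≤ ‖u.jet z‖ ^ 2 :=
    pow_le_pow_left₀ (norm_nonneg _) (norm_snd_le (u.jet z)) 2
  nlinarith

/-! ### Curves in tube coordinates -/

section Chart

variable {ρ δ : ℝ} {Φ : E2 × ℝ → E3}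

theorem IsTubeChart.contDiffOn_fderivWithin (hρ : 0 < ρ) (h : IsTubeChart ρ δ Φ) :
    ContDiffOn ℝ ∞ (fderivWithin ℝ Φ (cylinder δ (2 * ρ))) (cylinder δ (2 * ρ)) :=
  h.smooth.fderivWithin (uniqueDiffOn_cylinder h.pos (by linarith)) (by simp)

theorem IsTubeChart.hasFDerivWithinAt (h : IsTubeChart ρ δ Φ) {p : E2 × ℝ}
    (hp : p ∈ cylinder δ (2 * ρ)) :
    HasFDerivWithinAt Φ (fderivWithin ℝ Φ (cylinder δ (2 * ρ)) p) (cylinder δ (2 * ρ)) p :=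
  (h.smooth.differentiableOn (by simp) p hp).hasFDerivWithinAt

theorem IsTubeChart.mem_axis (h : IsTubeChart ρ δ Φ) {z : ℝ} (hz : z ∈ Icc 0 (2 * ρ)) :
    ((0 : E2), z) ∈ cylinder δ (2 * ρ) := mem_cylinder (by simpa using h.pos) hz

theorem IsTubeChart.fderivWithin_axis (hρ : 0 < ρ) (h : IsTubeChart ρ δ Φ) {z : ℝ}
    (hz : z ∈ Icc 0 (2 * ρ)) :
    fderivWithin ℝ Φ (cylinder δ (2 * ρ)) (0, z) (0, 1) = eZ := by
  have h1 : HasDerivWithinAt (fun s : ℝ => ((0 : E2), s)) (0, 1) (Icc 0 (2 * ρ)) z :=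
    ((hasDerivAt_const z (0 : E2)).prodMk (hasDerivAt_id z)).hasDerivWithinAt
  have h2 := (h.hasFDerivWithinAt (h.mem_axis hz)).comp_hasDerivWithinAt z h1
    fun s hs => h.mem_axis hs
  have h3 : HasDerivWithinAt (diameterCurve ρ) eZ (Icc 0 (2 * ρ)) z := by
    have := ((hasDerivAt_id z).sub_const ρ).smul_const eZ
    rw [one_smul] at this
    exact this.hasDerivWithinAt
  have h4 := h3.congr (f₁ := Φ ∘ fun s : ℝ => ((0 : E2), s)) (fun s hs => h.axis s hs) (h.axis z hz)
  exact (uniqueDiffOn_Icc (by linarith : (0 : ℝ) < 2 * ρ) z hz).eq_deriv _ h2 h4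

theorem IsTubeChart.fderivWithin_axis_apply_two (hρ : 0 < ρ) (h : IsTubeChart ρ δ Φ) {z : ℝ}
    (hz : z ∈ Icc 0 (2 * ρ)) (w : E2) :
    fderivWithin ℝ Φ (cylinder δ (2 * ρ)) (0, z) (w, 0) 2 = 0 := by
  have := h.orthogonal _ (h.mem_axis hz) w
  rw [h.fderivWithin_axis hρ hz] at this
  simpa [inner_coord] using this

/-- By orthogonality, the velocity of a curve which is a graph over the axis is at least the
length of the vertical coordinate vector. -/
theorem IsTubeChart.exists_le_norm (hρ : 0 < ρ) (h : IsTubeChart ρ δ Φ) :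
    ∃ c, 0 < c ∧ ∀ p ∈ halfCylinder δ (2 * ρ), ∀ k : E2,
      c ≤ ‖fderivWithin ℝ Φ (cylinder δ (2 * ρ)) p (k, 1)‖ := by
  have hsub := halfCylinder_subset h.pos (2 * ρ)
  have hc : ContinuousOn (fun p => ‖fderivWithin ℝ Φ (cylinder δ (2 * ρ)) p (0, 1)‖)
      (halfCylinder δ (2 * ρ)) :=
    (((h.contDiffOn_fderivWithin hρ).continuousOn.mono hsub).clm_apply continuousOn_const).norm
  have hne : (halfCylinder δ (2 * ρ)).Nonempty :=
    ⟨(0, 0), mem_halfCylinder (by simpa using (half_pos h.pos).le) ⟨le_rfl, by linarith⟩⟩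
  obtain ⟨p, hp, hmin⟩ := (isCompact_halfCylinder δ (2 * ρ)).exists_isMinOn hne hc
  refine ⟨_, norm_pos_iff.2 fun h0 => ?_, fun q hq k => (hmin hq).trans ?_⟩
  · have := (h.invertible p (hsub hp)).1 (h0.trans (map_zero _).symm)
    simp [Prod.ext_iff] at this
  · have h1 : fderivWithin ℝ Φ (cylinder δ (2 * ρ)) q (k, 1) =
        fderivWithin ℝ Φ (cylinder δ (2 * ρ)) q (k, 0) +
          fderivWithin ℝ Φ (cylinder δ (2 * ρ)) q (0, 1) := by
      rw [← map_add]; simp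
    have h2 := norm_add_sq_eq_norm_sq_add_norm_sq_of_inner_eq_zero _ _ (h.orthogonal q (hsub hq) k)
    rw [h1]
    change ‖_‖ ≤ _
    nlinarith [norm_nonneg (fderivWithin ℝ Φ (cylinder δ (2 * ρ)) q (k, 0) +
          fderivWithin ℝ Φ (cylinder δ (2 * ρ)) q (0, 1)),
        norm_nonneg (fderivWithin ℝ Φ (cylinder δ (2 * ρ)) q (k, 0)),
        norm_nonneg (fderivWithin ℝ Φ (cylinder δ (2 * ρ)) q (0, 1))]

end Chart

section Integral

variable {F : Type*} [NormedAddCommGroup F] [NormedSpace ℝ F] {δ L : ℝ}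

theorem integrable_slice (hδ : 0 < δ) (hL : 0 < L) {Λ : E2 × ℝ → E2 × ℝ →L[ℝ] F}
    (hΛ : ContDiffOn ℝ ∞ Λ (cylinder δ L)) (u : H1 L) {t : ℝ} (ht : |t| ≤ 1)
    (hu : ∀ z ∈ Icc 0 L, ‖t • u.eval z‖ ≤ δ / 2) :
    Integrable (fun z => slice Λ (u.eval z) (u.2 z) z t) (volume.restrict (Ioo 0 L)) := by
  obtain ⟨K, -, hK⟩ := exists_bound_slice hδ hL hΛ
  have hi : Integrable (fun z => K * (1 + ‖u.2 z‖)) (volume.restrict (Ioo 0 L)) :=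
    ((integrable_const 1).add (u.memLp.integrable (by norm_num)).norm).const_mul K
  refine hi.mono' ?_ ?_
  · have h1 : ContinuousOn (fun z => Λ (t • u.eval z, z)) (Ioo 0 L) := by
      refine hΛ.continuousOn.comp ((((u.continuousOn_eval hL.le).mono
        Ioo_subset_Icc_self).const_smul t).prodMk continuousOn_id) fun z hz => ?_
      exact halfCylinder_subset hδ L (mem_halfCylinder (hu z (Ioo_subset_Icc_self hz))
        (Ioo_subset_Icc_self hz))
    exact isBoundedBilinearMap_apply.continuous.comp_aestronglyMeasurable
      ((h1.aestronglyMeasurable measurableSet_Ioo).prodMk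
        ((u.memLp.1.const_smul t).prodMk aestronglyMeasurable_const))
  · filter_upwards [ae_restrict_mem measurableSet_Ioo] with z hz
    exact (hK _ _ z t (Ioo_subset_Icc_self hz) ht (hu z (Ioo_subset_Icc_self hz))).1

theorem ae_hasDerivAt_graph (hδ : 0 < δ) (hL : 0 < L) {Ψ : E2 × ℝ → F}
    (hΨ : ContDiffOn ℝ ∞ Ψ (cylinder δ L)) (u : H1 L) {t : ℝ}
    (hu : ∀ z ∈ Icc 0 L, ‖t • u.eval z‖ ≤ δ / 2) :
    ∀ᵐ z ∂volume.restrict (Ioo 0 L), HasDerivAt (fun s => Ψ (t • u.eval s, s))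
      (slice (fderivWithin ℝ Ψ (cylinder δ L)) (u.eval z) (u.2 z) z t) z := by
  filter_upwards [u.ae_hasDerivAt hL.le, ae_restrict_mem measurableSet_Ioo] with z hz hm
  have h1 : HasDerivAt (fun s => (t • u.eval s, s)) (t • u.2 z, (1 : ℝ)) z :=
    (hz.const_smul t).prodMk (hasDerivAt_id z)
  have h2 : ∀ s ∈ Icc 0 L, (t • u.eval s, s) ∈ cylinder δ L := fun s hs =>
    halfCylinder_subset hδ L (mem_halfCylinder (hu s hs) hs)
  refine (hΨ.differentiableOn (by simp) _
    (h2 z (Ioo_subset_Icc_self hm))).hasFDerivWithinAt.comp_hasDerivAt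
    (f := fun s => (t • u.eval s, s)) z h1 ?_
  filter_upwards [Icc_mem_nhds hm.1 hm.2] with s hs using h2 s hs

theorem H1.norm_eval_sub_le (u : H1 L) {a b : ℝ} (ha : a ∈ Icc 0 L) (hb : b ∈ Icc 0 L)
    (hab : a ≤ b) {t : ℝ} (ht : |t| ≤ 1) :
    ‖(t • u.eval b, b) - (t • u.eval a, a)‖ ≤ ∫ s in a..b, (1 + ‖u.2 s‖) := by
  have h1 := (u.intervalIntegrable' ha hb).norm
  have h2 : ∫ s in a..b, (1 + ‖u.2 s‖) = (b - a) + ∫ s in a..b, ‖u.2 s‖ := by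
    rw [intervalIntegral.integral_add intervalIntegrable_const h1]
    simp
  have h3 : ‖u.eval b - u.eval a‖ ≤ ∫ s in a..b, ‖u.2 s‖ := by
    rw [u.eval_sub ha hb]
    exact intervalIntegral.norm_integral_le_integral_norm hab
  have h4 := norm_nonneg (u.eval b - u.eval a)
  rw [h2, Prod.mk_sub_mk, Prod.norm_def, ← smul_sub, norm_smul, Real.norm_eq_abs,
    Real.norm_eq_abs, abs_of_nonneg (sub_nonneg.2 hab)]
  exact max_le (by nlinarith) (by linarith)

/-- The fundamental theorem of calculus along the graph of an `H¹` function. -/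
theorem integral_slice_eq_sub (hδ : 0 < δ) (hL : 0 < L) {Ψ : E2 × ℝ → ℝ}
    (hΨ : ContDiffOn ℝ ∞ Ψ (cylinder δ L)) (u : H1 L) {t : ℝ} (ht : |t| ≤ 1)
    (hu : ∀ z ∈ Icc 0 L, ‖t • u.eval z‖ ≤ δ / 2) :
    ∫ z in Ioo 0 L, slice (fderivWithin ℝ Ψ (cylinder δ L)) (u.eval z) (u.2 z) z t =
      Ψ (t • u.eval L, L) - Ψ (t • u.eval 0, 0) := by
  obtain ⟨K, hK0, hK⟩ := ContDiffOn.exists_bound_fderivWithin hδ hL hΨ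
  have hint : IntervalIntegrable (fun s => 1 + ‖u.2 s‖) volume 0 L :=
    intervalIntegrable_const.add (u.intervalIntegrable hL.le).norm
  have h0 : (0 : ℝ) ∈ Icc 0 L := ⟨le_rfl, hL.le⟩
  have hI : ∀ {a}, a ∈ Icc 0 L → IntervalIntegrable (fun s => 1 + ‖u.2 s‖) volume 0 a :=
    fun ha => intervalIntegrable_const.add (u.intervalIntegrable' h0 ha).norm
  have key : ∀ a ∈ Icc 0 L, ∀ b ∈ Icc 0 L, a ≤ b →
      dist (Ψ (t • u.eval a, a)) (Ψ (t • u.eval b, b)) ≤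
      K * dist (∫ s in (0 : ℝ)..a, (1 + ‖u.2 s‖)) (∫ s in (0 : ℝ)..b, (1 + ‖u.2 s‖)) := by
    intro a ha b hb hab
    have h1 := Convex.norm_image_sub_le_of_norm_hasFDerivWithin_le (C := K)
      (fun p hp => ((hΨ.differentiableOn (by simp) p
        (halfCylinder_subset hδ L hp)).hasFDerivWithinAt.mono (halfCylinder_subset hδ L)))
      hK (convex_halfCylinder δ L) (mem_halfCylinder (hu a ha) ha) (mem_halfCylinder (hu b hb) hb)
    rw [dist_comm, dist_eq_norm]
    refine h1.trans (mul_le_mul_of_nonneg_left ?_ hK0)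
    refine (u.norm_eval_sub_le ha hb hab ht).trans ?_
    rw [dist_comm, dist_eq_norm, intervalIntegral.integral_interval_sub_left (hI hb) (hI ha)]
    exact le_abs_self _
  have hac : AbsolutelyContinuousOnInterval (fun z => Ψ (t • u.eval z, z)) 0 L := by
    refine absolutelyContinuousOnInterval_of_dist_le
      (hint.absolutelyContinuousOnInterval_intervalIntegral left_mem_uIcc) (K := K) ?_
    rw [uIcc_of_le hL.le]
    intro a ha b hb
    rcases le_total a b with hab | hab
    · exact key a ha b hb hab
    · rw [dist_comm, dist_comm (∫ s in (0 : ℝ)..a, _)]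
      exact key b hb a ha hab
  rw [← hac.integral_deriv_eq_sub, intervalIntegral.integral_of_le hL.le,
    integral_Ioc_eq_integral_Ioo]
  refine integral_congr_ae ?_
  filter_upwards [ae_hasDerivAt_graph hδ hL hΨ u hu] with z hz using hz.deriv.symm

end Integral

/-! ### The second variation -/

theorem HasSecondDerivAt.congr {f g : ℝ → ℝ} {q t : ℝ} (h : HasSecondDerivAt f q t)
    (hfg : g =ᶠ[𝓝 t] f) : HasSecondDerivAt g q t := by
  obtain ⟨f', h1, h2⟩ := h
  refine ⟨f', ?_, h2⟩
  filter_upwards [h1, hfg.eventuallyEq_nhds] with s h3 h4 using h3.congr_of_eventuallyEq h4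

theorem tendsto_div_of_hasDerivAt {f : ℝ → ℝ} {a : ℝ} (hf : HasDerivAt f a 0) (h0 : f 0 = 0) :
    Tendsto (fun t => f t / t) (𝓝[≠] 0) (𝓝 a) := by
  refine (hasDerivAt_iff_tendsto_slope.1 hf).congr fun t => ?_
  rw [slope_def_field, h0, sub_zero, sub_zero]

theorem HasDerivAt.coord {x : ℝ → E3} {x' : E3} {t : ℝ} (h : HasDerivAt x x' t) (i : Fin 3) :
    HasDerivAt (fun s => x s i) (x' i) t :=
  (EuclideanSpace.proj (𝕜 := ℝ) i).hasFDerivAt.comp_hasDerivAt t h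

/-- The density of the second variation: `y` is the horizontal displacement of the curve at the
point of height `ζ` of the diameter, and `y'` the derivative of the displacement. -/
noncomputable def variationDensity (ρ ζ : ℝ) (y y' : E3) : ℝ :=
  maxRatio ρ * (y' 0 ^ 2 + y' 1 ^ 2) - 2 * calQ ρ (ζ ^ 2) *
    (ζ * (y 0 * y' 0 + y 1 * y' 1) - (y 0 ^ 2 + y 1 ^ 2))

/-- The second order expansion of the defect in the calibration inequality at the diameter. It
only involves the first order variations of the position `x` and of the velocity `v`. -/
theorem tendsto_defect_div_sq {ρ ζ : ℝ} {x v : ℝ → E3} {x' v' : E3} (hx : HasDerivAt x x' 0)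
    (hv : HasDerivAt v v' 0) (hx0 : x 0 = ζ • eZ) (hv0 : v 0 = eZ) :
    Tendsto (fun t => (maxRatio ρ * ‖v t‖ - inner ℝ (calibration ρ (x t)) (v t)) / t ^ 2)
      (𝓝[≠] 0) (𝓝 (variationDensity ρ ζ x' v' / 2)) := by
  have hle : 𝓝[≠] (0 : ℝ) ≤ 𝓝 0 := nhdsWithin_le_nhds
  have x0 := tendsto_div_of_hasDerivAt (HasDerivAt.coord hx 0) (by simp [hx0])
  have x1 := tendsto_div_of_hasDerivAt (HasDerivAt.coord hx 1) (by simp [hx0])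
  have v0 := tendsto_div_of_hasDerivAt (HasDerivAt.coord hv 0) (by simp [hv0])
  have v1 := tendsto_div_of_hasDerivAt (HasDerivAt.coord hv 1) (by simp [hv0])
  have x2 : Tendsto (fun t => x t 2) (𝓝 0) (𝓝 ζ) := by
    have := (HasDerivAt.coord hx 2).continuousAt.tendsto
    simpa [hx0] using this
  have v2 : Tendsto (fun t => v t 2) (𝓝 0) (𝓝 1) := by
    have := (HasDerivAt.coord hv 2).continuousAt.tendsto
    simpa [hv0] using this
  have nv : Tendsto (fun t => ‖v t‖) (𝓝 0) (𝓝 1) := by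
    have := hv.continuousAt.norm.tendsto
    simpa [hv0, norm_eZ] using this
  have q : Tendsto (fun t => calQ ρ (‖x t‖ ^ 2)) (𝓝 0) (𝓝 (calQ ρ (ζ ^ 2))) := by
    have h1 : Tendsto (fun t => ‖x t‖ ^ 2) (𝓝 0) (𝓝 (ζ ^ 2)) := by
      have := hx.continuousAt.norm.tendsto.pow 2
      simpa [hx0, norm_smul, norm_eZ] using this
    exact ((calQ_contDiff ρ).continuous.tendsto _).comp h1
  have hlim := ((((v0.pow 2).add (v1.pow 2)).const_mul (maxRatio ρ)).div
    ((nv.add v2).mono_left hle) (by norm_num)).sub ((q.mono_left hle).mul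
      (((x2.mono_left hle).mul ((x0.mul v0).add (x1.mul v1))).sub
        (((x0.pow 2).add (x1.pow 2)).mul (v2.mono_left hle))))
  have hval : maxRatio ρ * (v' 0 ^ 2 + v' 1 ^ 2) / (1 + 1) - calQ ρ (ζ ^ 2) *
      (ζ * (x' 0 * v' 0 + x' 1 * v' 1) - (x' 0 ^ 2 + x' 1 ^ 2) * 1) =
      variationDensity ρ ζ x' v' / 2 := by
    rw [variationDensity]; ring
  rw [hval] at hlim
  refine hlim.congr' ?_
  filter_upwards [self_mem_nhdsWithin,
    hle ((nv.add v2).eventually_ne (by norm_num : (1 : ℝ) + 1 ≠ 0))] with t ht hne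
  have ht0 : t ≠ 0 := ht
  have e1 : (v t 0 ^ 2 + v t 1 ^ 2) = (‖v t‖ - v t 2) * (‖v t‖ + v t 2) := by
    have := norm_sq_coord (v t)
    linear_combination -this
  rw [inner_calibration]
  simp only [Pi.div_apply]
  field_simp
  rw [e1]
  ring

/-- The density of the second variation is a sum of two copies of
`(R - ζ² q) b² + q ((ζ b - a)² + a²)`, one for each horizontal direction. -/
theorem variationDensity_pos {ρ ζ : ℝ} (hρ : 0 < ρ) (hζ : ζ ^ 2 ≤ ρ ^ 2) {y y' : E3}
    (h : ¬ (y 0 = 0 ∧ y 1 = 0 ∧ y' 0 = 0 ∧ y' 1 = 0)) : 0 < variationDensity ρ ζ y y' := by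
  have hq := calQ_pos ρ (sq_nonneg ζ)
  have hR := maxRatio_pos hρ
  have hle := mul_calQ_le (sq_nonneg ζ) hζ
  have key : ∀ a b : ℝ, ¬ (a = 0 ∧ b = 0) →
      0 < maxRatio ρ * b ^ 2 - 2 * calQ ρ (ζ ^ 2) * (ζ * (a * b) - a ^ 2) := by
    intro a b hab
    have e : maxRatio ρ * b ^ 2 - 2 * calQ ρ (ζ ^ 2) * (ζ * (a * b) - a ^ 2) =
        (maxRatio ρ - ζ ^ 2 * calQ ρ (ζ ^ 2)) * b ^ 2 +
          calQ ρ (ζ ^ 2) * ((ζ * b - a) ^ 2 + a ^ 2) := by ring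
    rw [e]
    have h1 : 0 ≤ (maxRatio ρ - ζ ^ 2 * calQ ρ (ζ ^ 2)) * b ^ 2 :=
      mul_nonneg (by linarith) (sq_nonneg b)
    by_cases ha : a = 0
    · have hb : b ≠ 0 := fun hb => hab ⟨ha, hb⟩
      subst ha
      have : 0 < b ^ 2 := by positivity
      by_cases hz : ζ = 0
      · simp only [hz]; simp; positivity
      · have : 0 < calQ ρ (ζ ^ 2) * ((ζ * b - 0) ^ 2 + 0 ^ 2) := by
          rw [sub_zero]; positivity
        linarith
    · have : 0 < calQ ρ (ζ ^ 2) * ((ζ * b - a) ^ 2 + a ^ 2) := by positivity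
      linarith
  have key0 : ∀ a b : ℝ,
      0 ≤ maxRatio ρ * b ^ 2 - 2 * calQ ρ (ζ ^ 2) * (ζ * (a * b) - a ^ 2) := by
    intro a b
    by_cases hab : a = 0 ∧ b = 0
    · simp [hab.1, hab.2]
    · exact (key a b hab).le
  have e : variationDensity ρ ζ y y' =
      (maxRatio ρ * y' 0 ^ 2 - 2 * calQ ρ (ζ ^ 2) * (ζ * (y 0 * y' 0) - y 0 ^ 2)) +
      (maxRatio ρ * y' 1 ^ 2 - 2 * calQ ρ (ζ ^ 2) * (ζ * (y 1 * y' 1) - y 1 ^ 2)) := by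
    rw [variationDensity]; ring
  rw [e]
  by_cases h0 : y 0 = 0 ∧ y' 0 = 0
  · exact add_pos_of_nonneg_of_pos (key0 _ _) (key _ _ fun h1 => h ⟨h0.1, h1.1, h0.2, h1.2⟩)
  · exact add_pos_of_pos_of_nonneg (key _ _ h0) (key0 _ _)

section Chart

variable {ρ δ : ℝ} {Φ : E2 × ℝ → E3}

/-- The first order displacement of the point of the diameter with parameter `z`, as a function of
the values of a variation and of its derivative. -/
noncomputable def displacement (ρ δ : ℝ) (Φ : E2 × ℝ → E3) (z : ℝ) : E2 × E2 →L[ℝ] E3 :=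
  (fderivWithin ℝ Φ (cylinder δ (2 * ρ)) (0, z)).comp
    ((ContinuousLinearMap.inl ℝ E2 ℝ).comp (ContinuousLinearMap.fst ℝ E2 E2))

/-- The first order change of the velocity at the point of the diameter with parameter `z`, as a
function of the values of a variation and of its derivative. -/
noncomputable def displacementD (ρ δ : ℝ) (Φ : E2 × ℝ → E3) (z : ℝ) : E2 × E2 →L[ℝ] E3 :=
  ((ContinuousLinearMap.apply ℝ E3 ((0 : E2), (1 : ℝ))).comp
    (fderivWithin ℝ (fderivWithin ℝ Φ (cylinder δ (2 * ρ))) (cylinder δ (2 * ρ)) (0, z))).comp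
      ((ContinuousLinearMap.inl ℝ E2 ℝ).comp (ContinuousLinearMap.fst ℝ E2 E2)) +
  (fderivWithin ℝ Φ (cylinder δ (2 * ρ)) (0, z)).comp
    ((ContinuousLinearMap.inl ℝ E2 ℝ).comp (ContinuousLinearMap.snd ℝ E2 E2))

theorem displacement_apply (z : ℝ) (u h : E2) : displacement ρ δ Φ z (u, h) =
    fderivWithin ℝ Φ (cylinder δ (2 * ρ)) (0, z) (u, 0) := rfl

theorem displacementD_apply (z : ℝ) (u h : E2) : displacementD ρ δ Φ z (u, h) =
    sliceD δ (2 * ρ) (fderivWithin ℝ Φ (cylinder δ (2 * ρ))) u h z 0 := by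
  simp [displacementD, sliceD]

theorem IsTubeChart.continuousOn_axis {G : Type*} [TopologicalSpace G] (h : IsTubeChart ρ δ Φ)
    {f : E2 × ℝ → G} (hf : ContinuousOn f (cylinder δ (2 * ρ))) :
    ContinuousOn (fun z => f ((0 : E2), z)) (Icc 0 (2 * ρ)) :=
  hf.comp (by fun_prop) fun z hz => h.mem_axis hz

theorem IsTubeChart.continuousOn_displacement (hρ : 0 < ρ) (h : IsTubeChart ρ δ Φ) :
    ContinuousOn (displacement ρ δ Φ) (Icc 0 (2 * ρ)) :=
  (h.continuousOn_axis (h.contDiffOn_fderivWithin hρ).continuousOn).clm_comp continuousOn_const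

theorem IsTubeChart.continuousOn_displacementD (hρ : 0 < ρ) (h : IsTubeChart ρ δ Φ) :
    ContinuousOn (displacementD ρ δ Φ) (Icc 0 (2 * ρ)) := by
  have h1 := h.contDiffOn_fderivWithin hρ
  have h2 := h1.continuousOn_fderivWithin
    (uniqueDiffOn_cylinder h.pos (by linarith : (0 : ℝ) < 2 * ρ)) (by simp)
  exact ((continuousOn_const.clm_comp (h.continuousOn_axis h2)).clm_comp continuousOn_const).add
    ((h.continuousOn_axis h1.continuousOn).clm_comp continuousOn_const)

theorem continuousOn_smulRight {V : Type*} [NormedAddCommGroup V] [NormedSpace ℝ V] {s : Set ℝ}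
    {f g : ℝ → V →L[ℝ] ℝ} (hf : ContinuousOn f s) (hg : ContinuousOn g s) :
    ContinuousOn (fun z => (f z).smulRight (g z)) s :=
  ((ContinuousLinearMap.smulRightL ℝ V (V →L[ℝ] ℝ)).continuous.comp_continuousOn hf).clm_apply hg

/-- The bilinear form whose quadratic form is `variationDensity`, for a displacement and a
displacement derivative which depend linearly on a vector of `V`. -/
noncomputable def densityForm {V : Type*} [NormedAddCommGroup V] [NormedSpace ℝ V] (ρ ζ : ℝ)
    (a b : V →L[ℝ] E3) : V →L[ℝ] V →L[ℝ] ℝ :=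
  ∑ i : Fin 2, (maxRatio ρ • ((EuclideanSpace.proj (𝕜 := ℝ) i.castSucc).comp b).smulRight
      ((EuclideanSpace.proj (𝕜 := ℝ) i.castSucc).comp b) -
    (2 * calQ ρ (ζ ^ 2)) • (ζ • ((EuclideanSpace.proj (𝕜 := ℝ) i.castSucc).comp a).smulRight
        ((EuclideanSpace.proj (𝕜 := ℝ) i.castSucc).comp b) -
      ((EuclideanSpace.proj (𝕜 := ℝ) i.castSucc).comp a).smulRight
        ((EuclideanSpace.proj (𝕜 := ℝ) i.castSucc).comp a)))

theorem densityForm_apply_self {V : Type*} [NormedAddCommGroup V] [NormedSpace ℝ V] (ρ ζ : ℝ)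
    (a b : V →L[ℝ] E3) (w : V) :
    densityForm ρ ζ a b w w = variationDensity ρ ζ (a w) (b w) := by
  simp [densityForm, variationDensity, Fin.sum_univ_two]
  ring

theorem continuousOn_sum_combination {G : Type*} [NormedAddCommGroup G] [NormedSpace ℝ G]
    {s : Set ℝ} {R : ℝ} {q l : ℝ → ℝ} (hq : ContinuousOn q s) (hl : ContinuousOn l s)
    {f g k : Fin 2 → ℝ → G} (hf : ∀ i, ContinuousOn (f i) s) (hg : ∀ i, ContinuousOn (g i) s)
    (hk : ∀ i, ContinuousOn (k i) s) :
    ContinuousOn (fun z => ∑ i : Fin 2, (R • f i z - q z • (l z • g i z - k i z))) s :=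
  continuousOn_finsetSum _ fun i _ =>
    ((hf i).const_smul R).sub (hq.smul ((hl.smul (hg i)).sub (hk i)))

theorem continuousOn_densityForm {V : Type*} [NormedAddCommGroup V] [NormedSpace ℝ V] {s : Set ℝ}
    {a b : ℝ → V →L[ℝ] E3} (ha : ContinuousOn a s) (hb : ContinuousOn b s) :
    ContinuousOn (fun z => densityForm ρ (z - ρ) (a z) (b z)) s := by
  have hq : Continuous fun z => 2 * calQ ρ ((z - ρ) ^ 2) :=
    continuous_const.mul ((calQ_contDiff ρ).continuous.comp (by fun_prop))
  have h1 : ∀ i : Fin 2, ContinuousOn (fun z =>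
      (EuclideanSpace.proj (𝕜 := ℝ) i.castSucc).comp (a z)) s :=
    fun i => continuousOn_const.clm_comp ha
  have h2 : ∀ i : Fin 2, ContinuousOn (fun z =>
      (EuclideanSpace.proj (𝕜 := ℝ) i.castSucc).comp (b z)) s :=
    fun i => continuousOn_const.clm_comp hb
  exact continuousOn_sum_combination (G := V →L[ℝ] V →L[ℝ] ℝ) hq.continuousOn
    (continuous_id.sub continuous_const).continuousOn
    (fun i => continuousOn_smulRight (h2 i) (h2 i)) (fun i => continuousOn_smulRight (h1 i) (h2 i))
    fun i => continuousOn_smulRight (h1 i) (h1 i)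

/-- The density of the second variation at the point of the diameter with parameter `z`, as a
bilinear form in the value and the derivative of a variation. -/
noncomputable def variationForm (ρ δ : ℝ) (Φ : E2 × ℝ → E3) (z : ℝ) :
    (E2 × E2) →L[ℝ] (E2 × E2) →L[ℝ] ℝ :=
  densityForm ρ (z - ρ) (displacement ρ δ Φ z) (displacementD ρ δ Φ z)

theorem variationForm_apply_self (z : ℝ) (w : E2 × E2) : variationForm ρ δ Φ z w w =
    variationDensity ρ (z - ρ) (displacement ρ δ Φ z w) (displacementD ρ δ Φ z w) :=
  densityForm_apply_self _ _ _ _ _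

theorem IsTubeChart.continuousOn_variationForm (hρ : 0 < ρ) (h : IsTubeChart ρ δ Φ) :
    ContinuousOn (variationForm ρ δ Φ) (Icc 0 (2 * ρ)) :=
  continuousOn_densityForm (h.continuousOn_displacement hρ) (h.continuousOn_displacementD hρ)

theorem IsTubeChart.variationForm_pos (hρ : 0 < ρ) (h : IsTubeChart ρ δ Φ) {z : ℝ}
    (hz : z ∈ Icc 0 (2 * ρ)) {w : E2 × E2} (hw : w ≠ 0) : 0 < variationForm ρ δ Φ z w w := by
  rw [variationForm_apply_self]
  refine variationDensity_pos hρ (sq_le_sq' (by linarith [hz.1]) (by linarith [hz.2])) ?_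
  rintro ⟨h0, h1, h2, h3⟩
  have hinj := (h.invertible _ (h.mem_axis hz)).1
  obtain ⟨u, k⟩ := w
  have hu : u = 0 := by
    have : fderivWithin ℝ Φ (cylinder δ (2 * ρ)) (0, z) (u, 0) = 0 :=
      ext_coord h0 h1 (h.fderivWithin_axis_apply_two hρ hz u)
    simpa using hinj (this.trans (map_zero _).symm)
  subst hu
  have hk : k = 0 := by
    have e : displacementD ρ δ Φ z (0, k) =
        fderivWithin ℝ Φ (cylinder δ (2 * ρ)) (0, z) (k, 0) := by
      simp [displacementD, Prod.mk_zero_zero]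
    rw [e] at h2 h3
    have : fderivWithin ℝ Φ (cylinder δ (2 * ρ)) (0, z) (k, 0) = 0 :=
      ext_coord h2 h3 (h.fderivWithin_axis_apply_two hρ hz k)
    simpa using hinj (this.trans (map_zero _).symm)
  exact hw (by rw [hk]; rfl)

end Chart

/-! ### The ratio along graphs in tube coordinates -/

section Chart

variable {ρ δ : ℝ} {Φ : E2 × ℝ → E3}

/-- The pull-back by a chart of a vector field, as a one-form. -/
noncomputable def pullback (ρ δ : ℝ) (Φ : E2 × ℝ → E3) (X : E3 → E3) (p : E2 × ℝ) :
    E2 × ℝ →L[ℝ] ℝ :=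
  (innerSL ℝ (X (Φ p))).comp (fderivWithin ℝ Φ (cylinder δ (2 * ρ)) p)

theorem slice_pullback (X : E3 → E3) (u h : E2) (z t : ℝ) :
    slice (pullback ρ δ Φ X) u h z t =
      inner ℝ (X (Φ (t • u, z))) (slice (fderivWithin ℝ Φ (cylinder δ (2 * ρ))) u h z t) := rfl

theorem IsTubeChart.contDiffOn_pullback (hρ : 0 < ρ) (h : IsTubeChart ρ δ Φ) {X : E3 → E3}
    (hX : ContDiff ℝ ∞ X) : ContDiffOn ℝ ∞ (pullback ρ δ Φ X) (cylinder δ (2 * ρ)) :=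
  ((innerSL ℝ).contDiff.comp_contDiffOn (hX.comp_contDiffOn h.smooth)).clm_comp
    (h.contDiffOn_fderivWithin hρ)

/-- The calibration potential contributes nothing to the circulation along a curve with end points
on the sphere. -/
theorem IsTubeChart.integral_pullback_eq (hρ : 0 < ρ) (h : IsTubeChart ρ δ Φ) (u : H1 (2 * ρ))
    {t : ℝ} (ht : |t| ≤ 1) (hu : ∀ z ∈ Icc 0 (2 * ρ), ‖t • u.eval z‖ ≤ δ / 2) :
    ∫ z in Ioo 0 (2 * ρ), slice (pullback ρ δ Φ (meissnerB ρ)) (u.eval z) (u.2 z) z t =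
      ∫ z in Ioo 0 (2 * ρ), slice (pullback ρ δ Φ (calibration ρ)) (u.eval z) (u.2 z) z t := by
  have hL : 0 < 2 * ρ := by linarith
  have hδ := h.pos
  have hΨ : ContDiffOn ℝ ∞ (fun p => calPotential ρ (Φ p)) (cylinder δ (2 * ρ)) :=
    (calPotential_contDiff ρ).comp_contDiffOn h.smooth
  have h1 := integral_slice_eq_sub hδ hL hΨ u ht hu
  have hmem : ∀ z ∈ Icc 0 (2 * ρ), (t • u.eval z, z) ∈ cylinder δ (2 * ρ) := fun z hz =>
    halfCylinder_subset hδ _ (mem_halfCylinder (hu z hz) hz)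
  have l0 : (0 : ℝ) ∈ Icc 0 (2 * ρ) := ⟨le_rfl, hL.le⟩
  have l1 : 2 * ρ ∈ Icc 0 (2 * ρ) := ⟨hL.le, le_rfl⟩
  rw [calPotential_eq_zero (h.top _ (hmem _ l1).1), calPotential_eq_zero (h.bottom _ (hmem _ l0).1),
    sub_zero] at h1
  rw [← sub_eq_zero, ← integral_sub
    (integrable_slice hδ hL (h.contDiffOn_pullback hρ (meissnerB_contDiff ρ)) u ht hu)
    (integrable_slice hδ hL (h.contDiffOn_pullback hρ (calibration_contDiff ρ)) u ht hu)]
  refine Eq.trans ?_ h1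
  refine setIntegral_congr_fun measurableSet_Ioo fun z hz => ?_
  have hm := hmem z (Ioo_subset_Icc_self hz)
  have hd := ((hasFDerivAt_calPotential ρ (Φ (t • u.eval z, z))).comp_hasFDerivWithinAt _
    (h.hasFDerivWithinAt hm)).fderivWithin (uniqueDiffOn_cylinder hδ hL _ hm)
  change _ = fderivWithin ℝ (calPotential ρ ∘ Φ) _ _ _
  rw [hd]
  simp only [slice_pullback, ← inner_sub_left]
  rfl

theorem IsTubeChart.curveRatio_eq (hρ : 0 < ρ) (h : IsTubeChart ρ δ Φ) {B : E3 → E3}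
    (hB : IsMeissnerField ρ B) (u : H1 (2 * ρ)) {t : ℝ} (ht : |t| ≤ 1)
    (hu : ∀ z ∈ Icc 0 (2 * ρ), ‖t • u.eval z‖ ≤ δ / 2) :
    curveRatio B (2 * ρ) (graphCurve Φ u t) =
      (∫ z in Ioo 0 (2 * ρ), slice (pullback ρ δ Φ (calibration ρ)) (u.eval z) (u.2 z) z t) /
      ∫ z in Ioo 0 (2 * ρ),
        ‖slice (fderivWithin ℝ Φ (cylinder δ (2 * ρ))) (u.eval z) (u.2 z) z t‖ := by
  have hL : 0 < 2 * ρ := by linarith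
  have hae := ae_hasDerivAt_graph h.pos hL h.smooth u hu
  rw [curveRatio, intervalIntegral.integral_of_le hL.le, intervalIntegral.integral_of_le hL.le,
    integral_Ioc_eq_integral_Ioo, integral_Ioc_eq_integral_Ioo, ← h.integral_pullback_eq hρ u ht hu]
  congr 1
  · refine integral_congr_ae ?_
    filter_upwards [hae, ae_restrict_mem measurableSet_Ioo] with z hz hm
    have hm' := Ioo_subset_Icc_self hm
    have hd : deriv (graphCurve Φ u t) z = _ := hz.deriv
    rw [hd, slice_pullback, graphCurve, hB.eq_meissnerB hρ _
      (h.mapsTo (halfCylinder_subset h.pos _ (mem_halfCylinder (hu z hm') hm')))]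
  · refine integral_congr_ae ?_
    filter_upwards [hae] with z hz
    have hd : deriv (graphCurve Φ u t) z = _ := hz.deriv
    rw [hd]

/-- The derivative in `t` of the speed of a variation of the diameter. -/
noncomputable def speedD (ρ δ : ℝ) (Φ : E2 × ℝ → E3) (u h : E2) (z t : ℝ) : ℝ :=
  inner ℝ (slice (fderivWithin ℝ Φ (cylinder δ (2 * ρ))) u h z t)
    (sliceD δ (2 * ρ) (fderivWithin ℝ Φ (cylinder δ (2 * ρ))) u h z t) /
    ‖slice (fderivWithin ℝ Φ (cylinder δ (2 * ρ))) u h z t‖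

/-- The second derivative in `t` of the speed of a variation of the diameter. -/
noncomputable def speedDD (ρ δ : ℝ) (Φ : E2 × ℝ → E3) (u h : E2) (z t : ℝ) : ℝ :=
  (inner ℝ (slice (fderivWithin ℝ Φ (cylinder δ (2 * ρ))) u h z t)
      (sliceDD δ (2 * ρ) (fderivWithin ℝ Φ (cylinder δ (2 * ρ))) u h z t) +
    inner ℝ (sliceD δ (2 * ρ) (fderivWithin ℝ Φ (cylinder δ (2 * ρ))) u h z t)
      (sliceD δ (2 * ρ) (fderivWithin ℝ Φ (cylinder δ (2 * ρ))) u h z t)) /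
    ‖slice (fderivWithin ℝ Φ (cylinder δ (2 * ρ))) u h z t‖ -
  inner ℝ (slice (fderivWithin ℝ Φ (cylinder δ (2 * ρ))) u h z t)
      (sliceD δ (2 * ρ) (fderivWithin ℝ Φ (cylinder δ (2 * ρ))) u h z t) ^ 2 /
    ‖slice (fderivWithin ℝ Φ (cylinder δ (2 * ρ))) u h z t‖ ^ 3

theorem IsTubeChart.hasDerivAt_speed (hρ : 0 < ρ) (h : IsTubeChart ρ δ Φ) {c : ℝ} (hc : 0 < c)
    (hle : ∀ p ∈ halfCylinder δ (2 * ρ), ∀ k : E2,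
      c ≤ ‖fderivWithin ℝ Φ (cylinder δ (2 * ρ)) p (k, 1)‖)
    {u : E2} (k : E2) {z t : ℝ} (hz : z ∈ Icc 0 (2 * ρ)) (ht : ‖t • u‖ ≤ δ / 2) :
    HasDerivAt (fun s => ‖slice (fderivWithin ℝ Φ (cylinder δ (2 * ρ))) u k z s‖)
      (speedD ρ δ Φ u k z t) t ∧
    HasDerivAt (speedD ρ δ Φ u k z) (speedDD ρ δ Φ u k z t) t ∧
    |speedD ρ δ Φ u k z t| ≤
      ‖sliceD δ (2 * ρ) (fderivWithin ℝ Φ (cylinder δ (2 * ρ))) u k z t‖ ∧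
    |speedDD ρ δ Φ u k z t| ≤
      ‖sliceDD δ (2 * ρ) (fderivWithin ℝ Φ (cylinder δ (2 * ρ))) u k z t‖ +
      2 * ‖sliceD δ (2 * ρ) (fderivWithin ℝ Φ (cylinder δ (2 * ρ))) u k z t‖ ^ 2 / c := by
  have hL : 0 < 2 * ρ := by linarith
  have hD := h.contDiffOn_fderivWithin hρ
  have ht' : ‖t • u‖ < δ := ht.trans_lt (half_lt_self h.pos)
  have h0 : c ≤ ‖slice (fderivWithin ℝ Φ (cylinder δ (2 * ρ))) u k z t‖ :=
    hle _ (mem_halfCylinder ht hz) _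
  have h1 := hasDerivAt_slice hD k hz ht'
  obtain ⟨h2, h3, h4⟩ :=
    hasDerivAt_norm_twice h1 (hasDerivAt_sliceD h.pos hL hD k hz ht') hc h0
  exact ⟨hasDerivAt_norm h1 (norm_pos_iff.1 (hc.trans_le h0)), h2, h3, h4⟩

/-- At the diameter the calibration inequality is an equality to first order, and its second order
expansion gives the density of the second variation. -/
theorem IsTubeChart.defect_at_zero (hρ : 0 < ρ) (h : IsTubeChart ρ δ Φ) {z : ℝ}
    (hz : z ∈ Icc 0 (2 * ρ)) (u k : E2) :
    slice (pullback ρ δ Φ (calibration ρ)) u k z 0 =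
      maxRatio ρ * ‖slice (fderivWithin ℝ Φ (cylinder δ (2 * ρ))) u k z 0‖ ∧
    ‖slice (fderivWithin ℝ Φ (cylinder δ (2 * ρ))) u k z 0‖ = 1 ∧
    sliceD δ (2 * ρ) (pullback ρ δ Φ (calibration ρ)) u k z 0 =
      maxRatio ρ * speedD ρ δ Φ u k z 0 ∧
    maxRatio ρ * speedDD ρ δ Φ u k z 0 -
      sliceDD δ (2 * ρ) (pullback ρ δ Φ (calibration ρ)) u k z 0 =
      variationForm ρ δ Φ z (u, k) (u, k) := by
  have hL : 0 < 2 * ρ := by linarith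
  have hD := h.contDiffOn_fderivWithin hρ
  have hP := h.contDiffOn_pullback hρ (calibration_contDiff ρ)
  obtain ⟨c, hc, hle⟩ := h.exists_le_norm hρ
  have hnear : ∀ᶠ t : ℝ in 𝓝 0, ‖t • u‖ ≤ δ / 2 := by
    have hcont : Continuous fun s : ℝ => ‖s • u‖ := by fun_prop
    exact (hcont.tendsto 0).eventually_le_const (by simpa using h.pos)
  have hv0 : slice (fderivWithin ℝ Φ (cylinder δ (2 * ρ))) u k z 0 = eZ := by
    rw [slice, zero_smul, zero_smul, h.fderivWithin_axis hρ hz]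
  have hx0 : Φ ((0 : ℝ) • u, z) = (z - ρ) • eZ := by
    rw [zero_smul, h.axis z hz, diameterCurve]
  have hn0 : ‖slice (fderivWithin ℝ Φ (cylinder δ (2 * ρ))) u k z 0‖ = 1 := by
    rw [hv0, norm_eZ]
  have hs0 : slice (pullback ρ δ Φ (calibration ρ)) u k z 0 = maxRatio ρ := by
    rw [slice_pullback, hv0, hx0, inner_calibration]
    simp
  set P : ℝ → ℝ := fun t => maxRatio ρ *
    ‖slice (fderivWithin ℝ Φ (cylinder δ (2 * ρ))) u k z t‖ -
      slice (pullback ρ δ Φ (calibration ρ)) u k z t with hPdef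
  set P' : ℝ → ℝ := fun t => maxRatio ρ * speedD ρ δ Φ u k z t -
      sliceD δ (2 * ρ) (pullback ρ δ Φ (calibration ρ)) u k z t with hP'def
  have hder : ∀ᶠ t in 𝓝 0, HasDerivAt P (P' t) t := by
    filter_upwards [hnear] with t ht
    exact ((h.hasDerivAt_speed hρ hc hle k hz ht).1.const_mul _).sub
      (hasDerivAt_slice hP k hz (ht.trans_lt (half_lt_self h.pos)))
  have hder' : HasDerivAt P' (maxRatio ρ * speedDD ρ δ Φ u k z 0 -
      sliceDD δ (2 * ρ) (pullback ρ δ Φ (calibration ρ)) u k z 0) 0 :=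
    ((h.hasDerivAt_speed hρ hc hle k hz hnear.self_of_nhds).2.1.const_mul _).sub
      (hasDerivAt_sliceD h.pos hL hP k hz (hnear.self_of_nhds.trans_lt (half_lt_self h.pos)))
  have hPzero : P 0 = 0 := by rw [hPdef]; simp only [hn0, hs0]; ring
  -- The calibration has length at most `maxRatio ρ`, so the defect `P` has a minimum at `0`.
  have hmin : IsLocalMin P 0 := by
    filter_upwards [hnear] with t ht
    rw [hPzero]
    have h1 := norm_calibration_le hρ
      (h.mapsTo (halfCylinder_subset h.pos _ (mem_halfCylinder ht hz)))
    have h2 := real_inner_le_norm (calibration ρ (Φ (t • u, z)))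
      (slice (fderivWithin ℝ Φ (cylinder δ (2 * ρ))) u k z t)
    rw [hPdef]
    simp only [slice_pullback]
    have h3 := mul_le_mul_of_nonneg_right h1
      (norm_nonneg (slice (fderivWithin ℝ Φ (cylinder δ (2 * ρ))) u k z t))
    linarith
  have hP'zero : P' 0 = 0 := hmin.hasDerivAt_eq_zero hder.self_of_nhds
  refine ⟨by rw [hs0, hn0, mul_one], hn0, (sub_eq_zero.1 hP'zero).symm, ?_⟩
  have ht0 : ‖(0 : ℝ) • u‖ < δ := by simpa using h.pos
  have hx := ContDiffOn.hasDerivAt_slice h.smooth hz ht0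
  have hv := hasDerivAt_slice hD k hz ht0
  have hlim := tendsto_defect_div_sq (ρ := ρ) hx hv hx0 hv0
  have heq := tendsto_nhds_unique (tendsto_div_sq hder hder' hPzero hP'zero) hlim
  rw [variationForm_apply_self, displacementD_apply, displacement_apply]
  rw [zero_smul] at heq
  linarith

/-- The second derivative of the ratio along a variation of the diameter. -/
theorem IsTubeChart.hasSecondDerivAt_curveRatio (hρ : 0 < ρ) (h : IsTubeChart ρ δ Φ)
    {B : E3 → E3} (hB : IsMeissnerField ρ B) (u : H1 (2 * ρ)) :
    HasSecondDerivAt (fun t => curveRatio B (2 * ρ) (graphCurve Φ u t))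
      (-((2 * ρ)⁻¹ * ∫ z in Ioo 0 (2 * ρ), variationForm ρ δ Φ z (u.jet z) (u.jet z))) 0 := by
  have hL : 0 < 2 * ρ := by linarith
  have hδ := h.pos
  have hD := h.contDiffOn_fderivWithin hρ
  have hP := h.contDiffOn_pullback hρ (calibration_contDiff ρ)
  obtain ⟨c, hc, hle⟩ := h.exists_le_norm hρ
  obtain ⟨U, hU0, hU⟩ := u.exists_bound_eval hL.le
  obtain ⟨K, hK0, hK⟩ := exists_bound_slice hδ hL hD
  obtain ⟨K', hK'0, hK'⟩ := exists_bound_slice hδ hL hP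
  -- For `|t| < ε` the graph of `t u` stays in the half cylinder.
  set ε : ℝ := min 1 (δ / 2 / (U + 1)) with hε
  have hεpos : 0 < ε := lt_min one_pos (by positivity)
  have hgood : ∀ t, |t| < ε → |t| ≤ 1 ∧ ∀ z ∈ Icc 0 (2 * ρ), ‖t • u.eval z‖ ≤ δ / 2 := by
    intro t ht
    refine ⟨(ht.trans_le (min_le_left _ _)).le, fun z hz => ?_⟩
    have h1 := (ht.trans_le (min_le_right _ _)).le
    rw [le_div_iff₀ (by positivity)] at h1
    rw [norm_smul, Real.norm_eq_abs]
    refine le_trans (mul_le_mul_of_nonneg_left ?_ (abs_nonneg t)) h1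
    linarith [hU z hz]
  have hhalf : ∀ {w : E2}, ‖w‖ ≤ δ / 2 → ‖w‖ < δ := fun hw => hw.trans_lt (half_lt_self hδ)
  set W : ℝ := (1 + U) ^ 2 with hW
  have hW1 : 1 ≤ W := by rw [hW]; nlinarith
  have hint : Integrable (fun z => (1 + ‖u.2 z‖) ^ 2) (volume.restrict (Ioo 0 (2 * ρ))) := by
    have h1 : Integrable (fun z => 1 + 2 * ‖u.2 z‖ + ‖u.2 z‖ ^ 2)
        (volume.restrict (Ioo 0 (2 * ρ))) :=
      ((integrable_const 1).add ((u.memLp.integrable (by norm_num)).norm.const_mul 2)).add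
        u.integrable_norm_sq
    refine h1.congr (Eventually.of_forall fun z => ?_)
    ring
  have hlin : ∀ {C x : ℝ}, 0 ≤ C → 0 ≤ x → C * (1 + x) ≤ C * W * (1 + x) ^ 2 := by
    intro C x hC hx
    calc C * (1 + x) = C * 1 * (1 + x) := by ring
      _ ≤ C * W * (1 + x) ^ 2 := by gcongr; nlinarith
  have hlin' : ∀ {C x : ℝ}, 0 ≤ C → 0 ≤ x → C * W * (1 + x) ≤ C * W * (1 + x) ^ 2 := by
    intro C x hC hx
    gcongr
    nlinarith
  have hpoint : ∀ z ∈ Icc 0 (2 * ρ), (1 + ‖u.eval z‖) ^ 2 ≤ W := fun z hz => by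
    rw [hW]; gcongr; exact hU z hz
  obtain ⟨f1, f2, -, -, f5⟩ := hasDerivAt_integral_twice (μ := volume.restrict (Ioo 0 (2 * ρ)))
    (g := fun t z => slice (pullback ρ δ Φ (calibration ρ)) (u.eval z) (u.2 z) z t)
    (g' := fun t z => sliceD δ (2 * ρ) (pullback ρ δ Φ (calibration ρ)) (u.eval z) (u.2 z) z t)
    (g'' := fun t z => sliceDD δ (2 * ρ) (pullback ρ δ Φ (calibration ρ)) (u.eval z) (u.2 z) z t)
    hεpos (hint.const_mul (K' * W))
    (fun t ht => (integrable_slice hδ hL hP u (hgood t ht).1 (hgood t ht).2).1) (by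
      filter_upwards [ae_restrict_mem measurableSet_Ioo] with z hm t ht
      have hz := Ioo_subset_Icc_self hm
      obtain ⟨ht1, hu⟩ := hgood t ht
      obtain ⟨b0, b1, b2⟩ := hK' _ (u.2 z) z t hz ht1 (hu z hz)
      have hx := norm_nonneg (u.2 z)
      have hm1 : K' * (1 + ‖u.eval z‖) ^ 2 * (1 + ‖u.2 z‖) ≤ K' * W * (1 + ‖u.2 z‖) := by
        gcongr; exact hpoint z hz
      exact ⟨b0.trans (hlin hK'0 hx), hasDerivAt_slice hP _ hz (hhalf (hu z hz)),
        (b1.trans hm1).trans (hlin' hK'0 hx), hasDerivAt_sliceD hδ hL hP _ hz (hhalf (hu z hz)),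
        (b2.trans hm1).trans (hlin' hK'0 hx)⟩)
  obtain ⟨n1, n2, -, -, n5⟩ := hasDerivAt_integral_twice (μ := volume.restrict (Ioo 0 (2 * ρ)))
    (g := fun t z =>
      ‖slice (fderivWithin ℝ Φ (cylinder δ (2 * ρ))) (u.eval z) (u.2 z) z t‖)
    (g' := fun t z => speedD ρ δ Φ (u.eval z) (u.2 z) z t)
    (g'' := fun t z => speedDD ρ δ Φ (u.eval z) (u.2 z) z t)
    hεpos (hint.const_mul (K * W + 2 * (K * W) ^ 2 / c))
    (fun t ht => (integrable_slice hδ hL hD u (hgood t ht).1 (hgood t ht).2).1.norm) (by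
      filter_upwards [ae_restrict_mem measurableSet_Ioo] with z hm t ht
      have hz := Ioo_subset_Icc_self hm
      obtain ⟨ht1, hu⟩ := hgood t ht
      obtain ⟨b0, b1, b2⟩ := hK _ (u.2 z) z t hz ht1 (hu z hz)
      obtain ⟨d1, d2, d3, d4⟩ := h.hasDerivAt_speed hρ hc hle (u.2 z) hz (hu z hz)
      have hx := norm_nonneg (u.2 z)
      have hm1 : K * (1 + ‖u.eval z‖) ^ 2 * (1 + ‖u.2 z‖) ≤ K * W * (1 + ‖u.2 z‖) := by
        gcongr; exact hpoint z hz
      have hmore : K * W * (1 + ‖u.2 z‖) ^ 2 ≤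
          (K * W + 2 * (K * W) ^ 2 / c) * (1 + ‖u.2 z‖) ^ 2 := by
        gcongr
        have : 0 ≤ 2 * (K * W) ^ 2 / c := by positivity
        linarith
      have hsq : 2 * ‖sliceD δ (2 * ρ) (fderivWithin ℝ Φ (cylinder δ (2 * ρ)))
          (u.eval z) (u.2 z) z t‖ ^ 2 / c ≤ 2 * (K * W * (1 + ‖u.2 z‖)) ^ 2 / c := by
        gcongr
        exact b1.trans hm1
      refine ⟨?_, d1, (d3.trans (b1.trans hm1)).trans ((hlin' hK0 hx).trans hmore), d2, ?_⟩
      · rw [abs_norm]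
        exact b0.trans ((hlin hK0 hx).trans hmore)
      · refine (d4.trans (add_le_add ((b2.trans hm1).trans (hlin' hK0 hx)) hsq)).trans (le_of_eq ?_)
        ring)
  have hlen : ∫ z in Ioo 0 (2 * ρ),
      ‖slice (fderivWithin ℝ Φ (cylinder δ (2 * ρ))) (u.eval z) (u.2 z) z 0‖ = 2 * ρ := by
    rw [setIntegral_congr_fun measurableSet_Ioo fun z hz =>
      (h.defect_at_zero hρ (Ioo_subset_Icc_self hz) (u.eval z) (u.2 z)).2.1]
    simp [hL.le]
  have hR : ∫ z in Ioo 0 (2 * ρ),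
      slice (pullback ρ δ Φ (calibration ρ)) (u.eval z) (u.2 z) z 0 = maxRatio ρ *
      ∫ z in Ioo 0 (2 * ρ),
        ‖slice (fderivWithin ℝ Φ (cylinder δ (2 * ρ))) (u.eval z) (u.2 z) z 0‖ := by
    rw [← integral_const_mul]
    exact setIntegral_congr_fun measurableSet_Ioo fun z hz =>
      (h.defect_at_zero hρ (Ioo_subset_Icc_self hz) (u.eval z) (u.2 z)).1
  have hR' : ∫ z in Ioo 0 (2 * ρ),
      sliceD δ (2 * ρ) (pullback ρ δ Φ (calibration ρ)) (u.eval z) (u.2 z) z 0 = maxRatio ρ *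
      ∫ z in Ioo 0 (2 * ρ), speedD ρ δ Φ (u.eval z) (u.2 z) z 0 := by
    rw [← integral_const_mul]
    exact setIntegral_congr_fun measurableSet_Ioo fun z hz =>
      (h.defect_at_zero hρ (Ioo_subset_Icc_self hz) (u.eval z) (u.2 z)).2.2.1
  have hsecond := HasSecondDerivAt.div f1 f2 n1 n2 (by rw [hlen]; exact hL.ne') hR hR'
  have hval : ∫ z in Ioo 0 (2 * ρ), variationForm ρ δ Φ z (u.jet z) (u.jet z) =
      maxRatio ρ * (∫ z in Ioo 0 (2 * ρ), speedDD ρ δ Φ (u.eval z) (u.2 z) z 0) -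
      ∫ z in Ioo 0 (2 * ρ),
        sliceDD δ (2 * ρ) (pullback ρ δ Φ (calibration ρ)) (u.eval z) (u.2 z) z 0 := by
    rw [← integral_const_mul, ← integral_sub (n5.const_mul _) f5]
    exact setIntegral_congr_fun measurableSet_Ioo fun z hz =>
      (h.defect_at_zero hρ (Ioo_subset_Icc_self hz) (u.eval z) (u.2 z)).2.2.2.symm
  rw [hlen] at hsecond
  have hq : -((2 * ρ)⁻¹ * ∫ z in Ioo 0 (2 * ρ), variationForm ρ δ Φ z (u.jet z) (u.jet z)) =
      ((∫ z in Ioo 0 (2 * ρ),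
        sliceDD δ (2 * ρ) (pullback ρ δ Φ (calibration ρ)) (u.eval z) (u.2 z) z 0) -
      maxRatio ρ * (∫ z in Ioo 0 (2 * ρ), speedDD ρ δ Φ (u.eval z) (u.2 z) z 0)) / (2 * ρ) := by
    rw [hval]
    field_simp
    ring
  rw [hq]
  refine hsecond.congr ?_
  have hev : ∀ᶠ t : ℝ in 𝓝 0, |t| < ε :=
    (continuous_abs.tendsto 0).eventually_lt_const (by simpa using hεpos)
  filter_upwards [hev] with t ht
  exact h.curveRatio_eq hρ hB u (hgood t ht).1 (hgood t ht).2

end Chart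

theorem stronglyNondegenerate {ρ : ℝ} (hρ : 0 < ρ) {B : E3 → E3} (hB : IsMeissnerField ρ B) :
    StronglyNondegenerate ρ B := by
  refine ⟨diameterMaximizes hρ hB, fun δ Φ h => ?_⟩
  obtain ⟨Q, hQ, c, hc, hle⟩ := exists_quadraticForm (by linarith)
    (h.continuousOn_variationForm hρ) fun z hz w hw => h.variationForm_pos hρ hz hw
  have hinv : 0 < (2 * ρ)⁻¹ := by positivity
  refine ⟨(2 * ρ)⁻¹ • Q, fun u => ?_, (2 * ρ)⁻¹ * c, by positivity, fun u => ?_⟩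
  · rw [smul_apply, smul_eq_mul, hQ]
    exact h.hasSecondDerivAt_curveRatio hρ hB u
  · rw [smul_apply, smul_eq_mul, mul_assoc]
    exact mul_le_mul_of_nonneg_left (hle u) hinv.le

end Isoflux

theorem proposition3 :
    ∃ ρ₀ : ℝ, 0 < ρ₀ ∧ ∀ ρ : ℝ, 0 < ρ → ρ < ρ₀ →
      ∀ B : Isoflux.E3 → Isoflux.E3, Isoflux.IsMeissnerField ρ B →
        Isoflux.StronglyNondegenerate ρ B :=
  ⟨1, one_pos, fun _ hρ _ _ hB => Isoflux.stronglyNondegenerate hρ hB⟩
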